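/- Let $M,N$ be positive integers, $\mathbb T^N=\mathbb R^N/\mathbb Z^N$, and let $H_1,\dots,H_M:\mathbb T^N\times\mathbb R^N\to\mathbb R$ be continuous, and convex and superlinear in the second variable, with Lagrangians $L_i(x,q)=\max_{p\in\mathbb R^N}\big(p\cdot q-H_i(x,p)\big)$. Let $\Lambda$ be a real $M\times M$ matrix whose off-diagonal entries are nonpositive, whose rows sum to $0$, and which is irreducible (for every nonempty $I\subsetneq\{1,\dots,M\}$ there are $i\in I$, $j\notin I$ with $\Lambda_{ij}\ne0$); $\Lambda^i$ is its $i$-th row. For $\alpha\in\mathbb R$ consider the system $$H_i(x,Du_i)+\Lambda^i\cdot\mathbf u=\alpha\quad\text{in }\mathbb T^N,\qquad i=1,\dots,M. \tag{HJ$\alpha$}$$ A continuous $\mathbf u:\mathbb T^N\to\mathbb R^M$ is a subsolution if $H_i(x,D\psi(x))+\Lambda^i\cdot\mathbf u(x)\le\alpha$ whenever $\psi\in C^1(\mathbb T^N)$ and $u_i-\psi$ attains a maximum at $x$. Let $\gamma$ be the infimum of the $\alpha$ for which (HJ$\alpha$) has a subsolution. Let $\mathcal D$ be the space of cadlag paths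 $\omega:[0,\infty)\to\{1,\dots,M\}$ with the $\sigma$-algebra generated by the evaluations, and the filtration $\mathcal F_t$ generated by the evaluations at times $s\le t$. Let $\mathbb P_i$ be the unique probability measure on $\mathcal D$ such that, for $0\le t_1<\dots<t_k$ and indices $j_1,\dots,j_k$, $$\mathbb P_i\{\omega(t_1)=j_1,\dots,\omega(t_k)=j_k\}=\big(e^{-t_1\Lambda}\big)_{i\,j_1}\prod_{l=2}^k\big(e^{-(t_l-t_{l-1})\Lambda}\big)_{j_{l-1}j_l},$$ and $\mathbb E_i$ its expectation; "a.s." means $\mathbb P_i$-a.s. for every $i$. Stopping times are meant with respect to $(\mathcal F_t)$. A control is a measurable map $\Xi$ from $\mathcal D$ to the cadlag paths $[0,\infty)\to\mathbb R^N$ (with the $\sigma$-algebra generated by the evaluations) such that for every $t>0$ there is $R>0$ with $\sup_{[0,t]}|\Xi|<R$ a.s., and such that $\omega_1=\omega_2$ on $[0,t]$ implies $\Xi(\omega_1)=\Xi(\omega_2)$ on $[0,t]$. Let $\mathcal I(\Xi)(t)\in\mathbb T^N$ be the projection of $\int_0^t\Xi\,ds$. **Theorem.** Let $\alpha\ge\gamma$,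 $y\in\mathbb T^N$ and $\mathbf b\in\mathbb R^M$. For $x\in\mathbb T^N$ and $i=1,\dots,M$ set $$v_i(x)=\inf\ \mathbb E_i\left[\int_0^\tau \Big(L_{\omega(s)}\big(x+\mathcal I(\Xi)(s),-\Xi(s)\big)+\alpha\Big)\,ds+b_{\omega(\tau)}\right],$$ where the infimum is over all bounded stopping times $\tau$ and all controls $\Xi$ with $x+\mathcal I(\Xi)(\tau)=y$ a.s. Then the integrals and expectations are well defined, the infimum is over a nonempty set and is finite, and $\mathbf v=(v_1,\dots,v_M)$ is a Lipschitz continuous subsolution of (HJ$\alpha$). -/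

import Mathlib

open MeasureTheory Filter Topology Set
open scoped NNReal ENNReal

noncomputable section

namespace HJSystem

/-! ## The flat torus, the Hamiltonians and the coupling matrix -/

/-- The Euclidean space `ℝ^N`. -/
abbrev Euc (N : ℕ) := EuclideanSpace ℝ (Fin N)

/-- The flat torus `𝕋^N = ℝ^N / ℤ^N`, an additive group. -/
abbrev Torus (N : ℕ) := UnitAddTorus (Fin N)

/-- The projection of `ℝ^N` onto `𝕋^N`. -/
def proj {N : ℕ} (z : Euc N) : Torus N := fun k => ((z k : ℝ) : UnitAddCircle)

/-- The standing assumptions on the Hamiltonians `H i : 𝕋^N × ℝ^N → ℝ` and on the coupling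
matrix `Λ`. -/
structure StandingAssumptions {M N : ℕ} (H : Fin M → Torus N → Euc N → ℝ)
    (Λ : Matrix (Fin M) (Fin M) ℝ) : Prop where
  /-- each Hamiltonian is continuous in both variables -/
  continuous : ∀ i, Continuous fun z : Torus N × Euc N => H i z.1 z.2
  /-- each Hamiltonian is convex in the momentum -/
  convex : ∀ i x, ConvexOn ℝ univ (H i x)
  /-- each Hamiltonian is superlinear in the momentum -/
  superlinear : ∀ i x, Tendsto (fun p => H i x p / ‖p‖) (Bornology.cobounded (Euc N)) atTop
  /-- the entries of `Λ` off the diagonal are nonpositive -/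
  offDiag_nonpos : ∀ i j, i ≠ j → Λ i j ≤ 0
  /-- the rows of `Λ` sum to zero -/
  row_sum : ∀ i, ∑ j, Λ i j = 0
  /-- `Λ` is irreducible -/
  irreducible : ∀ I : Set (Fin M), I.Nonempty → I ≠ univ → ∃ i ∈ I, ∃ j ∉ I, Λ i j ≠ 0

/-- The Lagrangian `L_i(x,q) = max_p (p · q - H_i(x,p))`. -/
def lagrangian {M N : ℕ} (H : Fin M → Torus N → Euc N → ℝ) (i : Fin M) (x : Torus N)
    (q : Euc N) : ℝ :=
  ⨆ p : Euc N, (inner ℝ p q - H i x p)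

/-- Viscosity subsolutions of the system `H_i(x, Du_i) + Λ^i · u = α` on the torus. A test
function `ψ` on `𝕋^N` is of class `C^1` when its `ℤ^N`-periodic lift to `ℝ^N` is, and its gradient
at `proj z` is the gradient of the lift at `z`. -/
def IsSubsolution {M N : ℕ} (H : Fin M → Torus N → Euc N → ℝ) (Λ : Matrix (Fin M) (Fin M) ℝ)
    (α : ℝ) (u : Torus N → Fin M → ℝ) : Prop :=
  Continuous u ∧
    ∀ (i : Fin M) (ψ : Torus N → ℝ), ContDiff ℝ 1 (fun w : Euc N => ψ (proj w)) →
      ∀ z : Euc N, (∀ x : Torus N, u x i - ψ x ≤ u (proj z) i - ψ (proj z)) →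
        H i (proj z) (gradient (fun w : Euc N => ψ (proj w)) z) + ∑ j, Λ i j * u (proj z) j ≤ α

/-- The critical value `γ`, the infimum of the `α` for which the system admits subsolutions. -/
def criticalValue {M N : ℕ} (H : Fin M → Torus N → Euc N → ℝ)
    (Λ : Matrix (Fin M) (Fin M) ℝ) : ℝ :=
  sInf {α : ℝ | ∃ u : Torus N → Fin M → ℝ, IsSubsolution H Λ α u}

/-! ## Spaces of cadlag paths -/

/-- Cadlag paths on `[0,∞)`: right continuous with left limits. -/
def IsCadlag {E : Type*} [TopologicalSpace E] (f : ℝ≥0 → E) : Prop :=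
  ∀ t, ContinuousWithinAt f (Ici t) t ∧ ∃ l, Tendsto f (𝓝[<] t) (𝓝 l)

/-- The space of cadlag paths with values in `E`. It carries the σ-algebra generated by the
evaluation maps, that is by the cylinders. -/
abbrev CadlagPath (E : Type*) [TopologicalSpace E] := {f : ℝ≥0 → E // IsCadlag f}

/-- The space `𝓓` of cadlag paths with values in the set of the `M` indices (with its discrete
topology). -/
abbrev IndexPath (M : ℕ) := CadlagPath (Fin M)

/-- The filtration `(𝓕_t)` of `𝓓`: `𝓕_t` is generated by the evaluations at the times `s ≤ t`. -/
def pathFiltration (M : ℕ) :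
    Filtration ℝ≥0 (inferInstance : MeasurableSpace (IndexPath M)) where
  seq t := ⨆ s : Iic t, MeasurableSpace.comap (fun ω : IndexPath M => ω.1 s) inferInstance
  mono' _ _ h := iSup_le fun s =>
    le_iSup (fun r : Iic _ => MeasurableSpace.comap (fun ω : IndexPath M => ω.1 r) inferInstance)
      ⟨s.1, s.2.trans h⟩
  le' _ := iSup_le fun s =>
    Measurable.comap_le ((measurable_pi_apply s.1).comp measurable_subtype_coe)

/-! ## The probability measures on the space of index paths -/

/-- The weight
`(a e^{-t₀Λ})_{j₀} ∏_l (e^{-(t_{l+1}-t_l)Λ})_{j_l j_{l+1}}` of the cylinder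
`{ω | ω(t₀) = j₀, …, ω(t_k) = j_k}`. -/
def cylinderWeight {M : ℕ} (Λ : Matrix (Fin M) (Fin M) ℝ) (a : Fin M → ℝ) {k : ℕ}
    (t : Fin (k + 1) → ℝ≥0) (j : Fin (k + 1) → Fin M) : ℝ :=
  (Matrix.vecMul a (NormedSpace.exp (-(t 0 : ℝ) • Λ))) (j 0) *
    ∏ l : Fin k,
      (NormedSpace.exp (-((t l.succ : ℝ) - (t l.castSucc : ℝ)) • Λ)) (j l.castSucc) (j l.succ)

/-- `μ` is a probability measure on `𝓓` which extends the weights of the cylinders. -/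
def ExtendsCylinderWeight {M : ℕ} (Λ : Matrix (Fin M) (Fin M) ℝ) (a : Fin M → ℝ)
    (μ : Measure (IndexPath M)) : Prop :=
  IsProbabilityMeasure μ ∧
    ∀ (k : ℕ) (t : Fin (k + 1) → ℝ≥0) (j : Fin (k + 1) → Fin M), StrictMono t →
      μ {ω | ∀ l, ω.1 (t l) = j l} = ENNReal.ofReal (cylinderWeight Λ a t j)

/-- At most one probability measure extends the weights of the cylinders. -/
theorem ExtendsCylinderWeight.unique {M : ℕ} {Λ : Matrix (Fin M) (Fin M) ℝ} {a : Fin M → ℝ}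
    {μ ν : Measure (IndexPath M)} (hμ : ExtendsCylinderWeight Λ a μ)
    (hν : ExtendsCylinderWeight Λ a ν) : μ = ν := by
  have := hμ.1
  have := hν.1
  let C : Set (Set (IndexPath M)) :=
    {A | ∃ (I : Finset ℝ≥0) (j : ℝ≥0 → Fin M), A = {ω | ∀ s ∈ I, ω.1 s = j s}} ∪ {∅}
  have key : ∀ A ∈ C, μ A = ν A := by
    rintro A (⟨I, j, rfl⟩ | rfl)
    · rcases Nat.eq_zero_or_pos I.card with h0 | hpos
      · rw [Finset.card_eq_zero] at h0
        subst h0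
        simp
      · obtain ⟨k, hk⟩ := Nat.exists_eq_succ_of_ne_zero hpos.ne'
        let t := I.orderEmbOfFin hk
        have hset : {ω : IndexPath M | ∀ s ∈ I, ω.1 s = j s}
            = {ω : IndexPath M | ∀ l, ω.1 (t l) = j (t l)} := by
          ext ω
          constructor
          · intro h l
            exact h _ (I.orderEmbOfFin_mem hk l)
          · intro h s hs
            have : s ∈ Set.range t := by
              rw [Finset.range_orderEmbOfFin]
              exact hs
            obtain ⟨l, rfl⟩ := this
            exact h l
        rw [hset, hμ.2 k t _ t.strictMono, hν.2 k t _ t.strictMono]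
    · simp
  have hpi : IsPiSystem C := by
    rintro A (⟨I, j, rfl⟩ | rfl) B (⟨J, i, rfl⟩ | rfl) hne
    · obtain ⟨ω, h1, h2⟩ := hne
      refine Or.inl ⟨I ∪ J, ω.1, ?_⟩
      ext η
      constructor
      · rintro ⟨h3, h4⟩ s hs
        rcases Finset.mem_union.1 hs with h | h
        · rw [h3 s h, h1 s h]
        · rw [h4 s h, h2 s h]
      · intro h
        exact ⟨fun s hs => by rw [h s (Finset.mem_union_left _ hs), h1 s hs],
          fun s hs => by rw [h s (Finset.mem_union_right _ hs), h2 s hs]⟩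
    · simp at hne
    · simp at hne
    · simp at hne
  have hgen : (inferInstance : MeasurableSpace (IndexPath M)) = MeasurableSpace.generateFrom C := by
    apply le_antisymm
    · have hid : @Measurable _ _ (MeasurableSpace.generateFrom C) _
          (fun ω : IndexPath M => ω.1) := by
        refine @measurable_pi_lambda _ _ _ (MeasurableSpace.generateFrom C) _ _ fun s => ?_
        refine @measurable_to_countable' _ _ _ _ (MeasurableSpace.generateFrom C) _ fun i => ?_
        refine MeasurableSpace.measurableSet_generateFrom (Or.inl ⟨{s}, fun _ => i, ?_⟩)
        ext ω
        simp
      exact hid.comap_le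
    · refine MeasurableSpace.generateFrom_le ?_
      rintro A (⟨I, j, rfl⟩ | rfl)
      · have : {ω : IndexPath M | ∀ s ∈ I, ω.1 s = j s}
            = ⋂ s ∈ I, (fun ω : IndexPath M => ω.1 s) ⁻¹' {j s} := by
          ext ω
          simp
        rw [this]
        exact Finset.measurableSet_biInter I fun s _ =>
          ((measurable_pi_apply s).comp measurable_subtype_coe) (measurableSet_singleton _)
      · exact MeasurableSet.empty
  exact ext_of_generate_finite C hgen hpi key (by rw [measure_univ, measure_univ])

/-- The probability measure `ℙ_a` on `𝓓`: the unique one that extends the weights of the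
cylinders. (It exists, by the extension theorem of Kolmogorov, when `a` is a probability vector
and the matrices `e^{-tΛ}` are stochastic.) -/
def pathMeasure {M : ℕ} (Λ : Matrix (Fin M) (Fin M) ℝ) (a : Fin M → ℝ) :
    Measure (IndexPath M) :=
  Classical.epsilon (ExtendsCylinderWeight Λ a)

/-- The measure `ℙ_i`, for the initial distribution concentrated at the index `i`. -/
def pathMeasureAt {M : ℕ} (Λ : Matrix (Fin M) (Fin M) ℝ) (i : Fin M) : Measure (IndexPath M) :=
  pathMeasure Λ (Pi.single i 1)

/-- A property holds almost surely when it holds up to a set that is null for all the `ℙ_i`;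
these are the null sets of `ℙ_a`, for any probability vector `a` with positive components. -/
def AlmostSurely {M : ℕ} (Λ : Matrix (Fin M) (Fin M) ℝ) (p : IndexPath M → Prop) : Prop :=
  ∀ i, ∀ᵐ ω ∂(pathMeasureAt Λ i), p ω

/-! ## Stopping times, controls and the value function -/

/-- Bounded stopping times for the filtration `(𝓕_t)`. -/
def IsBoundedStoppingTime {M : ℕ} (τ : IndexPath M → ℝ≥0) : Prop :=
  IsStoppingTime (pathFiltration M) (fun ω => (τ ω : WithTop ℝ≥0)) ∧ ∃ T, ∀ ω, τ ω ≤ T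

/-- Admissible controls: random variables with values in the space of cadlag paths in `ℝ^N` which
are locally (in time) bounded and nonanticipating. -/
structure IsControl {M N : ℕ} (Λ : Matrix (Fin M) (Fin M) ℝ)
    (Ξ : IndexPath M → CadlagPath (Euc N)) : Prop where
  measurable : Measurable Ξ
  locallyBounded : ∀ t : ℝ≥0, 0 < t → ∃ R : ℝ, 0 < R ∧
    AlmostSurely Λ fun ω => ∀ s ≤ t, ‖(Ξ ω).1 s‖ < R
  nonanticipating : ∀ t : ℝ≥0, 0 < t → ∀ ω₁ ω₂ : IndexPath M,
    (∀ s ≤ t, ω₁.1 s = ω₂.1 s) → ∀ s ≤ t, (Ξ ω₁).1 s = (Ξ ω₂).1 s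

/-- The curve `𝓘(ξ)(t) = proj (∫_0^t ξ ds)` on the torus. -/
def curve {N : ℕ} (ξ : CadlagPath (Euc N)) (t : ℝ≥0) : Torus N :=
  proj (∫ s in (0 : ℝ)..t, ξ.1 s.toNNReal)

/-- The class `𝓚(τ, z)` of the controls `Ξ` with `𝓘(Ξ)(τ) = z` almost surely. -/
def controlsTo {M N : ℕ} (Λ : Matrix (Fin M) (Fin M) ℝ) (τ : IndexPath M → ℝ≥0) (z : Torus N) :
    Set (IndexPath M → CadlagPath (Euc N)) :=
  {Ξ | IsControl Λ Ξ ∧ AlmostSurely Λ fun ω => curve (Ξ ω) (τ ω) = z}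

/-- The integrand `L_{ω(s)}(x + 𝓘(ξ)(s), -ξ(s)) + α` of the action, as a function of the real
time `s` (only `s ≥ 0` matters). -/
def actionIntegrand {M N : ℕ} (H : Fin M → Torus N → Euc N → ℝ) (α : ℝ) (x : Torus N)
    (ω : IndexPath M) (ξ : CadlagPath (Euc N)) (s : ℝ) : ℝ :=
  lagrangian H (ω.1 s.toNNReal) (x + curve ξ s.toNNReal) (-(ξ.1 s.toNNReal)) + α

/-- The random cost
`∫_0^τ (L_{ω(s)}(x + 𝓘(Ξ)(s), -Ξ(s)) + α) ds + b_{ω(τ)}`. -/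
def cost {M N : ℕ} (H : Fin M → Torus N → Euc N → ℝ) (α : ℝ) (b : Fin M → ℝ) (x : Torus N)
    (τ : IndexPath M → ℝ≥0) (Ξ : IndexPath M → CadlagPath (Euc N)) (ω : IndexPath M) : ℝ :=
  (∫ s in (0 : ℝ)..(τ ω), actionIntegrand H α x ω (Ξ ω) s) + b (ω.1 (τ ω))

/-- The expected costs `𝔼_i[…]` of the bounded stopping times `τ` and the controls
`Ξ ∈ 𝓚(τ, y - x)`. -/
def expectedCosts {M N : ℕ} (H : Fin M → Torus N → Euc N → ℝ) (Λ : Matrix (Fin M) (Fin M) ℝ)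
    (α : ℝ) (y : Torus N) (b : Fin M → ℝ) (x : Torus N) (i : Fin M) : Set ℝ :=
  {r | ∃ τ : IndexPath M → ℝ≥0, IsBoundedStoppingTime τ ∧
    ∃ Ξ ∈ controlsTo (N := N) Λ τ (y - x), r = ∫ ω, cost H α b x τ Ξ ω ∂(pathMeasureAt Λ i)}

/-- The value function `v = (v_1, …, v_M)`, the infimum of the expected costs. -/
def valueFunction {M N : ℕ} (H : Fin M → Torus N → Euc N → ℝ) (Λ : Matrix (Fin M) (Fin M) ℝ)
    (α : ℝ) (y : Torus N) (b : Fin M → ℝ) (x : Torus N) (i : Fin M) : ℝ :=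
  sInf (expectedCosts H Λ α y b x i)

end HJSystem

end

open HJSystem

/-! The theorem combines a comparison principle (finiteness) with a dynamic programming inequality
(regularity and the subsolution property). Both rest on the Markov property of the index process.

The measures. `pathMeasureAt` is defined by choice among the measures with prescribed cylinder
weights, so a concrete process is built by uniformization: independent exponential holding times of
one common rate `r`, and independent random maps of the indices with transition matrix `1 - Λ / r`.
Conditioning on the first mark yields a renewal equation, which is the linear system `G' = -Λ G`;
hence the semigroup `e^{-tΛ}` and the Markov property at deterministic times come out together
(`jumpLaw_shiftEvent_eq`). Uniqueness identifies the process with the chosen measure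
(`pathMeasureAt_eq`).

Finiteness. Straight lines run in unit time give admissible pairs with bounded cost. For the lower
bound, let `u` be a subsolution. Along a curve with frozen index `j`, `u_j` decreases by at most the
integral of `L_j + α - Λ^j · u` (`IsSubsolution.sub_le_action`). Since `u` is only continuous, this
is shown for differentiable approximations, obtained by sup-convolution and averaging over a small
ball; convexity of the Hamiltonian preserves the inequality. The jumps of the index change `u_ω` at
the mean rate `-Λ^ω · u`, so the coupling cancels, and `u_i(x)` is at most the expected action plus
the final value of `u` (`IsSubsolution.le_integral`). The cancellation is performed on a time grid,
where it is exact on each cell, and the mesh then tends to zero. As the critical level is not known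
to be attained, subsolutions at the levels `α + ε` are used. Irreducibility bounds their oscillation
uniformly (`StandingAssumptions.exists_subsolution_osc_bound`), and the extra cost `ε 𝔼 τ`
disappears as `ε → 0` because `τ` is bounded.

The value function. Moving with constant velocity `q` for a time `t` and then restarting a nearly
optimal strategy according to the index reached gives `StandingAssumptions.valueFunction_le`. With
unit speed it gives the Lipschitz bound. Divided by `t → 0` at a point where a test function `ψ`
touches `v_i` from above, it gives `L_i(x, -q) + α - Λ^i · v(x) + Dψ(x) · q ≥ 0` for every `q`, and
convex duality turns this into the viscosity inequality. -/

noncomputable section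

namespace HJSystem

/-! ## The transition semigroup `e^{-tΛ}` -/

/-- The transition matrices `e^{-tΛ}`. -/
def transition {M : ℕ} (Λ : Matrix (Fin M) (Fin M) ℝ) (t : ℝ) : Matrix (Fin M) (Fin M) ℝ :=
  NormedSpace.exp (-t • Λ)

section Transition

variable {M : ℕ} (Λ : Matrix (Fin M) (Fin M) ℝ)

@[simp] lemma transition_zero : transition Λ 0 = 1 := by simp [transition]

lemma transition_add (s t : ℝ) : transition Λ (s + t) = transition Λ s * transition Λ t := by
  unfold transition
  rw [neg_add, add_smul]
  exact Matrix.exp_add_of_commute _ _ (((Commute.refl Λ).smul_left _).smul_right _)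

lemma hasDerivAt_transition (t : ℝ) (i j : Fin M) :
    HasDerivAt (fun t => transition Λ t i j) (-(Λ * transition Λ t) i j) t := by
  -- A local choice of norm makes the matrices a Banach algebra; the derivative of an entry does not
  -- depend on it.
  let _ : NormedRing (Matrix (Fin M) (Fin M) ℝ) := Matrix.linftyOpNormedRing
  let _ : NormedAlgebra ℝ (Matrix (Fin M) (Fin M) ℝ) := Matrix.linftyOpNormedAlgebra
  have h := (hasDerivAt_exp_smul_const' (𝕂 := ℝ) (-Λ) t)
  have h2 := (hasDerivAt_pi.1 (hasDerivAt_pi.1 h i) j)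
  have e : ∀ t : ℝ, transition Λ t = NormedSpace.exp (t • -Λ) := fun t => by
    unfold transition; rw [smul_neg, neg_smul]
  simp only [e]
  rw [neg_mul] at h2
  exact h2

lemma continuous_transition (i j : Fin M) : Continuous fun t => transition Λ t i j :=
  continuous_iff_continuousAt.2 fun t => (hasDerivAt_transition Λ t i j).continuousAt

lemma transition_neg_mul (t : ℝ) : transition Λ t * transition Λ (-t) = 1 := by
  rw [← transition_add]; simp

/-- A solution of `g' = -Λ g` is given by the semigroup. -/
lemma eq_transition_of_hasDerivWithinAt {g : ℝ → Fin M → ℝ} (hc : ∀ i, ContinuousOn (fun t => g t i) (Ici 0))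
    (hd : ∀ t, 0 ≤ t → ∀ i, HasDerivWithinAt (fun t => g t i) (-∑ m, Λ i m * g t m) (Ici t) t)
    {t : ℝ} (ht : 0 ≤ t) (i : Fin M) : g t i = ∑ m, transition Λ t i m * g 0 m := by
  -- `e^{tΛ} g t` is constant
  have key : ∀ k, ∑ m, transition Λ (-t) k m * g t m = g 0 k := by
    intro k
    have := constant_of_has_deriv_right_zero (f := fun t => ∑ m, transition Λ (-t) k m * g t m)
      (a := 0) (b := t) ?_ ?_ t ⟨ht, le_rfl⟩
    · simpa [Matrix.one_apply] using this
    · refine continuousOn_finsetSum _ fun m _ => ContinuousOn.mul ?_ ?_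
      · exact ((continuous_transition Λ k m).comp continuous_neg).continuousOn
      · exact (hc m).mono fun x hx => hx.1
    · intro x hx
      have h1 : ∀ m, HasDerivWithinAt (fun t => transition Λ (-t) k m * g t m)
          ((Λ * transition Λ (-x)) k m * g x m
            + transition Λ (-x) k m * (-∑ l, Λ m l * g x l)) (Ici x) x := by
        intro m
        refine HasDerivWithinAt.mul ?_ (hd x hx.1 m)
        have := (hasDerivAt_transition Λ (-x) k m).scomp x (hasDerivAt_neg x)
        simpa [Function.comp_def] using this.hasDerivWithinAt
      have h2 := HasDerivWithinAt.fun_sum (u := Finset.univ) fun m _ => h1 m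
      convert h2 using 1
      -- Commutation makes the two terms of the product rule cancel.
      have hcomm : Λ * transition Λ (-x) = transition Λ (-x) * Λ := by
        have : Commute Λ (NormedSpace.exp (- -x • Λ)) := by
          let _ : NormedRing (Matrix (Fin M) (Fin M) ℝ) := Matrix.linftyOpNormedRing
          let _ : NormedAlgebra ℝ (Matrix (Fin M) (Fin M) ℝ) := Matrix.linftyOpNormedAlgebra
          exact ((Commute.refl Λ).smul_right _).exp_right
        exact this
      rw [hcomm, Finset.sum_add_distrib]
      simp only [Matrix.mul_apply, mul_neg, Finset.mul_sum, Finset.sum_mul, Finset.sum_neg_distrib]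
      rw [Finset.sum_comm, ← sub_eq_add_neg, eq_comm, sub_eq_zero]
      refine Finset.sum_congr rfl fun l _ => Finset.sum_congr rfl fun m _ => by ring
  calc g t i = ∑ k, (transition Λ t * transition Λ (-t)) i k * g t k := by
        rw [transition_neg_mul]; simp [Matrix.one_apply]
    _ = ∑ m, transition Λ t i m * ∑ k, transition Λ (-t) m k * g t k := by
        simp only [Matrix.mul_apply, Finset.mul_sum, Finset.sum_mul]
        rw [Finset.sum_comm]
        exact Finset.sum_congr rfl fun l _ => Finset.sum_congr rfl fun m _ => by ring
    _ = _ := by simp only [key]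

end Transition

end HJSystem

end

noncomputable section

namespace HJSystem

/-! ## Cadlag paths -/

section Cadlag

variable {E : Type*} [TopologicalSpace E]

/-- The shifted path `s ↦ ξ (t + s)`. -/
def shift (t : ℝ≥0) (ξ : CadlagPath E) : CadlagPath E :=
  ⟨fun s => ξ.1 (t + s), fun s => by
    constructor
    · refine ContinuousWithinAt.comp (t := Ici (t + s)) (ξ.2 (t + s)).1
        (continuous_const_add t).continuousWithinAt fun r hr => ?_
      exact add_le_add_right (mem_Ici.1 hr) t
    · obtain ⟨l, hl⟩ := (ξ.2 (t + s)).2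
      refine ⟨l, hl.comp (tendsto_nhdsWithin_iff.2 ⟨?_, ?_⟩)⟩
      · exact ((continuous_const_add t).tendsto s).mono_left nhdsWithin_le_nhds
      · filter_upwards [self_mem_nhdsWithin] with r hr
        exact add_lt_add_right (mem_Iio.1 hr) t⟩

@[simp] lemma shift_apply (t : ℝ≥0) (ξ : CadlagPath E) (s : ℝ≥0) :
    (shift t ξ).1 s = ξ.1 (t + s) := rfl

/-- The stopped path `s ↦ ξ (s ∧ t)`. -/
def stopped (t : ℝ≥0) (ξ : CadlagPath E) : CadlagPath E :=
  ⟨fun s => ξ.1 (min s t), fun s => by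
    constructor
    · refine ContinuousWithinAt.comp (t := Ici (min s t)) (ξ.2 (min s t)).1
        (continuous_id.min continuous_const).continuousWithinAt fun r hr => ?_
      exact min_le_min_right t (mem_Ici.1 hr)
    · rcases le_or_gt s t with h | h
      · obtain ⟨l, hl⟩ := (ξ.2 s).2
        refine ⟨l, hl.congr' ?_⟩
        filter_upwards [self_mem_nhdsWithin] with r hr
        rw [min_eq_left ((mem_Iio.1 hr).le.trans h)]
      · refine ⟨ξ.1 t, tendsto_const_nhds.congr' ?_⟩
        filter_upwards [nhdsWithin_le_nhds (Ioi_mem_nhds h)] with r hr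
        rw [min_eq_right (mem_Ioi.1 hr).le]⟩

@[simp] lemma stopped_apply (t : ℝ≥0) (ξ : CadlagPath E) (s : ℝ≥0) :
    (stopped t ξ).1 s = ξ.1 (min s t) := rfl

/-- The path which follows `ξ` up to the time `t` and then the path `η`. -/
def concat (t : ℝ≥0) (ξ η : CadlagPath E) : CadlagPath E :=
  ⟨fun s => if s < t then ξ.1 s else η.1 (s - t), fun s => by
    have hsub : ∀ s : ℝ≥0, t ≤ s → Tendsto (fun r => r - t) (𝓝[<] s) (𝓝 (s - t)) := fun s hs =>
      ((continuous_id.sub continuous_const).tendsto s).mono_left nhdsWithin_le_nhds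
    rcases lt_or_ge s t with h | h
    · constructor
      · refine (ξ.2 s).1.congr_of_eventuallyEq ?_ (if_pos h)
        filter_upwards [nhdsWithin_le_nhds (Iio_mem_nhds h)] with r hr using if_pos hr
      · obtain ⟨l, hl⟩ := (ξ.2 s).2
        refine ⟨l, hl.congr' ?_⟩
        filter_upwards [self_mem_nhdsWithin] with r hr using (if_pos ((mem_Iio.1 hr).trans h)).symm
    · constructor
      · have : ContinuousWithinAt (fun r => η.1 (r - t)) (Ici s) s :=
          ContinuousWithinAt.comp (t := Ici (s - t)) (η.2 (s - t)).1
            (continuous_id.sub continuous_const).continuousWithinAt fun r hr =>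
              tsub_le_tsub_right (mem_Ici.1 hr) t
        refine this.congr (fun r hr => ?_) ?_
        · exact if_neg (not_lt.2 (h.trans (mem_Ici.1 hr)))
        · exact if_neg (not_lt.2 h)
      · rcases h.eq_or_lt with rfl | h
        · obtain ⟨l, hl⟩ := (ξ.2 t).2
          refine ⟨l, hl.congr' ?_⟩
          filter_upwards [self_mem_nhdsWithin] with r hr using (if_pos (mem_Iio.1 hr)).symm
        · obtain ⟨l, hl⟩ := (η.2 (s - t)).2
          refine ⟨l, Tendsto.congr' ?_ (hl.comp (tendsto_nhdsWithin_iff.2 ⟨hsub s h.le, ?_⟩))⟩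
          · filter_upwards [nhdsWithin_le_nhds (Ioi_mem_nhds h)] with r hr
            exact (if_neg (not_lt.2 (mem_Ioi.1 hr).le)).symm
          · filter_upwards [self_mem_nhdsWithin, nhdsWithin_le_nhds (Ioi_mem_nhds h)] with r hr hr'
            exact tsub_lt_tsub_right_of_le (mem_Ioi.1 hr').le (mem_Iio.1 hr)⟩

lemma concat_apply (t : ℝ≥0) (ξ η : CadlagPath E) (s : ℝ≥0) :
    (concat t ξ η).1 s = if s < t then ξ.1 s else η.1 (s - t) := rfl

/-- The constant path. -/
def constPath (e : E) : CadlagPath E :=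
  ⟨fun _ => e, fun _ => ⟨continuousWithinAt_const, e, tendsto_const_nhds⟩⟩

@[simp] lemma constPath_apply (e : E) (s : ℝ≥0) : (constPath e).1 s = e := rfl

variable [MeasurableSpace E]

lemma measurable_eval (s : ℝ≥0) : Measurable fun ξ : CadlagPath E => ξ.1 s :=
  (measurable_pi_apply s).comp measurable_subtype_coe

lemma measurable_cadlagPath_iff {α : Type*} [MeasurableSpace α] {f : α → CadlagPath E} :
    Measurable f ↔ ∀ s, Measurable fun a => (f a).1 s :=
  ⟨fun h s => (measurable_eval s).comp h, fun h => (measurable_pi_lambda _ h).subtype_mk⟩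

/-- Points approaching `s` from the right, with values in a grid. -/
def upperGrid (n : ℕ) (s : ℝ≥0) : ℝ≥0 := (⌊(n + 1 : ℝ≥0) * s⌋₊ + 1) / (n + 1)

lemma lt_upperGrid (n : ℕ) (s : ℝ≥0) : s < upperGrid n s := by
  rw [upperGrid, lt_div_iff₀ (by positivity), mul_comm]
  exact Nat.lt_floor_add_one _

lemma upperGrid_le (n : ℕ) (s : ℝ≥0) : upperGrid n s ≤ s + 1 / (n + 1) := by
  rw [upperGrid, div_le_iff₀ (by positivity), add_mul s, div_mul_cancel₀ _ (by positivity),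
    mul_comm s]
  gcongr
  exact Nat.floor_le zero_le

lemma tendsto_upperGrid (s : ℝ≥0) : Tendsto (fun n => upperGrid n s) atTop (𝓝[≥] s) := by
  refine tendsto_nhdsWithin_iff.2 ⟨?_, Eventually.of_forall fun n => (lt_upperGrid n s).le⟩
  refine tendsto_of_tendsto_of_tendsto_of_le_of_le tendsto_const_nhds ?_
    (fun n => (lt_upperGrid n s).le) (fun n => upperGrid_le n s)
  simpa using (tendsto_const_nhds (x := s)).add tendsto_one_div_add_atTop_nhds_zero_nat

/-- Evaluation is jointly measurable. -/
lemma measurable_eval_prod [TopologicalSpace.PseudoMetrizableSpace E] [BorelSpace E] :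
    Measurable fun z : CadlagPath E × ℝ≥0 => z.1.1 z.2 := by
  -- Right continuity makes evaluation a limit of evaluations at grid points approaching from the
  -- right, and each of these involves countably many times only.
  refine measurable_of_tendsto_metrizable (f := fun n z => z.1.1 (upperGrid n z.2)) (fun n => ?_) ?_
  · have h1 : Measurable fun w : CadlagPath E × ℕ => w.1.1 ((w.2 + 1) / (n + 1)) :=
      measurable_from_prod_countable_left fun k =>
        measurable_eval ((k + 1 : ℝ≥0) / (n + 1))
    have h2 : Measurable fun z : CadlagPath E × ℝ≥0 => (z.1, ⌊(n + 1 : ℝ≥0) * z.2⌋₊) :=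
      measurable_fst.prodMk (Nat.measurable_floor.comp (measurable_const.mul measurable_snd))
    exact h1.comp h2
  · rw [tendsto_pi_nhds]
    intro z
    exact Tendsto.comp (z.1.2 z.2).1 (tendsto_upperGrid z.2)

lemma measurable_shift [TopologicalSpace.PseudoMetrizableSpace E] [BorelSpace E] :
    Measurable fun z : ℝ≥0 × CadlagPath E => shift z.1 z.2 :=
  measurable_cadlagPath_iff.2 fun s =>
    measurable_eval_prod.comp (measurable_snd.prodMk (measurable_fst.add_const s))

end Cadlag

/-- The left limit and right continuity bound the path near each time; compactness of `[0, T]` makes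
the bound uniform. -/
lemma exists_bound_cadlag {E : Type*} [SeminormedAddCommGroup E] (ξ : CadlagPath E) (T : ℝ≥0) :
    ∃ R, ∀ s ≤ T, ‖ξ.1 s‖ ≤ R := by
  have h : ∃ R, ∀ s ∈ Icc 0 T, ‖ξ.1 s‖ ≤ R := by
    refine (isCompact_Icc (a := (0 : ℝ≥0)) (b := T)).induction_on
      (p := fun S => ∃ R, ∀ s ∈ S, ‖ξ.1 s‖ ≤ R) ⟨0, by simp⟩ ?_ ?_ ?_
    · rintro S S' hS ⟨R, hR⟩
      exact ⟨R, fun s hs => hR s (hS hs)⟩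
    · rintro S S' ⟨R, hR⟩ ⟨R', hR'⟩
      refine ⟨max R R', fun s hs => ?_⟩
      rcases hs with hs | hs
      · exact (hR s hs).trans (le_max_left _ _)
      · exact (hR' s hs).trans (le_max_right _ _)
    · intro t _
      obtain ⟨l, hl⟩ := (ξ.2 t).2
      have h1 : ∀ᶠ s in 𝓝[<] t, ‖ξ.1 s‖ ≤ ‖l‖ + 1 :=
        (hl.norm.eventually (gt_mem_nhds (lt_add_one _))).mono fun s hs => le_of_lt hs
      have h2 : ∀ᶠ s in 𝓝[≥] t, ‖ξ.1 s‖ ≤ ‖ξ.1 t‖ + 1 :=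
        ((ξ.2 t).1.norm.eventually (gt_mem_nhds (lt_add_one _))).mono fun s hs => le_of_lt hs
      have h3 : ∀ᶠ s in 𝓝 t, ‖ξ.1 s‖ ≤ max (‖l‖ + 1) (‖ξ.1 t‖ + 1) := by
        rw [← nhdsLT_sup_nhdsGE t, eventually_sup]
        exact ⟨h1.mono fun s hs => hs.trans (le_max_left _ _),
          h2.mono fun s hs => hs.trans (le_max_right _ _)⟩
      exact ⟨_, mem_nhdsWithin_of_mem_nhds h3, _, fun s hs => hs⟩
  obtain ⟨R, hR⟩ := h
  exact ⟨R, fun s hs => hR s ⟨zero_le, hs⟩⟩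

end HJSystem

end

noncomputable section

namespace HJSystem

/-! ## Jump paths -/

/-- A mark of the uniformized chain: a holding time and a random map of the indices. -/
abbrev Mark (M : ℕ) := ℝ × (Fin M → Fin M)

section JumpPath

variable {M : ℕ}

/-- The time of the `n`-th jump. -/
def jumpTime (e : ℕ → Mark M) (n : ℕ) : ℝ := ∑ k ∈ Finset.range n, (e k).1

/-- The index after `n` jumps. -/
def chain (e : ℕ → Mark M) (i : Fin M) : ℕ → Fin M
  | 0 => i
  | n + 1 => (e n).2 (chain e i n)

/-- The number of jumps up to the time `t`. -/
def jumpCount (e : ℕ → Mark M) (t : ℝ) : ℕ := sInf {n | t < jumpTime e (n + 1)}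

/-- The holding times are positive and the jump times diverge. -/
def NonExplosive (e : ℕ → Mark M) : Prop :=
  (∀ k, 0 < (e k).1) ∧ ∀ C : ℕ, ∃ n, (C : ℝ) < jumpTime e n

lemma jumpTime_succ (e : ℕ → Mark M) (n : ℕ) : jumpTime e (n + 1) = jumpTime e n + (e n).1 :=
  Finset.sum_range_succ _ _

lemma NonExplosive.strictMono {e : ℕ → Mark M} (he : NonExplosive e) : StrictMono (jumpTime e) :=
  strictMono_nat_of_lt_succ fun n => by rw [jumpTime_succ]; linarith [he.1 n]

lemma NonExplosive.jumpCount_eq {e : ℕ → Mark M} (he : NonExplosive e) {t : ℝ} {n : ℕ}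
    (h1 : jumpTime e n ≤ t) (h2 : t < jumpTime e (n + 1)) : jumpCount e t = n := by
  refine le_antisymm (Nat.sInf_le h2) ?_
  refine le_csInf ⟨n, h2⟩ fun m hm => ?_
  by_contra! hlt
  have : jumpTime e (m + 1) ≤ jumpTime e n := he.strictMono.monotone hlt
  have hm' : t < jumpTime e (m + 1) := hm
  linarith

/-- Divergence of the jump times makes the set defining `jumpCount` nonempty, so its infimum is
attained and minimality gives the first inequality. -/
lemma NonExplosive.jumpCount_spec {e : ℕ → Mark M} (he : NonExplosive e) {t : ℝ} (ht : 0 ≤ t) :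
    jumpTime e (jumpCount e t) ≤ t ∧ t < jumpTime e (jumpCount e t + 1) := by
  have hne : {n | t < jumpTime e (n + 1)}.Nonempty := by
    obtain ⟨C, hC⟩ := exists_nat_gt t
    obtain ⟨n, hn⟩ := he.2 C
    exact ⟨n, (hC.trans hn).trans (he.strictMono (Nat.lt_succ_self n))⟩
  refine ⟨?_, Nat.sInf_mem hne⟩
  rcases h : jumpCount e t with _ | m
  · simpa [jumpTime] using ht
  · have : m ∉ {n | t < jumpTime e (n + 1)} := Nat.notMem_of_lt_sInf (by
      have : jumpCount e t = sInf {n | t < jumpTime e (n + 1)} := rfl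
      omega)
    simpa using this

lemma NonExplosive.isCadlag {e : ℕ → Mark M} (he : NonExplosive e) (i : Fin M) :
    IsCadlag fun t : ℝ≥0 => chain e i (jumpCount e t) := by
  intro t
  obtain ⟨h1, h2⟩ := he.jumpCount_spec t.coe_nonneg
  have hcoe : Tendsto (fun s : ℝ≥0 => (s : ℝ)) (𝓝 t) (𝓝 t) := NNReal.continuous_coe.tendsto t
  constructor
  · refine tendsto_const_nhds.congr' ?_
    filter_upwards [self_mem_nhdsWithin,
      nhdsWithin_le_nhds (hcoe.eventually (gt_mem_nhds h2))] with s hs hs'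
    rw [he.jumpCount_eq (h1.trans (NNReal.coe_le_coe.2 hs)) hs']
  · rcases h1.eq_or_lt with h | h
    · rcases hn : jumpCount e t with _ | m
      -- At `t = 0` there are no times to the left, so any value serves as left limit.
      · have : t = 0 := by
          rw [hn] at h
          exact NNReal.coe_eq_zero.1 (by simpa [jumpTime] using h.symm)
        subst this
        exact ⟨i, by simp⟩
      · refine ⟨chain e i m, tendsto_const_nhds.congr' ?_⟩
        rw [hn] at h
        have hm : jumpTime e m < t := by rw [← h]; exact he.strictMono (Nat.lt_succ_self m)
        filter_upwards [self_mem_nhdsWithin,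
          nhdsWithin_le_nhds (hcoe.eventually (lt_mem_nhds hm))] with s hs hs'
        rw [he.jumpCount_eq hs'.le (h ▸ NNReal.coe_lt_coe.2 hs)]
    · refine ⟨chain e i (jumpCount e t), tendsto_const_nhds.congr' ?_⟩
      filter_upwards [self_mem_nhdsWithin,
        nhdsWithin_le_nhds (hcoe.eventually (lt_mem_nhds h))] with s hs hs'
      rw [he.jumpCount_eq hs'.le ((NNReal.coe_lt_coe.2 hs).trans h2)]

open Classical in
/-- The index path which starts at `i` and jumps according to the marks `e`. -/
def jumpPath (i : Fin M) (e : ℕ → Mark M) : IndexPath M :=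
  if he : NonExplosive e then ⟨_, he.isCadlag i⟩ else constPath i

lemma NonExplosive.jumpPath_apply {e : ℕ → Mark M} (he : NonExplosive e) (i : Fin M) (t : ℝ≥0) :
    (jumpPath i e).1 t = chain e i (jumpCount e t) := by
  rw [jumpPath, dif_pos he]

/-- Prepend a mark. -/
def consMark (a : Mark M) (e : ℕ → Mark M) : ℕ → Mark M
  | 0 => a
  | n + 1 => e n

lemma jumpTime_consMark (a : Mark M) (e : ℕ → Mark M) (n : ℕ) :
    jumpTime (consMark a e) (n + 1) = jumpTime e n + a.1 := by
  rw [jumpTime, Finset.sum_range_succ']; rfl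

lemma chain_consMark (a : Mark M) (e : ℕ → Mark M) (i : Fin M) (n : ℕ) :
    chain (consMark a e) i (n + 1) = chain e (a.2 i) n := by
  induction n with
  | zero => rfl
  | succ n ih => rw [chain, ih]; rfl

lemma NonExplosive.cons {e : ℕ → Mark M} (he : NonExplosive e) {a : Mark M} (ha : 0 < a.1) :
    NonExplosive (consMark a e) := by
  refine ⟨fun k => ?_, fun C => ?_⟩
  · cases k with
    | zero => exact ha
    | succ k => exact he.1 k
  · obtain ⟨n, hn⟩ := he.2 C
    exact ⟨n + 1, by rw [jumpTime_consMark]; linarith⟩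

lemma NonExplosive.jumpPath_cons_of_lt {e : ℕ → Mark M} (he : NonExplosive e) {a : Mark M}
    (i : Fin M) {t : ℝ≥0} (ht : (t : ℝ) < a.1) : (jumpPath i (consMark a e)).1 t = i := by
  have h := he.cons (a := a) (t.coe_nonneg.trans_lt ht)
  rw [h.jumpPath_apply, h.jumpCount_eq (n := 0)]
  · rfl
  · simp [jumpTime]
  · rw [jumpTime_consMark]; simpa [jumpTime] using ht

lemma NonExplosive.jumpPath_cons_of_le {e : ℕ → Mark M} (he : NonExplosive e) {a : Mark M}
    (ha : 0 < a.1) (i : Fin M) {t s : ℝ≥0} (hs : (s : ℝ) = t - a.1) :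
    (jumpPath i (consMark a e)).1 t = (jumpPath (a.2 i) e).1 s := by
  have h := he.cons ha
  obtain ⟨h1, h2⟩ := he.jumpCount_spec s.coe_nonneg
  rw [h.jumpPath_apply, he.jumpPath_apply, h.jumpCount_eq (n := jumpCount e s + 1), chain_consMark]
  · rw [jumpTime_consMark]
    have h1' : jumpTime e (jumpCount e s) ≤ (s : ℝ) := h1
    linarith
  · rw [jumpTime_consMark]
    have h2' : (s : ℝ) < jumpTime e (jumpCount e s + 1) := h2
    linarith

/-! ### Measurability of the jump paths -/

lemma measurable_jumpTime (n : ℕ) : Measurable fun e : ℕ → Mark M => jumpTime e n :=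
  Finset.measurable_sum _ fun k _ => (measurable_pi_apply k).fst

lemma measurable_chain (i : Fin M) (n : ℕ) : Measurable fun e : ℕ → Mark M => chain e i n := by
  induction n with
  | zero => exact measurable_const
  | succ n ih =>
    have h : Measurable fun z : (Fin M → Fin M) × Fin M => z.1 z.2 :=
      measurable_from_prod_countable_left fun k => measurable_pi_apply k
    exact h.comp ((measurable_pi_apply n).snd.prodMk ih)

lemma measurableSet_nonExplosive : MeasurableSet {e : ℕ → Mark M | NonExplosive e} := by
  simp only [NonExplosive, ofPred_and, ofPred_forall, ofPred_exists]
  refine MeasurableSet.inter (MeasurableSet.iInter fun k => ?_)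
    (MeasurableSet.iInter fun C => MeasurableSet.iUnion fun n => ?_)
  · exact measurableSet_lt measurable_const (measurable_pi_apply k).fst
  · exact measurableSet_lt measurable_const (measurable_jumpTime n)

lemma measurable_jumpPath (i : Fin M) : Measurable (jumpPath i) := by
  refine measurable_cadlagPath_iff.2 fun t => measurable_to_countable' fun j => ?_
  have : (fun e => (jumpPath i e).1 t) ⁻¹' {j} =
      ({e | NonExplosive e} ∩
        ⋃ n, {e | jumpTime e n ≤ t} ∩ {e | t < jumpTime e (n + 1)} ∩ {e | chain e i n = j})
      ∪ ({e | NonExplosive e}ᶜ ∩ {_e | i = j}) := by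
    ext e
    by_cases he : NonExplosive e
    · simp only [mem_preimage, mem_singleton_iff, he.jumpPath_apply, mem_union, mem_inter_iff,
        mem_ofPred_eq, he, true_and, mem_compl_iff, not_true_eq_false, false_and, or_false, mem_iUnion]
      constructor
      · intro h
        exact ⟨_, he.jumpCount_spec t.coe_nonneg, h⟩
      · rintro ⟨n, ⟨h1, h2⟩, h3⟩
        rw [he.jumpCount_eq h1 h2, h3]
    · simp [jumpPath, he]
  rw [this]
  refine (measurableSet_nonExplosive.inter (MeasurableSet.iUnion fun n => ?_)).union
    (measurableSet_nonExplosive.compl.inter (MeasurableSet.const _))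
  exact ((measurableSet_le (measurable_jumpTime n) measurable_const).inter
    (measurableSet_lt measurable_const (measurable_jumpTime (n + 1)))).inter
    (measurable_chain i n (measurableSet_singleton j))

lemma measurable_consMark :
    Measurable fun z : Mark M × (ℕ → Mark M) => consMark z.1 z.2 := by
  refine measurable_pi_lambda _ fun n => ?_
  cases n with
  | zero => exact measurable_fst
  | succ n => exact (measurable_pi_apply n).comp measurable_snd

/-- An i.i.d. sequence consists of its head and of an independent tail with the same law. -/
lemma map_consMark (ν : Measure (Mark M)) [IsProbabilityMeasure ν] :
    (ν.prod (Measure.infinitePi fun _ : ℕ => ν)).map (fun z => consMark z.1 z.2)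
      = Measure.infinitePi fun _ : ℕ => ν := by
  refine Measure.eq_infinitePi _ fun s t ht => ?_
  classical
  -- The finite set of coordinates is enlarged to an initial segment, with no constraint on the
  -- added ones, so that the head separates from the tail.
  obtain ⟨n, hn⟩ : ∃ n, s ⊆ Finset.range (n + 1) :=
    ⟨s.sup id, fun k hk => Finset.mem_range.2 (Nat.lt_succ_of_le (Finset.le_sup (f := id) hk))⟩
  let t' : ℕ → Set (Mark M) := fun k => if k ∈ s then t k else univ
  have ht' : ∀ k, MeasurableSet (t' k) := fun k => by
    by_cases hk : k ∈ s <;> simp [t', hk, ht]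
  have h1 : (s : Set ℕ).pi t = ((Finset.range (n + 1) : Finset ℕ) : Set ℕ).pi t' := by
    ext e
    simp only [Set.mem_pi, Finset.mem_coe]
    constructor
    · intro h k _
      by_cases hk : k ∈ s
      · simpa [t', hk] using h k hk
      · simp [t', hk]
    · intro h k hk
      simpa [t', hk] using h k (hn hk)
  have h2 : ∏ k ∈ s, ν (t k) = ∏ k ∈ Finset.range (n + 1), ν (t' k) := by
    rw [← Finset.prod_subset hn]
    · exact Finset.prod_congr rfl fun k hk => by simp [t', hk]
    · intro k _ hk
      simp [t', hk]
  have h3 : (fun z : Mark M × (ℕ → Mark M) => consMark z.1 z.2) ⁻¹'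
      (((Finset.range (n + 1) : Finset ℕ) : Set ℕ).pi t')
      = t' 0 ×ˢ (((Finset.range n : Finset ℕ) : Set ℕ).pi fun k => t' (k + 1)) := by
    ext ⟨a, e⟩
    simp only [mem_preimage, Set.mem_pi, Finset.mem_coe, Finset.mem_range, mem_prod]
    constructor
    · intro h
      exact ⟨h 0 (Nat.succ_pos n), fun k hk => h (k + 1) (Nat.succ_lt_succ hk)⟩
    · rintro ⟨h0, h⟩ k hk
      cases k with
      | zero => exact h0
      | succ k => exact h k (Nat.lt_of_succ_lt_succ hk)
  have hmeas : MeasurableSet (((Finset.range (n + 1) : Finset ℕ) : Set ℕ).pi t') :=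
    MeasurableSet.pi (Finset.countable_toSet _) fun k _ => ht' k
  rw [h1, h2, Measure.map_apply measurable_consMark hmeas, h3, Measure.prod_prod,
    Measure.infinitePi_pi _ fun k _ => ht' (k + 1), Finset.prod_range_succ', mul_comm]

end JumpPath

end HJSystem

end

noncomputable section

namespace HJSystem

/-! ## The law of the index process -/

/-- The matrix `-Λ` generates a Markov chain. -/
class IsRateMatrix {M : ℕ} (Λ : Matrix (Fin M) (Fin M) ℝ) : Prop where
  offDiag_nonpos : ∀ i j, i ≠ j → Λ i j ≤ 0
  row_sum : ∀ i, ∑ j, Λ i j = 0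

section Law

variable {M : ℕ} (Λ : Matrix (Fin M) (Fin M) ℝ)

/-- The rate of the jumps of the uniformized chain. -/
def jumpRate : ℝ := 1 + ∑ i, |Λ i i|

lemma jumpRate_pos : 0 < jumpRate Λ := by
  have : 0 ≤ ∑ i, |Λ i i| := Finset.sum_nonneg fun i _ => abs_nonneg _
  unfold jumpRate
  linarith

/-- The transition probabilities of the uniformized chain. -/
def jumpProb (i m : Fin M) : ℝ := (1 : Matrix (Fin M) (Fin M) ℝ) i m - Λ i m / jumpRate Λ

/-- The rate exceeds every `|Λ i i|`, which keeps the diagonal of `1 - Λ / r` nonnegative; off the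
diagonal the sign of `Λ` suffices. -/
lemma jumpProb_nonneg [h : IsRateMatrix Λ] (i m : Fin M) : 0 ≤ jumpProb Λ i m := by
  unfold jumpProb
  have hr := jumpRate_pos Λ
  by_cases him : i = m
  · subst him
    rw [Matrix.one_apply_eq, sub_nonneg, div_le_one hr]
    have : |Λ i i| ≤ ∑ i, |Λ i i| :=
      Finset.single_le_sum (f := fun i => |Λ i i|) (fun i _ => abs_nonneg _) (Finset.mem_univ i)
    unfold jumpRate
    linarith [le_abs_self (Λ i i)]
  · rw [Matrix.one_apply_ne him, sub_nonneg]
    exact div_nonpos_of_nonpos_of_nonneg (h.offDiag_nonpos i m him) hr.le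

lemma sum_jumpProb [h : IsRateMatrix Λ] (i : Fin M) : ∑ m, jumpProb Λ i m = 1 := by
  simp [jumpProb, Finset.sum_sub_distrib, ← Finset.sum_div, h.row_sum, Matrix.one_apply]

/-- The law of the index which follows `i`. -/
def jumpMeasure (i : Fin M) : Measure (Fin M) :=
  ∑ m, ENNReal.ofReal (jumpProb Λ i m) • Measure.dirac m

instance [IsRateMatrix Λ] (i : Fin M) : IsProbabilityMeasure (jumpMeasure Λ i) := ⟨by
  simp only [jumpMeasure, Measure.coe_finsetSum, Finset.sum_apply, Measure.smul_apply,
    measure_univ, smul_eq_mul, mul_one]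
  rw [← ENNReal.ofReal_sum_of_nonneg fun m _ => jumpProb_nonneg Λ i m, sum_jumpProb,
    ENNReal.ofReal_one]⟩

lemma lintegral_jumpMeasure (i : Fin M) (f : Fin M → ℝ≥0∞) :
    ∫⁻ m, f m ∂(jumpMeasure Λ i) = ∑ m, ENNReal.ofReal (jumpProb Λ i m) * f m := by
  simp [jumpMeasure, lintegral_smul_measure]

/-- The exponential density. -/
def expDensity (r s : ℝ) : ℝ≥0∞ := ENNReal.ofReal (r * Real.exp (-r * s))

lemma measurable_expDensity (r : ℝ) : Measurable (expDensity r) := by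
  unfold expDensity; fun_prop

/-- The law of the holding times. -/
def holdingMeasure (r : ℝ) : Measure ℝ := (volume.restrict (Ioi 0)).withDensity (expDensity r)

lemma lintegral_holdingMeasure (r : ℝ) {f : ℝ → ℝ≥0∞} (hf : Measurable f) :
    ∫⁻ s, f s ∂(holdingMeasure r) = ∫⁻ s in Ioi 0, expDensity r s * f s := by
  rw [holdingMeasure, lintegral_withDensity_eq_lintegral_mul _ (measurable_expDensity r) hf]
  rfl

lemma lintegral_expDensity_Ioi {r : ℝ} (hr : 0 < r) (c : ℝ) :
    ∫⁻ s in Ioi c, expDensity r s = ENNReal.ofReal (Real.exp (-r * c)) := by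
  have hint : IntegrableOn (fun s => r * Real.exp (-r * s)) (Ioi c) :=
    (integrableOn_exp_mul_Ioi (neg_lt_zero.2 hr) c).const_mul r
  unfold expDensity
  rw [← ofReal_integral_eq_lintegral_ofReal hint (Eventually.of_forall fun s => by positivity),
    integral_const_mul, integral_exp_mul_Ioi (neg_lt_zero.2 hr)]
  congr 1
  field_simp

lemma isProbabilityMeasure_holdingMeasure {r : ℝ} (hr : 0 < r) :
    IsProbabilityMeasure (holdingMeasure r) := ⟨by
  rw [holdingMeasure, withDensity_apply _ MeasurableSet.univ, Measure.restrict_univ,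
    lintegral_expDensity_Ioi hr]
  simp⟩

instance : IsProbabilityMeasure (holdingMeasure (jumpRate Λ)) :=
  isProbabilityMeasure_holdingMeasure (jumpRate_pos Λ)

/-- The law of the marks. -/
def markMeasure : Measure (Mark M) :=
  (holdingMeasure (jumpRate Λ)).prod (Measure.pi (jumpMeasure Λ))

instance [IsRateMatrix Λ] : IsProbabilityMeasure (markMeasure Λ) := by
  unfold markMeasure; infer_instance

/-- The law of the sequence of the marks. -/
def markSeqMeasure [IsRateMatrix Λ] : Measure (ℕ → Mark M) :=
  Measure.infinitePi fun _ => markMeasure Λ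

instance [IsRateMatrix Λ] : IsProbabilityMeasure (markSeqMeasure Λ) := by
  unfold markSeqMeasure; infer_instance

variable [IsRateMatrix Λ]

lemma markMeasure_preimage_fst {S : Set ℝ} :
    markMeasure Λ {a | a.1 ∈ S} = holdingMeasure (jumpRate Λ) S := by
  have : {a : Mark M | a.1 ∈ S} = S ×ˢ univ := by ext; simp
  rw [this, markMeasure, Measure.prod_prod, measure_univ, mul_one]

/-- Almost surely infinitely many holding times exceed `1`: a run of `n` consecutive shorter ones
has probability `c ^ n` with `c < 1`. Positive holding times with this property have divergent sums.
-/
lemma ae_nonExplosive : ∀ᵐ e ∂(markSeqMeasure Λ), NonExplosive e := by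
  have hpos : ∀ᵐ e ∂(markSeqMeasure Λ), ∀ k, 0 < (e k).1 := by
    refine ae_all_iff.2 fun k => ?_
    have h1 : ∀ᵐ a ∂(markMeasure Λ), 0 < a.1 := by
      have : markMeasure Λ {a | a.1 ∈ Iic 0} = 0 := by
        rw [markMeasure_preimage_fst, holdingMeasure, withDensity_apply _ measurableSet_Iic,
          Measure.restrict_restrict measurableSet_Iic]
        have : Iic (0 : ℝ) ∩ Ioi 0 = ∅ := by ext; simp
        simp [this]
      rw [ae_iff]
      simpa using this
    exact (measurePreserving_eval_infinitePi (fun _ : ℕ => markMeasure Λ) k).quasiMeasurePreserving.ae h1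
  have hc : markMeasure Λ {a | a.1 ∈ Iic 1} < 1 := by
    rw [markMeasure_preimage_fst, ← compl_Ioi, prob_compl_eq_one_sub measurableSet_Ioi]
    refine ENNReal.sub_lt_self ENNReal.one_ne_top one_ne_zero ?_
    rw [holdingMeasure, withDensity_apply _ measurableSet_Ioi,
      Measure.restrict_restrict measurableSet_Ioi, inter_eq_left.2 (Ioi_subset_Ioi zero_le_one),
      lintegral_expDensity_Ioi (jumpRate_pos Λ)]
    simp [Real.exp_pos]
  have hrec : ∀ᵐ e ∂(markSeqMeasure Λ), ∀ m : ℕ, ∃ k, m ≤ k ∧ 1 < (e k).1 := by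
    refine ae_all_iff.2 fun m => ?_
    rw [ae_iff]
    refine le_antisymm (le_of_forall_pos_le_add fun ε hε => ?_) zero_le
    obtain ⟨n, hn⟩ := ((ENNReal.tendsto_pow_atTop_nhds_zero_of_lt_one hc).eventually
      (gt_mem_nhds hε)).exists
    have hsub : {e : ℕ → Mark M | ¬∃ k, m ≤ k ∧ 1 < (e k).1}
        ⊆ ((Finset.Ico m (m + n) : Finset ℕ) : Set ℕ).pi fun _ => {a | a.1 ∈ Iic 1} := by
      intro e he k hk
      have he' : ¬∃ k, m ≤ k ∧ 1 < (e k).1 := he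
      by_contra hlt
      exact he' ⟨k, (Finset.mem_Ico.1 hk).1, not_le.1 hlt⟩
    refine (measure_mono hsub).trans ?_
    have hS : MeasurableSet {a : Mark M | a.1 ∈ Iic 1} := measurable_fst measurableSet_Iic
    rw [markSeqMeasure, Measure.infinitePi_pi _ fun _ _ => hS]
    simpa using hn.le
  filter_upwards [hpos, hrec] with e h1 h2
  have hmono : Monotone (jumpTime e) := monotone_nat_of_le_succ fun n => by
    rw [jumpTime_succ]; linarith [h1 n]
  refine ⟨h1, fun C => ?_⟩
  induction C with
  | zero => exact ⟨1, by simpa [jumpTime] using h1 0⟩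
  | succ C ih =>
    obtain ⟨n, hn⟩ := ih
    obtain ⟨k, hk, hk1⟩ := h2 n
    refine ⟨k + 1, ?_⟩
    rw [jumpTime_succ]
    push_cast
    linarith [hmono hk]

/-- The law of the index process which starts at `i`. -/
def jumpLaw (i : Fin M) : Measure (IndexPath M) := (markSeqMeasure Λ).map (jumpPath i)

instance (i : Fin M) : IsProbabilityMeasure (jumpLaw Λ i) :=
  Measure.isProbabilityMeasure_map (measurable_jumpPath i).aemeasurable

lemma lintegral_pi_jumpMeasure (i : Fin M) (f : Fin M → ℝ≥0∞) :
    ∫⁻ U, f (U i) ∂(Measure.pi (jumpMeasure Λ)) = ∑ m, ENNReal.ofReal (jumpProb Λ i m) * f m := by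
  rw [← lintegral_jumpMeasure]
  exact (measurePreserving_eval (jumpMeasure Λ) i).lintegral_comp (measurable_of_finite f)

/-- Conditioning on the first mark. -/
lemma jumpLaw_apply (i : Fin M) {B : Set (IndexPath M)} (hB : MeasurableSet B) :
    jumpLaw Λ i B = ∫⁻ s in Ioi 0, expDensity (jumpRate Λ) s *
      ∫⁻ U, markSeqMeasure Λ {e | jumpPath i (consMark (s, U) e) ∈ B}
        ∂(Measure.pi (jumpMeasure Λ)) := by
  have hm : MeasurableSet {z : Mark M × (ℕ → Mark M) | jumpPath i (consMark z.1 z.2) ∈ B} :=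
    ((measurable_jumpPath i).comp measurable_consMark) hB
  have h1 : jumpLaw Λ i B = ((markMeasure Λ).prod (markSeqMeasure Λ))
      {z | jumpPath i (consMark z.1 z.2) ∈ B} := by
    have := map_consMark (markMeasure Λ)
    rw [jumpLaw, Measure.map_apply (measurable_jumpPath i) hB, markSeqMeasure]
    conv_lhs => rw [← this]
    rw [Measure.map_apply measurable_consMark (measurable_jumpPath i hB)]
    rfl
  have hm2 := measurable_measure_prodMk_left (ν := markSeqMeasure Λ) hm
  rw [h1, Measure.prod_apply hm, markMeasure, lintegral_prod _ hm2.aemeasurable,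
    lintegral_holdingMeasure _ (Measurable.lintegral_prod_right' hm2)]
  rfl

/-- The event that the path is at `j` at the time `t` and belongs to `A` afterwards. -/
def shiftEvent (j : Fin M) (A : Set (IndexPath M)) (t : ℝ≥0) : Set (IndexPath M) :=
  {ω | ω.1 t = j ∧ shift t ω ∈ A}

lemma measurableSet_shiftEvent_prod (j : Fin M) {A : Set (IndexPath M)} (hA : MeasurableSet A) :
    MeasurableSet {z : ℝ≥0 × IndexPath M | z.2 ∈ shiftEvent j A z.1} :=
  ((measurable_eval_prod.comp measurable_swap) (measurableSet_singleton j)).inter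
    (measurable_shift hA)

lemma measurableSet_shiftEvent (j : Fin M) {A : Set (IndexPath M)} (hA : MeasurableSet A)
    (t : ℝ≥0) : MeasurableSet (shiftEvent j A t) :=
  measurable_prodMk_left (measurableSet_shiftEvent_prod j hA)

lemma measurable_jumpLaw_shiftEvent (i j : Fin M) {A : Set (IndexPath M)} (hA : MeasurableSet A) :
    Measurable fun t => jumpLaw Λ i (shiftEvent j A t) :=
  measurable_measure_prodMk_left (measurableSet_shiftEvent_prod j hA)

lemma measure_jumpPath_eq (i : Fin M) {B : Set (IndexPath M)} (hB : MeasurableSet B) :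
    markSeqMeasure Λ {e | jumpPath i e ∈ B} = jumpLaw Λ i B := by
  rw [jumpLaw, Measure.map_apply (measurable_jumpPath i) hB]; rfl

/-- The renewal equation. -/
lemma jumpLaw_shiftEvent (i j : Fin M) {A : Set (IndexPath M)} (hA : MeasurableSet A) (t : ℝ≥0) :
    jumpLaw Λ i (shiftEvent j A t) =
      (∫⁻ s in Ioc 0 (t : ℝ), expDensity (jumpRate Λ) s *
        ∑ m, ENNReal.ofReal (jumpProb Λ i m) * jumpLaw Λ m (shiftEvent j A (t - s).toNNReal))
      + ENNReal.ofReal (Real.exp (-jumpRate Λ * t)) * (if i = j then jumpLaw Λ j A else 0) := by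
  rw [jumpLaw_apply Λ i (measurableSet_shiftEvent j hA t), ← Ioc_union_Ioi_eq_Ioi t.coe_nonneg,
    lintegral_union measurableSet_Ioi (disjoint_left.2 fun s hs hs' => absurd hs.2 (not_le.2 hs'))]
  congr 1
  -- First jump at a time `s ≤ t`: afterwards the path is a fresh one started at `U i`, observed at
  -- the remaining time `t - s`.
  · refine setLIntegral_congr_fun measurableSet_Ioc fun s hs => ?_
    rw [← lintegral_pi_jumpMeasure]
    congr 1
    refine lintegral_congr fun U => ?_
    rw [← measure_jumpPath_eq Λ _ (measurableSet_shiftEvent j hA _)]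
    refine measure_congr ?_
    filter_upwards [ae_nonExplosive Λ] with e he
    have hcoe : (((t : ℝ) - s).toNNReal : ℝ) = t - s := Real.coe_toNNReal _ (sub_nonneg.2 hs.2)
    have h1 : (jumpPath i (consMark (s, U) e)).1 t = (jumpPath (U i) e).1 (t - s).toNNReal :=
      he.jumpPath_cons_of_le (a := (s, U)) hs.1 i hcoe
    have h2 : shift t (jumpPath i (consMark (s, U) e))
        = shift (t - s).toNNReal (jumpPath (U i) e) := by
      refine Subtype.ext (funext fun r => ?_)
      refine he.jumpPath_cons_of_le (a := (s, U)) hs.1 i ?_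
      rw [NNReal.coe_add, NNReal.coe_add, hcoe]
      ring
    have h3 : (jumpPath i (consMark (s, U) e) ∈ shiftEvent j A t)
        = (jumpPath (U i) e ∈ shiftEvent j A (t - s).toNNReal) := by
      simp only [shiftEvent, mem_ofPred_eq, h1, h2]
    exact h3
  -- First jump after `t`: the exponential law has no memory, so translating the holding time by `t`
  -- costs the factor `e^{-rt}` and leaves a path with the law of one started at `i`.
  · have hmeas : MeasurableSet {ω : IndexPath M | i = j ∧ ω ∈ A} := (MeasurableSet.const _).inter hA
    have h1 : (if i = j then jumpLaw Λ j A else 0) = jumpLaw Λ i {ω | i = j ∧ ω ∈ A} := by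
      split_ifs with h
      · subst h; simp
      · simp [h]
    rw [h1, jumpLaw_apply Λ i hmeas]
    have h2 : ∀ s : ℝ, 0 < s → expDensity (jumpRate Λ) (s + t) *
        ∫⁻ U, markSeqMeasure Λ {e | jumpPath i (consMark (s + t, U) e) ∈ shiftEvent j A t}
          ∂(Measure.pi (jumpMeasure Λ))
        = ENNReal.ofReal (Real.exp (-jumpRate Λ * t)) * (expDensity (jumpRate Λ) s *
        ∫⁻ U, markSeqMeasure Λ {e | jumpPath i (consMark (s, U) e) ∈ {ω | i = j ∧ ω ∈ A}}
          ∂(Measure.pi (jumpMeasure Λ))) := by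
      intro s hs
      rw [← mul_assoc]
      congr 1
      · rw [expDensity, expDensity, ← ENNReal.ofReal_mul (Real.exp_pos _).le]
        congr 1
        rw [mul_add, Real.exp_add]
        ring
      · refine lintegral_congr fun U => measure_congr ?_
        filter_upwards [ae_nonExplosive Λ] with e he
        have h3 : (jumpPath i (consMark (s + t, U) e)).1 t = i :=
          he.jumpPath_cons_of_lt (a := (s + t, U)) i (by simpa using hs)
        have h4 : shift t (jumpPath i (consMark (s + t, U) e)) = jumpPath i (consMark (s, U) e) := by
          refine Subtype.ext (funext fun r => ?_)
          rw [shift_apply]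
          rcases lt_or_ge (r : ℝ) s with h | h
          · rw [he.jumpPath_cons_of_lt (a := (s, U)) i h,
              he.jumpPath_cons_of_lt (a := (s + t, U)) i (by push_cast; linarith)]
          · have hcoe : (((r : ℝ) - s).toNNReal : ℝ) = r - s :=
              Real.coe_toNNReal _ (sub_nonneg.2 h)
            rw [he.jumpPath_cons_of_le (a := (s, U)) hs i hcoe]
            refine he.jumpPath_cons_of_le (a := (s + t, U)) (by
              have := t.coe_nonneg
              show 0 < s + (t : ℝ)
              linarith) i ?_
            rw [hcoe]; push_cast; ring
        have h5 : (jumpPath i (consMark (s + t, U) e) ∈ shiftEvent j A t)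
            = (jumpPath i (consMark (s, U) e) ∈ {ω | i = j ∧ ω ∈ A}) := by
          simp only [shiftEvent, mem_ofPred_eq, h3, h4]
        exact h5
    rw [← lintegral_const_mul' _ _ ENNReal.ofReal_ne_top, ← lintegral_indicator measurableSet_Ioi,
      ← lintegral_indicator measurableSet_Ioi, ← lintegral_add_right_eq_self _ (t : ℝ)]
    refine lintegral_congr fun s => ?_
    by_cases hs : 0 < s
    · rw [indicator_of_mem (by simpa using hs), indicator_of_mem (by simpa using hs), h2 s hs]
    · rw [indicator_of_notMem (by simpa using hs), indicator_of_notMem (by simpa using hs)]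

end Law

end HJSystem

end

noncomputable section

namespace HJSystem

/-! ### From the renewal equation to the semigroup. -/

section Semigroup

variable {M : ℕ} (Λ : Matrix (Fin M) (Fin M) ℝ) [IsRateMatrix Λ]

/-- The real form of the renewal equation. -/
lemma jumpLaw_real_shiftEvent (i j : Fin M) {A : Set (IndexPath M)} (hA : MeasurableSet A)
    {t : ℝ} (ht : 0 ≤ t) :
    (jumpLaw Λ i).real (shiftEvent j A t.toNNReal) = Real.exp (-jumpRate Λ * t) *
      ((if i = j then (jumpLaw Λ j).real A else 0) +
        ∫ s in (0 : ℝ)..t, jumpRate Λ * Real.exp (jumpRate Λ * s) *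
          ∑ m, jumpProb Λ i m * (jumpLaw Λ m).real (shiftEvent j A s.toNNReal)) := by
  have hr := jumpRate_pos Λ
  have h1 := congrArg ENNReal.toReal (jumpLaw_shiftEvent Λ i j hA t.toNNReal)
  have hfin : ∀ s : ℝ, ∑ m, ENNReal.ofReal (jumpProb Λ i m) * jumpLaw Λ m
      (shiftEvent j A ((t.toNNReal : ℝ) - s).toNNReal) ≠ ∞ := fun s =>
    ENNReal.sum_ne_top.2 fun m _ => ENNReal.mul_ne_top ENNReal.ofReal_ne_top (measure_ne_top _ _)
  have hmeas : Measurable fun s : ℝ => expDensity (jumpRate Λ) s *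
      ∑ m, ENNReal.ofReal (jumpProb Λ i m) *
        jumpLaw Λ m (shiftEvent j A ((t.toNNReal : ℝ) - s).toNNReal) := by
    refine (measurable_expDensity _).mul (Finset.measurable_sum _ fun m _ => ?_)
    exact ((measurable_jumpLaw_shiftEvent Λ m j hA).comp
      ((measurable_const.sub measurable_id).real_toNNReal)).const_mul _
  have hI : (∫⁻ s in Ioc 0 (t.toNNReal : ℝ), expDensity (jumpRate Λ) s *
      ∑ m, ENNReal.ofReal (jumpProb Λ i m) *
        jumpLaw Λ m (shiftEvent j A ((t.toNNReal : ℝ) - s).toNNReal)).toReal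
      = ∫ s in (0 : ℝ)..t, jumpRate Λ * Real.exp (-jumpRate Λ * s) *
          ∑ m, jumpProb Λ i m * (jumpLaw Λ m).real (shiftEvent j A (t - s).toNNReal) := by
    rw [← integral_toReal hmeas.aemeasurable (Eventually.of_forall fun s =>
      ENNReal.mul_lt_top ENNReal.ofReal_lt_top (hfin s).lt_top), Real.coe_toNNReal t ht,
      intervalIntegral.integral_of_le ht]
    refine integral_congr_ae (Eventually.of_forall fun s => ?_)
    dsimp only
    rw [ENNReal.toReal_mul, expDensity, ENNReal.toReal_ofReal (by positivity),
      ENNReal.toReal_sum fun m _ => ENNReal.mul_ne_top ENNReal.ofReal_ne_top (measure_ne_top _ _)]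
    congr 1
    refine Finset.sum_congr rfl fun m _ => ?_
    rw [ENNReal.toReal_mul, ENNReal.toReal_ofReal (jumpProb_nonneg Λ i m)]
    rfl
  have hne : ∫⁻ s in Ioc 0 (t.toNNReal : ℝ), expDensity (jumpRate Λ) s *
      ∑ m, ENNReal.ofReal (jumpProb Λ i m) *
        jumpLaw Λ m (shiftEvent j A ((t.toNNReal : ℝ) - s).toNNReal) ≠ ∞ := by
    refine ne_top_of_le_ne_top (measure_ne_top (jumpLaw Λ i) (shiftEvent j A t.toNNReal)) ?_
    rw [jumpLaw_shiftEvent Λ i j hA t.toNNReal]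
    exact le_self_add
  have hne2 : (if i = j then jumpLaw Λ j A else 0) ≠ ∞ := by
    split_ifs
    · exact measure_ne_top _ _
    · exact ENNReal.zero_ne_top
  rw [ENNReal.toReal_add hne (ENNReal.mul_ne_top ENNReal.ofReal_ne_top hne2), hI,
    ENNReal.toReal_mul, ENNReal.toReal_ofReal (Real.exp_pos _).le, Real.coe_toNNReal t ht] at h1
  have h2 : (if i = j then jumpLaw Λ j A else 0).toReal
      = if i = j then (jumpLaw Λ j).real A else 0 := by
    split_ifs <;> simp [Measure.real]
  rw [h2] at h1
  rw [Measure.real, h1, mul_add, add_comm]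
  congr 1
  rw [← intervalIntegral.integral_const_mul]
  -- The substitution `s ↦ t - s` turns the convolution into a primitive with `e^{-rt}` in front, a
  -- form that can be differentiated in `t`.
  have := intervalIntegral.integral_comp_sub_left (a := 0) (b := t) (fun s =>
    Real.exp (-jumpRate Λ * t) * (jumpRate Λ * Real.exp (jumpRate Λ * s) *
          ∑ m, jumpProb Λ i m * (jumpLaw Λ m).real (shiftEvent j A s.toNNReal))) t
  rw [sub_self, sub_zero] at this
  rw [← this]
  refine intervalIntegral.integral_congr fun s _ => ?_
  have hexp : Real.exp (-jumpRate Λ * s)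
      = Real.exp (-jumpRate Λ * t) * Real.exp (jumpRate Λ * (t - s)) := by
    rw [← Real.exp_add]; ring_nf
  rw [hexp]
  ring

/-- The Markov property at a deterministic time, for the process started at an index. -/
lemma jumpLaw_shiftEvent_eq (i j : Fin M) {A : Set (IndexPath M)} (hA : MeasurableSet A)
    (t : ℝ≥0) : (jumpLaw Λ i).real (shiftEvent j A t)
      = transition Λ t i j * (jumpLaw Λ j).real A := by
  have hr := jumpRate_pos Λ
  set G : ℝ → Fin M → ℝ := fun t m => (jumpLaw Λ m).real (shiftEvent j A t.toNNReal) with hG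
  set κ : Fin M → ℝ → ℝ := fun i s => jumpRate Λ * Real.exp (jumpRate Λ * s) *
    ∑ m, jumpProb Λ i m * G s m with hκ
  set c : Fin M → ℝ := fun i => if i = j then (jumpLaw Λ j).real A else 0 with hc
  have hren : ∀ i t, 0 ≤ t → G t i
      = Real.exp (-jumpRate Λ * t) * (c i + ∫ s in (0 : ℝ)..t, κ i s) := fun i t ht =>
    jumpLaw_real_shiftEvent Λ i j hA ht
  have hGmeas : ∀ m, Measurable fun s => G s m := fun m =>
    ((measurable_jumpLaw_shiftEvent Λ m j hA).comp measurable_real_toNNReal).ennreal_toReal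
  have hGbd : ∀ s m, |G s m| ≤ 1 := fun s m => by
    rw [abs_of_nonneg measureReal_nonneg]; exact measureReal_le_one
  have hκmeas : ∀ i, Measurable (κ i) := fun i =>
    ((measurable_const.mul (Real.measurable_exp.comp (measurable_const.mul measurable_id)))).mul
      (Finset.measurable_sum _ fun m _ => (hGmeas m).const_mul _)
  have hκint : ∀ i a b, IntervalIntegrable (κ i) volume a b := by
    intro i a b
    refine (Continuous.intervalIntegrable (u := fun s => jumpRate Λ * Real.exp (jumpRate Λ * s)
      * ∑ m, |jumpProb Λ i m|) (by fun_prop) a b).mono_fun (hκmeas i).aestronglyMeasurable ?_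
    refine Eventually.of_forall fun s => ?_
    simp only [hκ, Real.norm_eq_abs, abs_mul]
    refine mul_le_mul_of_nonneg_left ?_ (by positivity)
    refine (Finset.abs_sum_le_sum_abs _ _).trans ?_
    rw [abs_of_nonneg (Finset.sum_nonneg fun m _ => abs_nonneg (jumpProb Λ i m))]
    refine Finset.sum_le_sum fun m _ => ?_
    rw [abs_mul]
    exact mul_le_of_le_one_right (abs_nonneg _) (hGbd s m)
  -- A priori `G` is only bounded and measurable. The renewal equation makes it continuous, hence
  -- `κ` is continuous too and its primitive has a right derivative.
  have hGc : ∀ i, ContinuousOn (fun t => G t i) (Ici 0) := fun i => by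
    have h1 : Continuous fun t => Real.exp (-jumpRate Λ * t) * (c i + ∫ s in (0 : ℝ)..t, κ i s) :=
      (by fun_prop : Continuous fun t => Real.exp (-jumpRate Λ * t)).mul
        (continuous_const.add (intervalIntegral.continuous_primitive (hκint i) 0))
    exact h1.continuousOn.congr fun t ht => hren i t ht
  have hκc : ∀ i, ContinuousOn (κ i) (Ici 0) := fun i =>
    (by fun_prop : Continuous fun s => jumpRate Λ * Real.exp (jumpRate Λ * s)).continuousOn.mul
      (continuousOn_finsetSum _ fun m _ => continuousOn_const.mul (hGc m))
  -- Differentiating the renewal equation gives `G' = -r G + r P G = -Λ G`, because `P = 1 - Λ / r`.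
  have key := eq_transition_of_hasDerivWithinAt Λ (g := G) hGc (fun t ht i => ?_) t.coe_nonneg i
  · have h0 : ∀ m, G 0 m = c m := fun m => by simp [hren m 0 le_rfl]
    have hGt : G t i = (jumpLaw Λ i).real (shiftEvent j A t) := by simp [hG]
    rw [← hGt, key]
    simp [h0, hc]
  · have h1 : HasDerivWithinAt (fun t => ∫ s in (0 : ℝ)..t, κ i s) (κ i t) (Ici t) t := by
      refine intervalIntegral.integral_hasDerivWithinAt_right (hκint i 0 t) (s := Ici t) (t := Ioi t)
        ((hκmeas i).stronglyMeasurable.stronglyMeasurableAtFilter) ?_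
      exact ((hκc i) t ht).mono (Ioi_subset_Ici_self.trans (Ici_subset_Ici.2 ht))
    have h2 : HasDerivAt (fun t => Real.exp (-jumpRate Λ * t))
        (Real.exp (-jumpRate Λ * t) * (-jumpRate Λ)) t := by
      simpa using ((hasDerivAt_id t).const_mul (-jumpRate Λ)).exp
    have h3 := h2.hasDerivWithinAt.mul (h1.const_add (c i)) (s := Ici t)
    refine HasDerivWithinAt.congr (f := fun t => Real.exp (-jumpRate Λ * t) *
      (c i + ∫ s in (0 : ℝ)..t, κ i s)) ?_ (fun s hs => hren i s (ht.trans hs)) (hren i t ht)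
    refine h3.congr_deriv ?_
    have h4 : Real.exp (-jumpRate Λ * t) * (-jumpRate Λ) * (c i + ∫ s in (0 : ℝ)..t, κ i s)
        = -jumpRate Λ * G t i := by rw [hren i t ht]; ring
    have h5 : Real.exp (-jumpRate Λ * t) * κ i t = jumpRate Λ * ∑ m, jumpProb Λ i m * G t m := by
      have : Real.exp (-jumpRate Λ * t) * Real.exp (jumpRate Λ * t) = 1 := by
        rw [← Real.exp_add]; simp
      simp only [hκ]
      linear_combination (jumpRate Λ * ∑ m, jumpProb Λ i m * G t m) * this
    rw [h4, h5]
    simp only [jumpProb, sub_mul, Finset.sum_sub_distrib, Matrix.one_apply, ite_mul, one_mul,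
      zero_mul, Finset.sum_ite_eq, Finset.mem_univ, if_true]
    have h6 : jumpRate Λ * ∑ m, Λ i m / jumpRate Λ * G t m = ∑ m, Λ i m * G t m := by
      rw [Finset.mul_sum]
      refine Finset.sum_congr rfl fun m _ => ?_
      field_simp
    rw [mul_sub, h6]
    ring

end Semigroup

end HJSystem

end

noncomputable section

namespace HJSystem

/-! ### The path measures and their Markov property. -/

section PathMeasure

variable {M : ℕ} (Λ : Matrix (Fin M) (Fin M) ℝ)

lemma vecMul_single_transition (i j : Fin M) (t : ℝ) :
    Matrix.vecMul (Pi.single i 1) (NormedSpace.exp (-t • Λ)) j = transition Λ t i j := by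
  rw [Matrix.single_one_vecMul]; rfl

lemma measurableSet_cylinder {n : ℕ} (s : Fin n → ℝ≥0) (b : Fin n → Fin M) :
    MeasurableSet {ω : IndexPath M | ∀ l, ω.1 (s l) = b l} := by
  rw [ofPred_forall]
  exact MeasurableSet.iInter fun l => measurable_eval (s l) (measurableSet_singleton _)

variable [IsRateMatrix Λ]

/-- Induction on the number of times: the Markov property at the first time splits off one factor
and shifts the other times back by `t 0`. -/
lemma jumpLaw_real_cylinder (k : ℕ) (i : Fin M) (t : Fin (k + 1) → ℝ≥0) (j : Fin (k + 1) → Fin M)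
    (ht : StrictMono t) : (jumpLaw Λ i).real {ω | ∀ l, ω.1 (t l) = j l}
      = cylinderWeight Λ (Pi.single i 1) t j := by
  induction k generalizing i with
  | zero =>
    have h : {ω : IndexPath M | ∀ l, ω.1 (t l) = j l} = shiftEvent (j 0) univ (t 0) := by
      ext ω; simp [shiftEvent]
    rw [h, jumpLaw_shiftEvent_eq Λ _ _ MeasurableSet.univ, cylinderWeight,
      vecMul_single_transition]
    simp
  | succ k ih =>
    let t' : Fin (k + 1) → ℝ≥0 := fun l => t l.succ - t 0
    have hle : ∀ l : Fin (k + 1), t 0 ≤ t l.succ := fun l => ht.monotone (Fin.zero_le _)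
    have ht' : StrictMono t' := fun a b hab =>
      tsub_lt_tsub_right_of_le (hle a) (ht (Fin.succ_lt_succ_iff.2 hab))
    have h : {ω : IndexPath M | ∀ l, ω.1 (t l) = j l}
        = shiftEvent (j 0) {ω | ∀ l, ω.1 (t' l) = j l.succ} (t 0) := by
      ext ω
      simp only [shiftEvent, mem_ofPred_eq, shift_apply, t', add_tsub_cancel_of_le (hle _)]
      exact Fin.forall_fin_succ
    rw [h, jumpLaw_shiftEvent_eq Λ _ _ (measurableSet_cylinder _ _), ih (j 0) t' _ ht',
      cylinderWeight, cylinderWeight, vecMul_single_transition, vecMul_single_transition,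
      Fin.prod_univ_succ]
    have hc : ∀ l : Fin (k + 1), (t' l : ℝ) = t l.succ - t 0 := fun l => NNReal.coe_sub (hle l)
    congr 1
    congr 1
    · rw [hc]; rfl
    · refine Finset.prod_congr rfl fun l _ => ?_
      rw [hc, hc, sub_sub_sub_cancel_right]
      rfl

lemma extendsCylinderWeight_jumpLaw (i : Fin M) :
    ExtendsCylinderWeight Λ (Pi.single i 1) (jumpLaw Λ i) := by
  refine ⟨inferInstance, fun k t j ht => ?_⟩
  rw [← jumpLaw_real_cylinder Λ k i t j ht, ofReal_measureReal]

/-- The choice in `pathMeasure` is harmless: `jumpLaw` is a candidate, and candidates are unique. -/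
lemma pathMeasureAt_eq (i : Fin M) : pathMeasureAt Λ i = jumpLaw Λ i :=
  (Classical.epsilon_spec (p := ExtendsCylinderWeight Λ (Pi.single i 1))
    ⟨_, extendsCylinderWeight_jumpLaw Λ i⟩).unique (extendsCylinderWeight_jumpLaw Λ i)

instance (i : Fin M) : IsProbabilityMeasure (pathMeasureAt Λ i) := by
  rw [pathMeasureAt_eq]; infer_instance

/-- The Markov property at a deterministic time. -/
lemma pathMeasureAt_shiftEvent (i j : Fin M) {A : Set (IndexPath M)} (hA : MeasurableSet A)
    (t : ℝ≥0) : (pathMeasureAt Λ i).real (shiftEvent j A t)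
      = transition Λ t i j * (pathMeasureAt Λ j).real A := by
  rw [pathMeasureAt_eq, pathMeasureAt_eq, jumpLaw_shiftEvent_eq Λ i j hA]

lemma pathMeasureAt_real_eval (i j : Fin M) (t : ℝ≥0) :
    (pathMeasureAt Λ i).real {ω | ω.1 t = j} = transition Λ t i j := by
  have := pathMeasureAt_shiftEvent Λ i j MeasurableSet.univ t
  simpa [shiftEvent] using this

/-- No matrix computation is needed for stochasticity: the entries are probabilities. -/
lemma transition_nonneg (i j : Fin M) (t : ℝ≥0) : 0 ≤ transition Λ t i j := by
  rw [← pathMeasureAt_real_eval]; exact measureReal_nonneg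

lemma sum_transition (i : Fin M) (t : ℝ≥0) : ∑ j, transition Λ t i j = 1 := by
  simp_rw [← pathMeasureAt_real_eval]
  have h := sum_measureReal_preimage_singleton (μ := pathMeasureAt Λ i) (Finset.univ : Finset (Fin M))
    (f := fun ω : IndexPath M => ω.1 t)
    (fun y _ => measurable_eval t (measurableSet_singleton y))
  rw [Finset.coe_univ, preimage_univ, probReal_univ] at h
  exact h

lemma ae_eval_zero (i : Fin M) : ∀ᵐ ω ∂(pathMeasureAt Λ i), ω.1 0 = i := by
  have h := pathMeasureAt_real_eval Λ i i 0
  simp only [NNReal.coe_zero, transition_zero, Matrix.one_apply_eq] at h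
  have hm : MeasurableSet {ω : IndexPath M | ω.1 0 = i} :=
    measurable_eval 0 (measurableSet_singleton i)
  refine (mem_ae_iff_prob_eq_one (μ := pathMeasureAt Λ i) hm).2 ?_
  rw [← ofReal_measureReal (μ := pathMeasureAt Λ i), h, ENNReal.ofReal_one]

/-- The law of the shifted path on the event that the path is at `j`. -/
lemma map_shift_restrict (i j : Fin M) (t : ℝ≥0) :
    ((pathMeasureAt Λ i).restrict {ω | ω.1 t = j}).map (shift t)
      = ENNReal.ofReal (transition Λ t i j) • pathMeasureAt Λ j := by
  have hs : Measurable (shift t : IndexPath M → IndexPath M) :=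
    measurable_shift.comp measurable_prodMk_left
  ext A hA
  rw [Measure.map_apply hs hA, Measure.restrict_apply (hs hA), Measure.smul_apply, smul_eq_mul]
  have h1 : shift t ⁻¹' A ∩ {ω : IndexPath M | ω.1 t = j} = shiftEvent j A t := by
    ext ω; simp [shiftEvent, and_comm]
  rw [h1, ← ofReal_measureReal (μ := pathMeasureAt Λ i), pathMeasureAt_shiftEvent Λ i j hA,
    ENNReal.ofReal_mul (transition_nonneg Λ i j t), ofReal_measureReal]

/-! ### The Markov property with respect to the past -/

/-- Conditioning at the earliest time `s 0` shortens both cylinders by one time and changes the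
starting index to `b 0`, so induction applies. At the end only the Markov property at `t` remains.
-/
lemma pathMeasureAt_cylinder_inter {n : ℕ} (i k : Fin M) (s : Fin n → ℝ≥0) (b : Fin n → Fin M)
    (t : ℝ≥0) (hs : Monotone s) (hst : ∀ l, s l ≤ t) {A : Set (IndexPath M)}
    (hA : MeasurableSet A) :
    (pathMeasureAt Λ i).real ({ω | ∀ l, ω.1 (s l) = b l} ∩ shiftEvent k A t)
      = (pathMeasureAt Λ i).real ({ω | ∀ l, ω.1 (s l) = b l} ∩ {ω | ω.1 t = k})
        * (pathMeasureAt Λ k).real A := by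
  induction n generalizing i t with
  | zero => simp [pathMeasureAt_shiftEvent Λ i k hA, pathMeasureAt_real_eval]
  | succ n ih =>
    let s' : Fin n → ℝ≥0 := fun l => s l.succ - s 0
    have hle : ∀ l : Fin n, s 0 ≤ s l.succ := fun l => hs (Fin.zero_le _)
    have hs' : Monotone s' := fun a c hac =>
      tsub_le_tsub_right (hs (Fin.succ_le_succ_iff.2 hac)) _
    have hst' : ∀ l, s' l ≤ t - s 0 := fun l => tsub_le_tsub_right (hst _) _
    have e1 : ∀ ω : IndexPath M, shift t ω = shift (t - s 0) (shift (s 0) ω) := fun ω => by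
      refine Subtype.ext (funext fun r => ?_)
      simp only [shift_apply]
      rw [← add_assoc, add_tsub_cancel_of_le (hst 0)]
    have h1 : {ω : IndexPath M | ∀ l, ω.1 (s l) = b l} ∩ shiftEvent k A t
        = shiftEvent (b 0) ({ω | ∀ l, ω.1 (s' l) = b l.succ} ∩ shiftEvent k A (t - s 0)) (s 0) := by
      ext ω
      simp only [shiftEvent, mem_inter_iff, mem_ofPred_eq, shift_apply, s',
        add_tsub_cancel_of_le (hle _), add_tsub_cancel_of_le (hst 0), Fin.forall_fin_succ, e1 ω,
        and_assoc]
    have h2 : {ω : IndexPath M | ∀ l, ω.1 (s l) = b l} ∩ {ω | ω.1 t = k}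
        = shiftEvent (b 0) ({ω | ∀ l, ω.1 (s' l) = b l.succ} ∩ {ω | ω.1 (t - s 0) = k}) (s 0) := by
      ext ω
      simp only [shiftEvent, mem_inter_iff, mem_ofPred_eq, shift_apply, s',
        add_tsub_cancel_of_le (hle _), add_tsub_cancel_of_le (hst 0), Fin.forall_fin_succ,
        and_assoc]
    rw [h1, h2, pathMeasureAt_shiftEvent, pathMeasureAt_shiftEvent, ih _ _ _ _ hs' hst', mul_assoc]
    · exact (measurableSet_cylinder _ _).inter (measurable_eval _ (measurableSet_singleton k))
    · exact (measurableSet_cylinder _ _).inter (measurableSet_shiftEvent k hA _)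

/-- The Markov property with respect to the past. -/
lemma pathMeasureAt_inter_shiftEvent (i k : Fin M) (t : ℝ≥0) {B : Set (IndexPath M)}
    (hB : MeasurableSet[pathFiltration M t] B) {A : Set (IndexPath M)} (hA : MeasurableSet A) :
    (pathMeasureAt Λ i).real (B ∩ shiftEvent k A t)
      = (pathMeasureAt Λ i).real (B ∩ {ω | ω.1 t = k}) * (pathMeasureAt Λ k).real A := by
  have hS1 := measurableSet_shiftEvent k hA t
  have hS2 : MeasurableSet {ω : IndexPath M | ω.1 t = k} :=
    measurable_eval t (measurableSet_singleton k)
  -- Cylinders with times up to `t` form a π-system generating `𝓕_t`, so it suffices to compare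
  -- there two finite measures restricted to `𝓕_t`.
  let C : Set (Set (IndexPath M)) :=
    {B | ∃ (I : Finset ℝ≥0) (b : ℝ≥0 → Fin M), (∀ s ∈ I, s ≤ t) ∧ B = {ω | ∀ s ∈ I, ω.1 s = b s}}
  have hpi : IsPiSystem C := by
    rintro _ ⟨I, b, hI, rfl⟩ _ ⟨J, c, hJ, rfl⟩ ⟨ω, h1, h2⟩
    refine ⟨I ∪ J, ω.1, fun s hs => (Finset.mem_union.1 hs).elim (hI s) (hJ s), ?_⟩
    ext η
    simp only [mem_inter_iff, mem_ofPred_eq, Finset.mem_union]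
    constructor
    · rintro ⟨h3, h4⟩ s (h | h)
      · rw [h3 s h, h1 s h]
      · rw [h4 s h, h2 s h]
    · intro h
      exact ⟨fun s hs => by rw [h s (Or.inl hs), h1 s hs],
        fun s hs => by rw [h s (Or.inr hs), h2 s hs]⟩
  have hgen : (pathFiltration M t : MeasurableSpace (IndexPath M))
      = MeasurableSpace.generateFrom C := by
    refine le_antisymm (iSup_le fun s => ?_) (MeasurableSpace.generateFrom_le ?_)
    · refine Measurable.comap_le ?_
      refine @measurable_to_countable' _ _ _ _ (MeasurableSpace.generateFrom C) _ fun b => ?_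
      refine MeasurableSpace.measurableSet_generateFrom ⟨{s.1}, fun _ => b, by simpa using mem_Iic.1 s.2, ?_⟩
      ext ω; simp
    · rintro _ ⟨I, b, hI, rfl⟩
      have : {ω : IndexPath M | ∀ s ∈ I, ω.1 s = b s}
          = ⋂ s ∈ I, (fun ω : IndexPath M => ω.1 s) ⁻¹' {b s} := by ext; simp
      rw [this]
      refine Finset.measurableSet_biInter I fun s hs => ?_
      refine (le_iSup (fun r : Iic t => MeasurableSpace.comap
        (fun ω : IndexPath M => ω.1 r) inferInstance) ⟨s, hI s hs⟩) _ ?_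
      exact ⟨{b s}, measurableSet_singleton _, rfl⟩
  have hle := (pathFiltration M).le t
  have htot : ∀ D, (pathMeasureAt Λ i).real (D ∩ shiftEvent k A t)
        = (pathMeasureAt Λ i).real (D ∩ {ω | ω.1 t = k}) * (pathMeasureAt Λ k).real A →
      pathMeasureAt Λ i (D ∩ shiftEvent k A t)
        = pathMeasureAt Λ k A * pathMeasureAt Λ i (D ∩ {ω | ω.1 t = k}) := fun D h => by
    rw [← ofReal_measureReal (μ := pathMeasureAt Λ i), h, mul_comm,
      ENNReal.ofReal_mul measureReal_nonneg, ofReal_measureReal, ofReal_measureReal]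
  have hext : ((pathMeasureAt Λ i).restrict (shiftEvent k A t)).trim hle
      = (pathMeasureAt Λ k A • (pathMeasureAt Λ i).restrict {ω | ω.1 t = k}).trim hle := by
    have : IsFiniteMeasure (((pathMeasureAt Λ i).restrict (shiftEvent k A t)).trim hle) :=
      isFiniteMeasure_trim hle
    refine ext_of_generate_finite C hgen hpi ?_ ?_
    · rintro _ ⟨I, b, hI, rfl⟩
      have hD : MeasurableSet[pathFiltration M t] {ω : IndexPath M | ∀ s ∈ I, ω.1 s = b s} := by
        rw [hgen]
        exact MeasurableSpace.measurableSet_generateFrom ⟨I, b, hI, rfl⟩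
      rw [trim_measurableSet_eq hle hD, trim_measurableSet_eq hle hD,
        Measure.restrict_apply (hle _ hD), Measure.smul_apply, Measure.restrict_apply (hle _ hD)]
      refine htot _ ?_
      let s := I.orderEmbOfFin rfl
      have hset : {ω : IndexPath M | ∀ s ∈ I, ω.1 s = b s}
          = {ω : IndexPath M | ∀ l, ω.1 (s l) = b (s l)} := by
        ext ω
        constructor
        · intro h l
          exact h _ (I.orderEmbOfFin_mem rfl l)
        · intro h r hr
          have : r ∈ Set.range s := by
            rw [Finset.range_orderEmbOfFin]
            exact hr
          obtain ⟨l, rfl⟩ := this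
          exact h l
      rw [hset]
      exact pathMeasureAt_cylinder_inter Λ i k _ _ t s.monotone
        (fun l => hI _ (I.orderEmbOfFin_mem rfl l)) hA
    · rw [trim_measurableSet_eq hle MeasurableSet.univ, trim_measurableSet_eq hle MeasurableSet.univ,
        Measure.restrict_apply MeasurableSet.univ, Measure.smul_apply,
        Measure.restrict_apply MeasurableSet.univ]
      refine htot _ ?_
      simp only [univ_inter]
      rw [pathMeasureAt_shiftEvent Λ i k hA, pathMeasureAt_real_eval]
  have h := congrFun (congrArg DFunLike.coe hext) B
  rw [trim_measurableSet_eq hle hB, trim_measurableSet_eq hle hB,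
    Measure.restrict_apply (hle _ hB), Measure.smul_apply, Measure.restrict_apply (hle _ hB)] at h
  rw [Measure.real, h, smul_eq_mul, ENNReal.toReal_mul, mul_comm]
  rfl

end PathMeasure

end HJSystem

end

noncomputable section

namespace HJSystem

/-! ## Lagrangians -/

section Lagrangian

variable {M N : ℕ} {H : Fin M → Torus N → Euc N → ℝ} {Λ : Matrix (Fin M) (Fin M) ℝ}

lemma StandingAssumptions.isRateMatrix (h : StandingAssumptions H Λ) : IsRateMatrix Λ :=
  ⟨h.offDiag_nonpos, h.row_sum⟩

lemma StandingAssumptions.exists_hamiltonian_bound_ball (h : StandingAssumptions H Λ) (i : Fin M) (R : ℝ) :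
    ∃ C, ∀ x p, ‖p‖ ≤ R → |H i x p| ≤ C := by
  obtain ⟨C, hC⟩ := ((isCompact_univ (X := Torus N)).prod
    (isCompact_closedBall (0 : Euc N) R)).exists_bound_of_continuousOn (h.continuous i).continuousOn
  exact ⟨C, fun x p hp => hC (x, p) ⟨mem_univ _, by simpa using hp⟩⟩

/-- Superlinearity is uniform on the torus. -/
lemma StandingAssumptions.exists_superlinear_bound (h : StandingAssumptions H Λ) (i : Fin M)
    {K : ℝ} (hK : 0 ≤ K) : ∃ C, ∀ x p, K * ‖p‖ - C ≤ H i x p := by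
  suffices hs : ∃ C, ∀ x ∈ (univ : Set (Torus N)), ∀ p, K * ‖p‖ - C ≤ H i x p by
    obtain ⟨C, hC⟩ := hs
    exact ⟨C, fun x => hC x (mem_univ x)⟩
  refine isCompact_univ.induction_on (p := fun S => ∃ C, ∀ x ∈ S, ∀ p, K * ‖p‖ - C ≤ H i x p)
    ⟨0, by simp⟩ ?_ ?_ ?_
  · rintro S S' hS ⟨C, hC⟩
    exact ⟨C, fun x hx => hC x (hS hx)⟩
  · rintro S S' ⟨C, hC⟩ ⟨C', hC'⟩
    refine ⟨max C C', fun x hx p => ?_⟩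
    rcases hx with hx | hx
    · linarith [hC x hx p, le_max_left C C']
    · linarith [hC' x hx p, le_max_right C C']
  · intro x₀ _
    set a := H i x₀ 0
    -- The slope `K + |a| + 2` leaves room: one unit is given up in passing to nearby points `x`,
    -- and `|a| + 1` in removing the value at `p = 0`.
    obtain ⟨R, hR1, hR⟩ : ∃ R, 1 ≤ R ∧ ∀ p : Euc N, R ≤ ‖p‖ → (K + |a| + 2) * ‖p‖ ≤ H i x₀ p := by
      have h1 := (h.superlinear i x₀).eventually (eventually_ge_atTop (K + |a| + 2))
      rw [← comap_norm_atTop, eventually_comap] at h1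
      obtain ⟨R, hR⟩ := eventually_atTop.1 h1
      refine ⟨max R 1, le_max_right _ _, fun p hp => ?_⟩
      have hpos : 0 < ‖p‖ := by linarith [le_max_right R 1]
      exact (le_div_iff₀ hpos).1 (hR ‖p‖ ((le_max_left _ _).trans hp) p rfl)
    have hsph : ∀ᶠ x in 𝓝 x₀, ∀ p ∈ Metric.sphere (0 : Euc N) R, (K + |a| + 1) * R < H i x p := by
      refine (isCompact_sphere (0 : Euc N) R).eventually_forall_of_forall_eventually fun p hp => ?_
      have hp' : ‖p‖ = R := by simpa using hp
      refine (h.continuous i).continuousAt.eventually (lt_mem_nhds ?_)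
      have := hR p hp'.ge
      rw [hp'] at this
      show _ < H i x₀ p
      linarith
    have h0 : ∀ᶠ x in 𝓝 x₀, |H i x 0 - a| < 1 := by
      have hc : Continuous fun x => H i x 0 :=
        (h.continuous i).comp (continuous_id.prodMk continuous_const)
      have := (hc.tendsto x₀).eventually (Metric.ball_mem_nhds a one_pos)
      simpa [Real.dist_eq] using this
    obtain ⟨C', hC'⟩ := h.exists_hamiltonian_bound_ball i R
    refine ⟨_, mem_nhdsWithin_of_mem_nhds (hsph.and h0), max (C' + K * R) (|a| + 1), ?_⟩
    rintro x ⟨hx1, hx2⟩ p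
    have ha : |H i x 0| ≤ |a| + 1 := by
      have := abs_add_le (H i x 0 - a) a
      simp only [sub_add_cancel] at this
      linarith
    rcases le_or_gt ‖p‖ R with hp | hp
    · have h1 := (abs_le.1 (hC' x p hp)).1
      have h2 : K * ‖p‖ ≤ K * R := by gcongr
      linarith [le_max_left (C' + K * R) (|a| + 1)]
    · have hp0 : 0 < ‖p‖ := by linarith
      have hR0 : 0 < R := by linarith
      -- The segment from `0` to `p` crosses the sphere of radius `R`; convexity propagates the
      -- bound there outwards.
      have hmem : (R / ‖p‖) • p ∈ Metric.sphere (0 : Euc N) R := by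
        simp [norm_smul, abs_of_pos hR0, hp0.ne']
      have h1 := hx1 _ hmem
      have hcoef : 0 ≤ 1 - R / ‖p‖ := by rw [sub_nonneg, div_le_one hp0]; exact hp.le
      have hconv := (h.convex i x).2 (mem_univ p) (mem_univ 0)
        (show 0 ≤ R / ‖p‖ by positivity) hcoef (by ring)
      simp only [smul_zero, add_zero, smul_eq_mul] at hconv
      have h2 : (K + |a| + 1) * R < R / ‖p‖ * H i x p + (1 - R / ‖p‖) * H i x 0 :=
        h1.trans_le hconv
      have h3 : (1 - R / ‖p‖) * H i x 0 ≤ (1 - R / ‖p‖) * (|a| + 1) := by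
        gcongr
        exact (le_abs_self _).trans ha
      have h4 : (K + |a| + 1) * R * (‖p‖ / R)
          ≤ (R / ‖p‖ * H i x p + (1 - R / ‖p‖) * (|a| + 1)) * (‖p‖ / R) := by
        gcongr
        linarith
      have e1 : (K + |a| + 1) * R * (‖p‖ / R) = (K + |a| + 1) * ‖p‖ := by field_simp
      have e2 : (R / ‖p‖ * H i x p + (1 - R / ‖p‖) * (|a| + 1)) * (‖p‖ / R)
          = H i x p + (‖p‖ / R - 1) * (|a| + 1) := by field_simp
      rw [e1, e2] at h4
      have h5 : (‖p‖ / R - 1) * (|a| + 1) ≤ ‖p‖ * (|a| + 1) := by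
        gcongr
        linarith [div_le_self hp0.le hR1]
      linarith [le_max_right (C' + K * R) (|a| + 1), abs_nonneg a]

lemma StandingAssumptions.bddAbove_conjugate (h : StandingAssumptions H Λ) (i : Fin M) (x : Torus N)
    (q : Euc N) : BddAbove (range fun p : Euc N => inner ℝ p q - H i x p) := by
  obtain ⟨C, hC⟩ := h.exists_superlinear_bound i (norm_nonneg q)
  refine ⟨C, ?_⟩
  rintro _ ⟨p, rfl⟩
  have := real_inner_le_norm p q
  dsimp only
  linarith [hC x p, mul_comm ‖p‖ ‖q‖]

/-- Fenchel's inequality. -/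
lemma StandingAssumptions.inner_le (h : StandingAssumptions H Λ) (i : Fin M) (x : Torus N)
    (p q : Euc N) : inner ℝ p q ≤ H i x p + lagrangian H i x q := by
  have := le_ciSup (h.bddAbove_conjugate i x q) p
  unfold lagrangian
  linarith

/-- The Lagrangians are continuous. -/
lemma StandingAssumptions.continuous_lagrangian (h : StandingAssumptions H Λ) (i : Fin M) :
    Continuous fun z : Torus N × Euc N => lagrangian H i z.1 z.2 := by
  refine continuous_iff_continuousAt.2 fun z₀ => ?_
  set K := ‖z₀.2‖ + 1
  obtain ⟨C, hC⟩ := h.exists_superlinear_bound i (K := K + 1) (by positivity)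
  obtain ⟨C₀, hC₀⟩ := h.exists_hamiltonian_bound_ball i 0
  have hC₀' : ∀ x, |H i x 0| ≤ C₀ := fun x => hC₀ x 0 (by simp)
  -- For `‖p‖ > C + C₀` and `‖q‖ < K` one has `p · q - H ≤ C - ‖p‖ < -C₀ ≤ -H(x, 0)`. The momentum
  -- `0` does better, so near `z₀` the supremum is over a fixed compact ball.
  set R := max (C + C₀) 0
  have hcont : Continuous fun z : Torus N × Euc N =>
      sSup ((fun p : Euc N => inner ℝ p z.2 - H i z.1 p) '' Metric.closedBall 0 R) := by
    refine (isCompact_closedBall (0 : Euc N) R).continuous_sSup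
      (f := fun (z : Torus N × Euc N) p => inner ℝ p z.2 - H i z.1 p) ?_
    have := h.continuous i
    have h1 : Continuous fun w : (Torus N × Euc N) × Euc N => H i w.1.1 w.2 :=
      this.comp (continuous_fst.fst.prodMk continuous_snd)
    exact (continuous_snd.inner continuous_fst.snd).sub h1
  refine hcont.continuousAt.congr ?_
  have hnear : ∀ᶠ z : Torus N × Euc N in 𝓝 z₀, ‖z.2‖ < K :=
    (continuous_snd.norm.tendsto z₀).eventually (gt_mem_nhds (lt_add_one _))
  filter_upwards [hnear] with z hz
  have h0mem : (0 : Euc N) ∈ Metric.closedBall (0 : Euc N) R :=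
    Metric.mem_closedBall_self (le_max_right _ _)
  have hbdd : BddAbove ((fun p : Euc N => inner ℝ p z.2 - H i z.1 p) '' Metric.closedBall 0 R) :=
    (h.bddAbove_conjugate i z.1 z.2).mono (image_subset_range _ _)
  refine le_antisymm (csSup_le ((nonempty_of_mem h0mem).image _) ?_) (ciSup_le fun p => ?_)
  · rintro _ ⟨p, _, rfl⟩
    exact le_ciSup (h.bddAbove_conjugate i z.1 z.2) p
  · by_cases hp : ‖p‖ ≤ R
    · exact le_csSup hbdd ⟨p, by simpa using hp, rfl⟩
    · refine le_trans ?_ (le_csSup hbdd ⟨0, h0mem, rfl⟩)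
      have h1 := real_inner_le_norm p z.2
      have h2 : ‖p‖ * ‖z.2‖ ≤ ‖p‖ * K := by gcongr
      have h3 := hC z.1 p
      have h4 := (abs_le.1 (hC₀' z.1)).2
      have h5 : C + C₀ < ‖p‖ := (le_max_left _ _).trans_lt (not_le.1 hp)
      simp only [inner_zero_left]
      nlinarith

lemma StandingAssumptions.exists_lagrangian_bound (h : StandingAssumptions H Λ) (R : ℝ) :
    ∃ C, 0 ≤ C ∧ ∀ i x q, ‖q‖ ≤ R → |lagrangian H i x q| ≤ C := by
  have h1 : ∀ i, ∃ C, ∀ x q, ‖q‖ ≤ R → |lagrangian H i x q| ≤ C := fun i => by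
    obtain ⟨C, hC⟩ := ((isCompact_univ (X := Torus N)).prod
      (isCompact_closedBall (0 : Euc N) R)).exists_bound_of_continuousOn
        (h.continuous_lagrangian i).continuousOn
    exact ⟨C, fun x p hp => hC (x, p) ⟨mem_univ _, by simpa using hp⟩⟩
  choose C hC using h1
  refine ⟨∑ i, |C i|, Finset.sum_nonneg fun i _ => abs_nonneg _, fun i x q hq => ?_⟩
  exact ((hC i x q hq).trans (le_abs_self _)).trans
    (Finset.single_le_sum (f := fun i => |C i|) (fun i _ => abs_nonneg _) (Finset.mem_univ i))

lemma StandingAssumptions.exists_hamiltonian_lower_bound (h : StandingAssumptions H Λ) :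
    ∃ C, ∀ i x p, -C ≤ H i x p := by
  have h1 := fun i => h.exists_superlinear_bound i le_rfl
  choose C hC using h1
  refine ⟨∑ i, |C i|, fun i x p => ?_⟩
  have h2 := hC i x p
  have h3 := Finset.single_le_sum (f := fun i => |C i|) (fun i _ => abs_nonneg _) (Finset.mem_univ i)
  linarith [le_abs_self (C i)]

/-- The Hamiltonian is the conjugate of the Lagrangian. -/
lemma StandingAssumptions.exists_sub_lagrangian_ge (h : StandingAssumptions H Λ) (i : Fin M)
    (x : Torus N) (p : Euc N) {ε : ℝ} (hε : 0 < ε) :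
    ∃ q : Euc N, H i x p - ε ≤ inner ℝ p q - lagrangian H i x q := by
  have hcont : Continuous (H i x) := (h.continuous i).comp (continuous_const.prodMk continuous_id)
  -- An affine minorant with value `H i x p - ε` at `p`; its slope is the required `q`, since
  -- minorization says `L(q) ≤ -c`.
  obtain ⟨l, c, hl, hlc⟩ := (h.convex i x).exists_affine_le_of_lt (𝕜 := ℝ) (mem_univ p)
    (a := H i x p - ε) (by linarith) isClosed_univ (hcont.lowerSemicontinuous.lowerSemicontinuousOn univ)
  have hl' : ∀ p', l p' + c ≤ H i x p' := fun p' => hl ⟨p', mem_univ p'⟩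
  have hlc' : l p + c = H i x p - ε := hlc
  obtain ⟨q, hq⟩ : ∃ q : Euc N, ∀ p', inner ℝ p' q = l p' :=
    ⟨(InnerProductSpace.toDual ℝ (Euc N)).symm l, fun p' => by
      rw [real_inner_comm, InnerProductSpace.toDual_symm_apply]⟩
  refine ⟨q, ?_⟩
  have : lagrangian H i x q ≤ -c := ciSup_le fun p' => by
    rw [hq]; linarith [hl' p']
  rw [hq]
  linarith

end Lagrangian

end HJSystem

end

noncomputable section

namespace HJSystem

/-! ## The torus -/

section Torus

variable {N : ℕ}

lemma proj_add (z w : Euc N) : proj (z + w) = proj z + proj w := by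
  ext k; simp [proj]

lemma proj_sub (z w : Euc N) : proj (z - w) = proj z - proj w := by
  ext k; simp [proj]

@[simp] lemma proj_zero : proj (0 : Euc N) = 0 := by
  ext k; simp [proj]

lemma proj_surjective : Function.Surjective (proj : Euc N → Torus N) := fun θ => by
  choose x hx using fun k => QuotientAddGroup.mk_surjective (θ k)
  exact ⟨WithLp.toLp 2 x, funext hx⟩

lemma norm_proj_le (z : Euc N) : ‖proj z‖ ≤ ‖z‖ := by
  refine (pi_norm_le_iff_of_nonneg (norm_nonneg z)).2 fun k => ?_
  exact QuotientAddGroup.norm_mk_le_norm.trans (PiLp.norm_apply_le z k)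

lemma dist_proj_le (z w : Euc N) : dist (proj z) (proj w) ≤ dist z w := by
  rw [dist_eq_norm, dist_eq_norm, ← proj_sub]; exact norm_proj_le _

lemma continuous_proj : Continuous (proj : Euc N → Torus N) :=
  (LipschitzWith.of_dist_le_mul (K := 1) fun z w => by simpa using dist_proj_le z w).continuous

/-- Subtracting the nearest integer from each coordinate realizes the norm of that coordinate; `√N`
compares the Euclidean norm with the maximum norm of the torus. -/
lemma exists_proj_eq_norm_le (θ : Torus N) : ∃ z : Euc N, proj z = θ ∧ ‖z‖ ≤ √N * ‖θ‖ := by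
  obtain ⟨x, rfl⟩ := proj_surjective θ
  have hk : ∀ k, ‖((x k : ℝ) : UnitAddCircle)‖ = |x k - round (x k)| := fun k => by
    rw [AddCircle.norm_eq]; simp
  refine ⟨WithLp.toLp 2 fun k => x k - round (x k), ?_, ?_⟩
  · ext k
    simp only [proj]
    rw [AddCircle.coe_sub, sub_eq_self]
    exact (AddCircle.coe_eq_zero_iff _).2 ⟨round (x k), by simp⟩
  · rw [EuclideanSpace.norm_eq]
    refine Real.sqrt_le_iff.2 ⟨by positivity, ?_⟩
    rw [mul_pow, Real.sq_sqrt (Nat.cast_nonneg N)]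
    have : ∀ k : Fin N, ‖x k - round (x k)‖ ^ 2 ≤ ‖proj x‖ ^ 2 := fun k => by
      rw [Real.norm_eq_abs, ← hk]
      gcongr
      exact norm_le_pi_norm (proj x) k
    refine (Finset.sum_le_sum fun k _ => this k).trans ?_
    simp

/-- A function on the torus which vanishes at the origin only, and has a smooth lift. -/
def wave (θ : Torus N) : ℝ := ∑ k, (1 - (AddCircle.toCircle (θ k) : ℂ).re)

lemma wave_proj (z : Euc N) : wave (proj z) = ∑ k, (1 - Real.cos (2 * Real.pi * z k)) := by
  refine Finset.sum_congr rfl fun k _ => ?_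
  rw [proj, AddCircle.toCircle_apply_mk, Circle.coe_exp, div_one]
  congr 1
  rw [Complex.exp_ofReal_mul_I_re]

lemma continuous_wave : Continuous (wave : Torus N → ℝ) :=
  continuous_finsetSum _ fun k _ => continuous_const.sub
    (Complex.continuous_re.comp (continuous_subtype_val.comp
      (AddCircle.continuous_toCircle.comp (continuous_apply k))))

lemma wave_nonneg (θ : Torus N) : 0 ≤ wave θ := by
  obtain ⟨z, rfl⟩ := proj_surjective θ
  rw [wave_proj]
  exact Finset.sum_nonneg fun k _ => sub_nonneg.2 (Real.cos_le_one _)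

@[simp] lemma wave_zero : wave (0 : Torus N) = 0 := by simp [wave]

lemma eq_zero_of_wave_eq_zero {θ : Torus N} (h : wave θ = 0) : θ = 0 := by
  obtain ⟨z, rfl⟩ := proj_surjective θ
  rw [wave_proj, Finset.sum_eq_zero_iff_of_nonneg fun k _ => sub_nonneg.2 (Real.cos_le_one _)] at h
  ext k
  have hk := h k (Finset.mem_univ k)
  obtain ⟨n, hn⟩ := (Real.cos_eq_one_iff _).1 (sub_eq_zero.1 hk).symm
  have : z k = n := by
    have := Real.pi_pos
    field_simp at hn
    linarith
  simp only [proj, Pi.zero_apply, this]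
  exact (AddCircle.coe_eq_zero_iff _).2 ⟨n, by simp⟩

/-- Points at which the wave is small are close to the origin. -/
lemma exists_wave_lt_imp {η : ℝ} (hη : 0 < η) :
    ∃ δ > 0, ∀ θ : Torus N, wave θ < δ → ‖θ‖ < η := by
  have hK : IsCompact {θ : Torus N | η ≤ ‖θ‖} :=
    (isClosed_le continuous_const continuous_norm).isCompact
  rcases {θ : Torus N | η ≤ ‖θ‖}.eq_empty_or_nonempty with he | hne
  · refine ⟨1, one_pos, fun θ _ => ?_⟩
    by_contra hlt
    have : θ ∈ {θ : Torus N | η ≤ ‖θ‖} := not_lt.1 hlt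
    rw [he] at this
    exact this
  · obtain ⟨θ₀, h0, hmin⟩ := hK.exists_isMinOn hne continuous_wave.continuousOn
    refine ⟨wave θ₀, ?_, fun θ hθ => ?_⟩
    · refine lt_of_le_of_ne (wave_nonneg _) fun h => ?_
      have h1 := eq_zero_of_wave_eq_zero h.symm
      have h2 : η ≤ ‖θ₀‖ := h0
      rw [h1, norm_zero] at h2
      linarith
    · by_contra hlt
      exact absurd hθ (not_lt.2 (hmin (show θ ∈ {θ : Torus N | η ≤ ‖θ‖} from not_lt.1 hlt)))

/-- The lift of the wave. -/
def waveLift (z : Euc N) : ℝ := wave (proj z)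

/-- This is why the wave replaces the squared distance as penalty: test functions must be `C^1` on
the whole torus, and the squared distance is not. -/
lemma contDiff_waveLift : ContDiff ℝ 1 (waveLift : Euc N → ℝ) := by
  have : (waveLift : Euc N → ℝ) = fun z => ∑ k, (1 - Real.cos (2 * Real.pi * z k)) :=
    funext wave_proj
  rw [this]
  fun_prop

lemma lipschitzWith_waveLift :
    LipschitzWith (N * (2 * Real.pi)).toNNReal (waveLift : Euc N → ℝ) := by
  refine LipschitzWith.of_le_add_mul _ fun z w => ?_
  rw [Real.coe_toNNReal _ (by positivity), waveLift, waveLift, wave_proj, wave_proj,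
    ← sub_le_iff_le_add', ← Finset.sum_sub_distrib]
  have h1 : ∀ k : Fin N, (1 - Real.cos (2 * Real.pi * z k)) - (1 - Real.cos (2 * Real.pi * w k))
      ≤ 2 * Real.pi * dist z w := fun k => by
    have h2 := Real.abs_cos_sub_cos_le (2 * Real.pi * w k) (2 * Real.pi * z k)
    have h3 : |2 * Real.pi * w k - 2 * Real.pi * z k| ≤ 2 * Real.pi * dist z w := by
      rw [← mul_sub, abs_mul, abs_of_pos Real.two_pi_pos, abs_sub_comm]
      gcongr
      rw [dist_eq_norm]
      exact PiLp.norm_apply_le (z - w) k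
    linarith [le_abs_self (Real.cos (2 * Real.pi * w k) - Real.cos (2 * Real.pi * z k))]
  refine (Finset.sum_le_sum fun k _ => h1 k).trans ?_
  simp [mul_assoc]

end Torus

end HJSystem

end

noncomputable section

namespace HJSystem

/-! ## Regularization of scalar subsolutions -/

section SupConvolution

variable {N : ℕ}

/-- Scalar viscosity subsolutions of `h(x, Dv) = f(x)` on the torus. -/
def IsScalarSubsolution (h : Torus N → Euc N → ℝ) (f v : Torus N → ℝ) : Prop :=
  ∀ ψ : Torus N → ℝ, ContDiff ℝ 1 (fun w : Euc N => ψ (proj w)) →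
    ∀ z : Euc N, (∀ x : Torus N, v x - ψ x ≤ v (proj z) - ψ (proj z)) →
      h (proj z) (gradient (fun w : Euc N => ψ (proj w)) z) ≤ f (proj z)

/-- The sup-convolution of `v`. -/
def supConv (v : Torus N → ℝ) (ε : ℝ) (x : Euc N) : ℝ :=
  ⨆ θ, (v θ - wave (proj x - θ) / ε)

/-- The point `proj w` is optimal in the definition of the sup-convolution at `x`. -/
def IsSupConvPoint (v : Torus N → ℝ) (ε : ℝ) (x w : Euc N) : Prop :=
  ∀ θ, v θ - wave (proj x - θ) / ε ≤ v (proj w) - waveLift (x - w) / ε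

variable {v : Torus N → ℝ} {ε : ℝ}

lemma exists_isSupConvPoint (hv : Continuous v) (ε : ℝ) (x : Euc N) :
    ∃ w, IsSupConvPoint v ε x w := by
  have hc : Continuous fun θ => v θ - wave (proj x - θ) / ε :=
    hv.sub ((continuous_wave.comp (continuous_const.sub continuous_id)).div_const ε)
  obtain ⟨θ, _, hθ⟩ := isCompact_univ.exists_isMaxOn (univ_nonempty (α := Torus N)) hc.continuousOn
  obtain ⟨w, rfl⟩ := proj_surjective θ
  refine ⟨w, fun θ => ?_⟩
  rw [waveLift, proj_sub]
  exact hθ (mem_univ θ)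

lemma IsSupConvPoint.supConv_eq {x w : Euc N} (hw : IsSupConvPoint v ε x w) :
    supConv v ε x = v (proj w) - waveLift (x - w) / ε := by
  refine le_antisymm (ciSup_le hw) ?_
  rw [waveLift, proj_sub]
  exact le_ciSup (f := fun θ => v θ - wave (proj x - θ) / ε) ⟨_, forall_mem_range.2 hw⟩ (proj w)

lemma IsSupConvPoint.le_supConv {x w : Euc N} (hw : IsSupConvPoint v ε x w) (y : Euc N) :
    v (proj y) - waveLift (x - y) / ε ≤ supConv v ε x := by
  rw [hw.supConv_eq, waveLift, proj_sub]; exact hw _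

/-- A supremum of functions with a common Lipschitz constant. Rademacher's theorem then gives
differentiability almost everywhere. -/
lemma lipschitzWith_supConv (hv : Continuous v) (hε : 0 < ε) :
    LipschitzWith (N * (2 * Real.pi) / ε).toNNReal (supConv v ε) := by
  refine LipschitzWith.of_le_add_mul _ fun x y => ?_
  obtain ⟨w, hw⟩ := exists_isSupConvPoint hv ε x
  obtain ⟨w', hw'⟩ := exists_isSupConvPoint hv ε y
  have h1 := hw'.le_supConv w
  have h2 := lipschitzWith_waveLift.le_add_mul (y - w) (x - w)
  rw [dist_sub_right, Real.coe_toNNReal _ (by positivity)] at h2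
  rw [hw.supConv_eq, Real.coe_toNNReal _ (by positivity)]
  have h3 : waveLift (y - w) / ε ≤ waveLift (x - w) / ε + N * (2 * Real.pi) / ε * dist x y := by
    rw [div_mul_eq_mul_div, ← add_div, dist_comm x y]
    gcongr
  linarith

/-- The momentum at an optimal point. -/
def supConvMomentum (ε : ℝ) (x w : Euc N) : Euc N :=
  -(ε⁻¹ • gradient waveLift (x - w))

/-- Optimality of `w` says that `v - wave (proj x - ·) / ε` is maximal at `proj w`, so the penalty
itself is a test function there. -/
lemma IsSupConvPoint.hamiltonian_le {h : Torus N → Euc N → ℝ} {f : Torus N → ℝ}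
    (hsub : IsScalarSubsolution h f v) {x w : Euc N} (hw : IsSupConvPoint v ε x w) :
    h (proj w) (supConvMomentum ε x w) ≤ f (proj w) := by
  have hfun : (fun w' : Euc N => wave (proj x - proj w') / ε) = fun w' => ε⁻¹ * waveLift (x - w') := by
    funext w'
    rw [waveLift, proj_sub, div_eq_inv_mul]
  have hd := (contDiff_waveLift (N := N)).differentiable one_ne_zero
  have hgrad : gradient (fun w' : Euc N => wave (proj x - proj w') / ε) w = supConvMomentum ε x w := by
    rw [hfun, supConvMomentum]
    refine HasGradientAt.gradient ?_
    have h1 := (hd (x - w)).hasGradientAt.hasFDerivAt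
    have h2 : HasFDerivAt (fun w' : Euc N => x - w') (-(ContinuousLinearMap.id ℝ (Euc N))) w :=
      (hasFDerivAt_id w).const_sub x
    have h3 := (h1.comp w h2).const_mul ε⁻¹
    refine hasGradientAt_iff_hasFDerivAt.2 (h3.congr_fderiv ?_)
    ext y
    simp
  have := hsub (fun θ => wave (proj x - θ) / ε) ?_ w ?_
  · rwa [hgrad] at this
  · rw [hfun]
    exact contDiff_const.mul (contDiff_waveLift.comp (contDiff_const.sub contDiff_id))
  · intro θ
    have := hw θ
    rwa [waveLift, proj_sub] at this

/-- With `w` fixed, `y ↦ supConv v ε y + waveLift (y - w) / ε` is at least `v (proj w)`, with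
equality at `x`; its derivative at `x` vanishes. The momentum seen by the equation at `w` is thus
the gradient of the sup-convolution at `x`. -/
lemma IsSupConvPoint.gradient_eq {x w : Euc N} (hv : Continuous v) (hw : IsSupConvPoint v ε x w)
    (hd : DifferentiableAt ℝ (supConv v ε) x) :
    gradient (supConv v ε) x = supConvMomentum ε x w := by
  have hd' := (contDiff_waveLift (N := N)).differentiable one_ne_zero
  have h1 := (hd' (x - w)).hasGradientAt.hasFDerivAt
  have h2 : HasFDerivAt (fun y : Euc N => y - w) (ContinuousLinearMap.id ℝ (Euc N)) x :=
    (hasFDerivAt_id x).sub_const w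
  have h3 := hd.hasGradientAt.hasFDerivAt.add ((h1.comp x h2).const_mul ε⁻¹)
  have hmin : IsLocalMin (fun y => supConv v ε y + ε⁻¹ * waveLift (y - w)) x := by
    refine Eventually.of_forall fun y => ?_
    obtain ⟨w', hw'⟩ := exists_isSupConvPoint hv ε y
    have h4 := hw'.le_supConv w
    have h5 := hw.supConv_eq
    rw [div_eq_inv_mul] at h4 h5
    dsimp only
    linarith
  have h6 := hmin.hasFDerivAt_eq_zero h3
  have h7 : (InnerProductSpace.toDual ℝ (Euc N)) (gradient (supConv v ε) x
      + ε⁻¹ • gradient waveLift (x - w)) = 0 := by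
    rw [← h6]
    ext y
    simp
  rw [map_eq_zero_iff _ (LinearIsometryEquiv.injective _)] at h7
  rw [supConvMomentum, ← add_eq_zero_iff_eq_neg, h7]

/-- Optimal points are close. -/
lemma exists_supConv_close (hv : Continuous v) {δ : ℝ} (hδ : 0 < δ) :
    ∃ ε > 0, ∀ x w, IsSupConvPoint v ε x w → dist (proj x) (proj w) < δ := by
  obtain ⟨B, hB⟩ := isCompact_univ.exists_bound_of_continuousOn (s := (univ : Set (Torus N)))
    hv.continuousOn
  obtain ⟨η, hη, hη'⟩ := exists_wave_lt_imp (N := N) hδ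
  have hB' : ∀ θ, |v θ| ≤ B := fun θ => hB θ (mem_univ θ)
  have hB0 : 0 ≤ B := (abs_nonneg _).trans (hB' 0)
  -- Testing optimality with `θ = proj x` bounds the wave by `2 * B * ε`, which is less than `η` for
  -- this `ε`.
  refine ⟨η / (2 * B + 1), by positivity, fun x w hw => ?_⟩
  rw [dist_eq_norm, ← proj_sub]
  refine hη' _ ?_
  have h1 := hw (proj x)
  rw [sub_self, wave_zero, zero_div, sub_zero] at h1
  have h2 : waveLift (x - w) / (η / (2 * B + 1)) ≤ 2 * B := by
    linarith [(abs_le.1 (hB' (proj x))).1, (abs_le.1 (hB' (proj w))).2]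
  rw [div_le_iff₀ (by positivity)] at h2
  refine h2.trans_lt ?_
  rw [mul_div_assoc', div_lt_iff₀ (by positivity)]
  nlinarith

/-- Stated in the dual space because it is the Fréchet derivatives that are averaged below. -/
lemma convex_setOf_toDual_symm_le {g : Euc N → ℝ} (hg : ConvexOn ℝ univ g) (c : ℝ) :
    Convex ℝ {l : Euc N →L[ℝ] ℝ | g ((InnerProductSpace.toDual ℝ (Euc N)).symm l) ≤ c} := by
  intro l hl l' hl' a b ha hb hab
  have hl : g ((InnerProductSpace.toDual ℝ (Euc N)).symm l) ≤ c := hl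
  have hl' : g ((InnerProductSpace.toDual ℝ (Euc N)).symm l') ≤ c := hl'
  have h1 := hg.2 (mem_univ ((InnerProductSpace.toDual ℝ (Euc N)).symm l))
    (mem_univ ((InnerProductSpace.toDual ℝ (Euc N)).symm l')) ha hb hab
  have h2 : (InnerProductSpace.toDual ℝ (Euc N)).symm (a • l + b • l')
      = a • (InnerProductSpace.toDual ℝ (Euc N)).symm l
        + b • (InnerProductSpace.toDual ℝ (Euc N)).symm l' := by
    rw [map_add, map_smulₛₗ, map_smulₛₗ]; simp
  show g _ ≤ c
  rw [h2]
  refine h1.trans ?_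
  simp only [smul_eq_mul]
  calc _ ≤ a * c + b * c := by gcongr
    _ = c := by rw [← add_mul, hab, one_mul]

/-- Viscosity subsolutions of convex coercive equations are uniform limits of differentiable
approximate subsolutions. -/
theorem IsScalarSubsolution.exists_differentiable {h : Torus N → Euc N → ℝ} {f : Torus N → ℝ}
    (hsub : IsScalarSubsolution h f v) (hv : Continuous v) (hf : Continuous f)
    (hh : Continuous fun z : Torus N × Euc N => h z.1 z.2) (hconv : ∀ x, ConvexOn ℝ univ (h x))
    {C : ℝ} (hcoer : ∀ x p, ‖p‖ - C ≤ h x p) {η : ℝ} (hη : 0 < η) :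
    ∃ W : Euc N → ℝ, Differentiable ℝ W ∧ (∀ x, |W x - v (proj x)| ≤ η) ∧
      ∀ x, h (proj x) (gradient W x) ≤ f (proj x) + η := by
  obtain ⟨B, hB⟩ := isCompact_univ.exists_bound_of_continuousOn (s := (univ : Set (Torus N)))
    hf.continuousOn
  -- Coercivity and `h ≤ f ≤ B` confine the momenta that occur to this ball, so uniform continuity
  -- of `h` is needed on a compact set only.
  set R := C + B with hR
  -- uniform continuity
  obtain ⟨δ₁, hδ₁, hu₁⟩ := Metric.uniformContinuousOn_iff.1
    (((isCompact_univ (X := Torus N)).prod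
      (isCompact_closedBall (0 : Euc N) R)).uniformContinuousOn_of_continuous hh.continuousOn)
    (η / 2) (half_pos hη)
  obtain ⟨δ₂, hδ₂, hu₂⟩ := Metric.uniformContinuous_iff.1
    (CompactSpace.uniformContinuous_of_continuous hf) (η / 2) (half_pos hη)
  obtain ⟨δ₃, hδ₃, hu₃⟩ := Metric.uniformContinuous_iff.1
    (CompactSpace.uniformContinuous_of_continuous hv) η hη
  set δ := min δ₁ (min δ₂ δ₃) / 2 with hδdef
  have hδ : 0 < δ := by positivity
  obtain ⟨ε, hε, hclose⟩ := exists_supConv_close hv hδ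
  have hlip := lipschitzWith_supConv (N := N) hv hε
  set U := supConv v ε with hU
  -- The sup-convolution is differentiable only almost everywhere. Averaging its translates over a
  -- small ball makes it differentiable at every point, as needed along arbitrary curves.
  set ν : Measure (Euc N) := ProbabilityTheory.cond volume (Metric.ball 0 δ) with hν
  have hνprob : IsProbabilityMeasure ν :=
    ProbabilityTheory.cond_isProbabilityMeasure_of_finite
      (Metric.measure_ball_pos volume 0 hδ).ne' measure_ball_lt_top.ne
  have hνac : ν ≪ volume := ProbabilityTheory.cond_absolutelyContinuous
  have hball : ∀ᵐ z ∂ν, ‖z‖ < δ := by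
    have : ∀ᵐ z ∂ν, z ∈ Metric.ball (0 : Euc N) δ := ProbabilityTheory.ae_cond_mem measurableSet_ball
    simpa using this
  -- optimal points near a given point
  have hnear : ∀ x z w : Euc N, ‖z‖ < δ → IsSupConvPoint v ε (x + z) w →
      dist (proj w) (proj x) < min δ₁ (min δ₂ δ₃) := fun x z w hz hw => by
    have h1 := hclose _ _ hw
    have h2 : dist (proj (x + z)) (proj x) < δ := by
      refine (dist_proj_le _ _).trans_lt ?_
      simpa [dist_eq_norm] using hz
    have h3 := dist_triangle (proj w) (proj (x + z)) (proj x)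
    rw [dist_comm (proj w) (proj (x + z))] at h3
    linarith
  have hUv : ∀ x z : Euc N, ‖z‖ < δ → |U (x + z) - v (proj x)| ≤ η := fun x z hz => by
    obtain ⟨w, hw⟩ := exists_isSupConvPoint hv ε (x + z)
    have h1 := hw.le_supConv (x + z)
    have h2 := hu₃ (lt_of_lt_of_le (hnear x z w hz hw) ((min_le_right _ _).trans (min_le_right _ _)))
    have h3 : dist (proj (x + z)) (proj x) < δ₃ := by
      have h4 : dist (proj (x + z)) (proj x) ≤ ‖z‖ := by simpa using dist_proj_le (x + z) x
      have h5 : min δ₁ (min δ₂ δ₃) ≤ δ₃ := (min_le_right _ _).trans (min_le_right _ _)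
      linarith
    have h4 := hu₃ h3
    have h5 := hw.supConv_eq
    have h6 : 0 ≤ waveLift (x + z - w) / ε := div_nonneg (wave_nonneg _) hε.le
    rw [Real.dist_eq] at h2 h4
    have h7 : waveLift (x + z - (x + z)) / ε = 0 := by simp [waveLift]
    rw [abs_le]
    constructor <;> linarith [(abs_lt.1 h2).2, (abs_lt.1 h4).1]
  have hint : ∀ x, Integrable (fun z => U (x + z)) ν := fun x => by
    refine Integrable.of_bound (C := |v (proj x)| + η)
      (hlip.continuous.comp (continuous_const_add x)).aestronglyMeasurable ?_
    filter_upwards [hball] with z hz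
    rw [Real.norm_eq_abs]
    have := abs_add_le (U (x + z) - v (proj x)) (v (proj x))
    rw [sub_add_cancel] at this
    linarith [hUv x z hz]
  have hdiff : ∀ x, ∀ᵐ z ∂ν, DifferentiableAt ℝ U (x + z) := fun x =>
    hνac.ae_le ((measurePreserving_add_left volume x).quasiMeasurePreserving.ae
      hlip.ae_differentiableAt)
  have hder : ∀ x, Integrable (fun z => fderiv ℝ U (x + z)) ν ∧
      HasFDerivAt (fun x => ∫ z, U (x + z) ∂ν) (∫ z, fderiv ℝ U (x + z) ∂ν) x := fun x => by
    -- Differentiation under the integral at `x` needs differentiability of `U` at `x + z` for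
    -- almost every `z` only; the Lipschitz constant dominates.
    refine hasFDerivAt_integral_of_dominated_loc_of_lip (F := fun x z => U (x + z))
      (bound := fun _ => ((N * (2 * Real.pi) / ε).toNNReal : ℝ)) univ_mem
      (Eventually.of_forall fun x => (hint x).aestronglyMeasurable) (hint x)
      ((measurable_fderiv ℝ U).comp (measurable_const_add x)).aestronglyMeasurable ?_
      (integrable_const _) ?_
    · refine Eventually.of_forall fun z => ?_
      rw [Real.nnabs_coe]
      refine LipschitzWith.lipschitzOnWith ?_
      simpa [Function.comp_def] using hlip.comp (isometry_add_right z).lipschitz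
    · filter_upwards [hdiff x] with z hz
      have h1 : HasFDerivAt (fun y : Euc N => y + z) (ContinuousLinearMap.id ℝ (Euc N)) x :=
        (hasFDerivAt_id x).add_const z
      simpa [Function.comp_def] using hz.hasFDerivAt.comp x h1
  refine ⟨fun x => ∫ z, U (x + z) ∂ν, fun x => (hder x).2.differentiableAt, fun x => ?_, fun x => ?_⟩
  · have h1 : (∫ z, U (x + z) ∂ν) - v (proj x) = ∫ z, (U (x + z) - v (proj x)) ∂ν := by
      rw [integral_sub (hint x) (integrable_const _)]; simp
    rw [h1, ← Real.norm_eq_abs]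
    have := norm_integral_le_of_norm_le_const (μ := ν) (f := fun z => U (x + z) - v (proj x)) (C := η)
      (by filter_upwards [hball] with z hz using hUv x z hz)
    simpa using this
  · have hcont : Continuous (h (proj x)) := hh.comp (continuous_const.prodMk continuous_id)
    -- Jensen's inequality in geometric form: the mean of the derivatives stays in a closed convex
    -- set that contains almost all of them.
    have hmem : (∫ z, fderiv ℝ U (x + z) ∂ν) ∈ {l : Euc N →L[ℝ] ℝ |
        h (proj x) ((InnerProductSpace.toDual ℝ (Euc N)).symm l) ≤ f (proj x) + η} := by
      refine (convex_setOf_toDual_symm_le (hconv (proj x)) _).integral_mem ?_ ?_ (hder x).1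
      · exact isClosed_le (hcont.comp (LinearIsometryEquiv.continuous _)) continuous_const
      · filter_upwards [hball, hdiff x] with z hz hzd
        obtain ⟨w, hw⟩ := exists_isSupConvPoint hv ε (x + z)
        have h1 : (InnerProductSpace.toDual ℝ (Euc N)).symm (fderiv ℝ U (x + z))
            = supConvMomentum ε (x + z) w := hw.gradient_eq hv hzd
        show h (proj x) _ ≤ _
        rw [h1]
        set p := supConvMomentum ε (x + z) w
        have h2 : h (proj w) p ≤ f (proj w) := hw.hamiltonian_le hsub
        have h3 : ‖p‖ ≤ R := by
          have := hB (proj w) (mem_univ _)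
          rw [Real.norm_eq_abs] at this
          linarith [hcoer (proj w) p, le_abs_self (f (proj w))]
        have h4 := hnear x z w hz hw
        have h5 := hu₁ (proj w, p) ⟨mem_univ _, by simpa using h3⟩ (proj x, p)
          ⟨mem_univ _, by simpa using h3⟩ (by
            rw [Prod.dist_eq, dist_self, max_eq_left dist_nonneg]
            exact h4.trans_le (min_le_left _ _))
        have h6 := hu₂ (h4.trans_le ((min_le_right _ _).trans (min_le_left _ _)))
        rw [Real.dist_eq] at h5 h6
        have h5' := (abs_lt.1 h5).1
        have h6' := (abs_lt.1 h6).2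
        dsimp only at h5'
        linarith
    have : gradient (fun x => ∫ z, U (x + z) ∂ν) x
        = (InnerProductSpace.toDual ℝ (Euc N)).symm (∫ z, fderiv ℝ U (x + z) ∂ν) := by
      rw [gradient, (hder x).2.fderiv]
    rw [this]
    exact hmem

end SupConvolution

end HJSystem

end

noncomputable section

namespace HJSystem

/-! ## Curves and actions -/

lemma intervalIntegrable_of_bound {E : Type*} [NormedAddCommGroup E] {f : ℝ → E} {a b C : ℝ}
    (hf : AEStronglyMeasurable f volume) (hC : ∀ s ∈ uIcc a b, ‖f s‖ ≤ C) :
    IntervalIntegrable f volume a b := by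
  refine (intervalIntegrable_const (c := C)).mono_fun hf.restrict ?_
  filter_upwards [ae_restrict_mem measurableSet_uIoc] with s hs
  exact (hC s (uIoc_subset_uIcc hs)).trans (le_abs_self C)

/-- Integrals up to a measurable time are measurable. -/
lemma measurable_integral_upto {α E : Type*} [MeasurableSpace α] [NormedAddCommGroup E]
    [NormedSpace ℝ E] [MeasurableSpace E] [BorelSpace E] [SecondCountableTopology E]
    {f : α × ℝ → E} (hf : Measurable f)
    {τ : α → ℝ≥0} (hτ : Measurable τ) :
    Measurable fun a => ∫ s in (0 : ℝ)..τ a, f (a, s) := by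
  set S : Set (α × ℝ) := {z | 0 < z.2 ∧ z.2 ≤ τ z.1} with hSdef
  have hS : MeasurableSet S :=
    (measurableSet_lt measurable_const measurable_snd).inter
      (measurableSet_le measurable_snd (hτ.comp measurable_fst).coe_nnreal_real)
  have h : (fun a => ∫ s in (0 : ℝ)..τ a, f (a, s)) = fun a => ∫ s, S.indicator f (a, s) := by
    funext a
    rw [intervalIntegral.integral_of_le (τ a).coe_nonneg, ← integral_indicator measurableSet_Ioc]
    refine integral_congr_ae (Eventually.of_forall fun s => ?_)
    show (Ioc (0 : ℝ) (τ a)).indicator (fun s => f (a, s)) s = S.indicator f (a, s)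
    by_cases hs : s ∈ Ioc (0 : ℝ) (τ a)
    · rw [indicator_of_mem hs, indicator_of_mem (show (a, s) ∈ S from hs)]
    · rw [indicator_of_notMem hs, indicator_of_notMem (show (a, s) ∉ S from hs)]
  rw [h]
  exact (hf.indicator hS).stronglyMeasurable.integral_prod_right'.measurable

section Curve

variable {N : ℕ}

lemma measurable_eval_toNNReal :
    Measurable fun z : CadlagPath (Euc N) × ℝ => z.1.1 z.2.toNNReal :=
  measurable_eval_prod.comp (measurable_fst.prodMk measurable_snd.real_toNNReal)

lemma measurable_path_toNNReal (ξ : CadlagPath (Euc N)) :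
    Measurable fun s : ℝ => ξ.1 s.toNNReal :=
  measurable_eval_toNNReal.comp measurable_prodMk_left

lemma intervalIntegrable_path (ξ : CadlagPath (Euc N)) (a b : ℝ) :
    IntervalIntegrable (fun s : ℝ => ξ.1 s.toNNReal) volume a b := by
  obtain ⟨R, hR⟩ := exists_bound_cadlag ξ (max a b).toNNReal
  exact intervalIntegrable_of_bound (measurable_path_toNNReal ξ).aestronglyMeasurable
    fun s hs => hR _ (Real.toNNReal_le_toNNReal hs.2)

/-- The displacement `∫_0^t ξ ds`. -/
def displacement (ξ : CadlagPath (Euc N)) (t : ℝ) : Euc N := ∫ s in (0 : ℝ)..t, ξ.1 s.toNNReal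

lemma curve_eq (ξ : CadlagPath (Euc N)) (t : ℝ≥0) : curve ξ t = proj (displacement ξ t) := rfl

lemma continuous_displacement (ξ : CadlagPath (Euc N)) : Continuous (displacement ξ) :=
  intervalIntegral.continuous_primitive (intervalIntegrable_path ξ) 0

lemma continuous_curve (ξ : CadlagPath (Euc N)) : Continuous (curve ξ) :=
  continuous_proj.comp ((continuous_displacement ξ).comp NNReal.continuous_coe)

lemma continuousWithinAt_path_toNNReal {E : Type*} [TopologicalSpace E] (ξ : CadlagPath E) (t : ℝ) :
    ContinuousWithinAt (fun s : ℝ => ξ.1 s.toNNReal) (Ici t) t :=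
  ContinuousWithinAt.comp (t := Ici t.toNNReal) (ξ.2 t.toNNReal).1
    continuous_real_toNNReal.continuousWithinAt fun _ hs => Real.toNNReal_le_toNNReal hs

lemma hasDerivWithinAt_displacement (ξ : CadlagPath (Euc N)) (t : ℝ) :
    HasDerivWithinAt (displacement ξ) (ξ.1 t.toNNReal) (Ioi t) t :=
  (intervalIntegral.integral_hasDerivWithinAt_right (intervalIntegrable_path ξ 0 t)
    (s := Ici t) (t := Ioi t)
    (measurable_path_toNNReal ξ).stronglyMeasurable.stronglyMeasurableAtFilter
    ((continuousWithinAt_path_toNNReal ξ t).mono Ioi_subset_Ici_self)).mono Ioi_subset_Ici_self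

lemma measurable_curve {β : Type*} [MeasurableSpace β] {ξ : β → CadlagPath (Euc N)} {t : β → ℝ≥0}
    (hξ : Measurable ξ) (ht : Measurable t) : Measurable fun z => curve (ξ z) (t z) := by
  refine continuous_proj.measurable.comp ?_
  exact measurable_integral_upto (f := fun w : β × ℝ => (ξ w.1).1 w.2.toNNReal)
    (measurable_eval_toNNReal.comp ((hξ.comp measurable_fst).prodMk measurable_snd)) ht

variable {M : ℕ} {H : Fin M → Torus N → Euc N → ℝ} {Λ : Matrix (Fin M) (Fin M) ℝ}

lemma StandingAssumptions.measurable_lagrangian (h : StandingAssumptions H Λ) :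
    Measurable fun z : Fin M × Torus N × Euc N => lagrangian H z.1 z.2.1 z.2.2 :=
  measurable_from_prod_countable_right fun i => (h.continuous_lagrangian i).measurable

lemma measurable_index_toNNReal :
    Measurable fun z : IndexPath M × ℝ => z.1.1 z.2.toNNReal :=
  measurable_eval_prod.comp (measurable_fst.prodMk measurable_snd.real_toNNReal)

lemma StandingAssumptions.measurable_actionIntegrand (h : StandingAssumptions H Λ) (α : ℝ)
    (x : Torus N) {β : Type*} [MeasurableSpace β] {ω : β → IndexPath M}
    {ξ : β → CadlagPath (Euc N)} {s : β → ℝ} (hω : Measurable ω) (hξ : Measurable ξ)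
    (hs : Measurable s) : Measurable fun z => actionIntegrand H α x (ω z) (ξ z) (s z) := by
  have h1 : Measurable fun z => (ω z).1 (s z).toNNReal :=
    measurable_index_toNNReal.comp (hω.prodMk hs)
  have h2 : Measurable fun z => -(ξ z).1 (s z).toNNReal :=
    continuous_neg.measurable.comp (measurable_eval_toNNReal.comp (hξ.prodMk hs))
  have h3 : Measurable fun z => x + curve (ξ z) (s z).toNNReal :=
    (continuous_const_add x).measurable.comp (measurable_curve hξ hs.real_toNNReal)
  exact (h.measurable_lagrangian.comp (h1.prodMk (h3.prodMk h2))).add_const α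

/-- The action of a path in the state `i`. -/
lemma StandingAssumptions.intervalIntegrable_lagrangian (h : StandingAssumptions H Λ)
    (ω : IndexPath M) (x : Torus N) (ξ : CadlagPath (Euc N)) (a b : ℝ) :
    IntervalIntegrable (fun s : ℝ => lagrangian H (ω.1 s.toNNReal) (x + curve ξ s.toNNReal)
      (-ξ.1 s.toNNReal)) volume a b := by
  obtain ⟨R, hR⟩ := exists_bound_cadlag ξ (max a b).toNNReal
  obtain ⟨C, _, hC⟩ := h.exists_lagrangian_bound R
  have hm : Measurable fun s : ℝ => lagrangian H (ω.1 s.toNNReal) (x + curve ξ s.toNNReal)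
      (-ξ.1 s.toNNReal) := by
    have := h.measurable_actionIntegrand 0 x (measurable_const (a := ω)) (measurable_const (a := ξ))
      measurable_id
    simpa [actionIntegrand] using this
  exact intervalIntegrable_of_bound hm.aestronglyMeasurable fun s hs =>
    hC _ _ _ (by rw [norm_neg]; exact hR _ (Real.toNNReal_le_toNNReal hs.2))

/-- Along any curve, subsolutions decrease at most by the action. -/
theorem IsSubsolution.sub_le_action (h : StandingAssumptions H Λ) {α : ℝ}
    {u : Torus N → Fin M → ℝ} (hu : IsSubsolution H Λ α u) (i : Fin M) (x : Torus N)
    (ξ : CadlagPath (Euc N)) {a b : ℝ} (ha : 0 ≤ a) (hab : a ≤ b) :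
    u (x + curve ξ a.toNNReal) i - u (x + curve ξ b.toNNReal) i ≤
      ∫ s in a..b, (lagrangian H i (x + curve ξ s.toNNReal) (-ξ.1 s.toNNReal) + α
        - ∑ j, Λ i j * u (x + curve ξ s.toNNReal) j) := by
  have huc : ∀ j, Continuous fun x => u x j := fun j => (continuous_apply j).comp hu.1
  set f : Torus N → ℝ := fun x => α - ∑ j, Λ i j * u x j with hf
  have hfc : Continuous f := continuous_const.sub
    (continuous_finsetSum _ fun j _ => continuous_const.mul (huc j))
  have hscalar : IsScalarSubsolution (H i) f fun x => u x i := fun ψ hψ z hz => by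
    have := hu.2 i ψ hψ z hz
    simp only [hf]
    linarith
  obtain ⟨C, hC⟩ := h.exists_superlinear_bound i zero_le_one
  set ℓ : ℝ → ℝ := fun s => lagrangian H i (x + curve ξ s.toNNReal) (-ξ.1 s.toNNReal) with hℓ
  have hℓint : IntervalIntegrable ℓ volume a b :=
    h.intervalIntegrable_lagrangian (constPath i) x ξ a b
  set X : ℝ → Torus N := fun s => x + curve ξ s.toNNReal with hX
  have hXc : Continuous X := continuous_const.add ((continuous_curve ξ).comp continuous_real_toNNReal)
  have hfint : IntervalIntegrable (fun s => f (X s)) volume a b :=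
    (hfc.comp hXc).intervalIntegrable a b
  obtain ⟨x₀, hx₀⟩ := proj_surjective x
  set Y : ℝ → Euc N := fun s => x₀ + displacement ξ s with hY
  have hYX : ∀ s, 0 ≤ s → proj (Y s) = X s := fun s hs => by
    simp only [hY, hX]
    rw [proj_add, hx₀, curve_eq, Real.coe_toNNReal s hs]
  have hint_eq : ∫ s in a..b, (lagrangian H i (x + curve ξ s.toNNReal) (-ξ.1 s.toNNReal) + α
        - ∑ j, Λ i j * u (x + curve ξ s.toNNReal) j) = ∫ s in a..b, (ℓ s + f (X s)) :=
    intervalIntegral.integral_congr fun s _ => by simp only [hℓ, hf, hX]; ring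
  rw [hint_eq]
  refine le_of_forall_pos_le_add fun ε hε => ?_
  -- The total error is `η` at each endpoint plus `η * (b - a)` from the approximate equation.
  set η := ε / (2 + (b - a)) with hη
  have hη0 : 0 < η := div_pos hε (by linarith)
  obtain ⟨W, hWd, hWu, hWH⟩ := hscalar.exists_differentiable (huc i) hfc (h.continuous i)
    (h.convex i) (C := C) (fun x p => by simpa using hC x p) hη0
  have hYc : Continuous Y := continuous_const.add (continuous_displacement ξ)
  set D : ℝ → ℝ := fun s => fderiv ℝ W (Y s) (ξ.1 s.toNNReal) with hD
  -- the derivative along the curve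
  have hder : ∀ s, HasDerivWithinAt (fun s => W (Y s)) (D s) (Ioi s) s := fun s =>
    (hWd (Y s)).hasFDerivAt.comp_hasDerivWithinAt s
      ((hasDerivWithinAt_displacement ξ s).const_add x₀)
  obtain ⟨B, hB⟩ := isCompact_univ.exists_bound_of_continuousOn (s := (univ : Set (Torus N)))
    hfc.continuousOn
  have hgradbd : ∀ y, ‖fderiv ℝ W y‖ ≤ B + η + C := fun y => by
    have h1 := hWH y
    have h2 := hC (proj y) (gradient W y)
    have h3 := hB (proj y) (mem_univ _)
    rw [Real.norm_eq_abs] at h3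
    have h4 : ‖gradient W y‖ = ‖fderiv ℝ W y‖ := by rw [gradient, LinearIsometryEquiv.norm_map]
    rw [← h4]
    linarith [le_abs_self (f (proj y))]
  have hDint : IntervalIntegrable D volume a b := by
    obtain ⟨R, hR⟩ := exists_bound_cadlag ξ (max a b).toNNReal
    refine intervalIntegrable_of_bound (C := (B + η + C) * R) ?_ fun s hs => ?_
    · have hDeq : D = fun s => inner ℝ ((InnerProductSpace.toDual ℝ (Euc N)).symm
          (fderiv ℝ W (Y s))) (ξ.1 s.toNNReal) :=
        funext fun s => InnerProductSpace.toDual_symm_apply.symm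
      rw [hDeq]
      exact (Measurable.inner ((LinearIsometryEquiv.continuous _).measurable.comp
        ((measurable_fderiv ℝ W).comp hYc.measurable))
        (measurable_path_toNNReal ξ)).aestronglyMeasurable
    · refine (ContinuousLinearMap.le_opNorm _ _).trans ?_
      gcongr
      · exact (norm_nonneg _).trans (hgradbd (Y s))
      · exact hgradbd _
      · exact hR _ (Real.toNNReal_le_toNNReal hs.2)
  -- The velocity is only right continuous, so the curve is differentiated from the right.
  have hFTC := intervalIntegral.integral_eq_sub_of_hasDeriv_right (a := a) (b := b)
    (hWd.continuous.comp hYc).continuousOn (fun s _ => hder s) hDint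
  -- Fenchel's inequality between the momentum `DW` and the velocity `-ξ` of the cost.
  have hbound : ∀ s ∈ Icc a b, -(ℓ s + f (X s) + η) ≤ D s := fun s hs => by
    have h1 := h.inner_le i (X s) (gradient W (Y s)) (-ξ.1 s.toNNReal)
    have h2 := hWH (Y s)
    rw [hYX s (ha.trans hs.1)] at h2
    have h3 : inner ℝ (gradient W (Y s)) (-ξ.1 s.toNNReal) = - D s := by
      rw [inner_neg_right, gradient, InnerProductSpace.toDual_symm_apply]
    rw [h3] at h1
    have h4 : ℓ s = lagrangian H i (X s) (-ξ.1 s.toNNReal) := rfl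
    rw [← h4] at h1
    linarith
  have hmono := intervalIntegral.integral_mono_on hab
    ((hℓint.add hfint).add intervalIntegrable_const).neg hDint hbound
  have hsplit : ∫ s in a..b, -(ℓ s + f (X s) + η)
      = -((∫ s in a..b, (ℓ s + f (X s))) + η * (b - a)) := by
    rw [intervalIntegral.integral_neg, intervalIntegral.integral_add (hℓint.add hfint)
      intervalIntegrable_const, intervalIntegral.integral_const, smul_eq_mul, mul_comm]
  have hWa := hWu (Y a)
  have hWb := hWu (Y b)
  rw [hYX a ha] at hWa
  rw [hYX b (ha.trans hab)] at hWb
  have hWa' := (abs_le.1 hWa).1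
  have hWb' := (abs_le.1 hWb).2
  have hεη : ε = 2 * η + η * (b - a) := by
    have : 2 + (b - a) ≠ 0 := by linarith
    rw [hη]; field_simp
  have hFTC' : ∫ s in a..b, D s = W (Y b) - W (Y a) := hFTC
  have hsum : -((∫ s in a..b, (ℓ s + f (X s))) + η * (b - a)) ≤ W (Y b) - W (Y a) := by
    rw [← hsplit, ← hFTC']; exact hmono
  show u (X a) i - u (X b) i ≤ _
  linarith

/-- The coupling term of a subsolution is bounded above. -/
lemma IsSubsolution.coupling_le {α : ℝ} {u : Torus N → Fin M → ℝ} (hu : IsSubsolution H Λ α u)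
    {C : ℝ} (hC : ∀ i x p, -C ≤ H i x p) (i : Fin M) (x : Torus N) :
    ∑ j, Λ i j * u x j ≤ α + C := by
  have huc : ∀ j, Continuous fun x => u x j := fun j => (continuous_apply j).comp hu.1
  set g : Torus N → ℝ := fun x => ∑ j, Λ i j * u x j with hg
  have hgc : Continuous g := continuous_finsetSum _ fun j _ => continuous_const.mul (huc j)
  have hscalar : IsScalarSubsolution (H i) (fun x => α - g x) fun x => u x i := fun ψ hψ z hz => by
    have := hu.2 i ψ hψ z hz
    simp only [hg]
    linarith
  refine le_of_forall_pos_le_add fun ε hε => ?_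
  obtain ⟨x₀, rfl⟩ := proj_surjective x
  obtain ⟨δ, hδ, hδ'⟩ := Metric.continuous_iff.1 hgc (proj x₀) ε hε
  -- No test function need touch `u_i` at the given point. Sup-convolution supplies touching points
  -- as close to it as desired, where `H ≥ -C` bounds the coupling.
  obtain ⟨r, _, hr⟩ := exists_supConv_close (huc i) hδ
  obtain ⟨w, hw⟩ := exists_isSupConvPoint (huc i) r x₀
  have h1 := hw.hamiltonian_le hscalar
  have h2 := hC i (proj w) (supConvMomentum r x₀ w)
  have h3 := hδ' (proj w) (by rw [dist_comm]; exact hr _ _ hw)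
  rw [Real.dist_eq] at h3
  have h4 := (abs_lt.1 h3).1
  have h5 : g (proj x₀) ≤ α + C + ε := by linarith
  exact h5

end Curve

end HJSystem

end

noncomputable section

namespace HJSystem

/-! ## Oscillation bounds -/

section Oscillation

variable {M N : ℕ} {H : Fin M → Torus N → Euc N → ℝ} {Λ : Matrix (Fin M) (Fin M) ℝ}

lemma curve_constPath (q : Euc N) (t : ℝ≥0) : curve (constPath q) t = proj ((t : ℝ) • q) := by
  simp [curve]

@[simp] lemma curve_zero (ξ : CadlagPath (Euc N)) : curve ξ 0 = 0 := by
  simp [curve]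

lemma exists_torus_bound (N : ℕ) : ∃ R : ℝ, 0 ≤ R ∧ ∀ θ : Torus N, √N * ‖θ‖ ≤ R := by
  obtain ⟨B, hB⟩ := isCompact_univ.exists_bound_of_continuousOn (s := (univ : Set (Torus N)))
    continuous_id.continuousOn
  have h0 : 0 ≤ B := (norm_nonneg _).trans (hB 0 (mem_univ _))
  exact ⟨√N * B, by positivity, fun θ => by gcongr; exact hB θ (mem_univ _)⟩

/-- No nonzero entry of `Λ` leads out of the set of indices reachable from `i`, so irreducibility
forces it to be everything. -/
lemma StandingAssumptions.reachable (h : StandingAssumptions H Λ) (i j : Fin M) :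
    Relation.ReflTransGen (fun i j => Λ i j ≠ 0) i j := by
  by_contra hij
  obtain ⟨k, hk, l, hl, hkl⟩ := h.irreducible {j | Relation.ReflTransGen (fun i j => Λ i j ≠ 0) i j}
    ⟨i, Relation.ReflTransGen.refl⟩ (fun hu => hij (hu ▸ mem_univ j : j ∈ {j | _}))
  exact hl (Relation.ReflTransGen.tail hk hkl)

lemma StandingAssumptions.sum_mul_eq (h : StandingAssumptions H Λ) (i : Fin M) (f : Fin M → ℝ) :
    ∑ k, Λ i k * f k = ∑ k, Λ i k * (f k - f i) := by
  simp only [mul_sub, Finset.sum_sub_distrib, ← Finset.sum_mul, h.row_sum, zero_mul, sub_zero]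

/-- Irreducibility bounds the oscillation of a vector in terms of its coupling terms. -/
lemma StandingAssumptions.exists_osc_bound (h : StandingAssumptions H Λ) {D : ℝ} (hD : 0 ≤ D) :
    ∃ C, 0 ≤ C ∧ ∀ f : Fin M → ℝ, (∀ i, ∑ k, Λ i k * f k ≤ D) → ∀ i j, f i - f j ≤ C := by
  -- The bound is propagated along a chain of nonzero entries starting at an index `i₀` where `f` is
  -- maximal; the constant must not depend on `f`.
  have key : ∀ i₀ j, ∃ c, 0 ≤ c ∧ ∀ f : Fin M → ℝ, (∀ i, ∑ k, Λ i k * f k ≤ D) →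
      (∀ k, f k ≤ f i₀) → f i₀ - f j ≤ c := by
    intro i₀ j
    induction h.reachable i₀ j with
    | refl => exact ⟨0, le_rfl, fun f _ _ => by simp⟩
    | @tail k j _ hkj ih =>
      obtain ⟨c, hc0, hc⟩ := ih
      by_cases hne : k = j
      · subst hne; exact ⟨c, hc0, hc⟩
      have hneg : Λ k j < 0 := lt_of_le_of_ne (h.offDiag_nonpos k j hne) hkj
      -- In row `k` the entries other than `j` contribute at least `-∑ |Λ k l| * c`, since `f l - f
      -- k ≤ f i₀ - f k ≤ c`. Solving for `f k - f j` divides by `-Λ k j > 0`.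
      refine ⟨c + (D + ∑ l, |Λ k l| * c) / (-Λ k j), ?_, fun f hf hmax => ?_⟩
      · have : 0 ≤ ∑ l, |Λ k l| * c := Finset.sum_nonneg fun l _ => by positivity
        have := neg_pos.2 hneg
        positivity
      · have h1 := hc f hf hmax
        have h2 := hf k
        rw [h.sum_mul_eq, ← Finset.add_sum_erase _ _ (Finset.mem_univ j)] at h2
        have h3 : -∑ l, |Λ k l| * c ≤ ∑ l ∈ Finset.univ.erase j, Λ k l * (f l - f k) := by
          have h4 : ∑ l ∈ Finset.univ.erase j, |Λ k l| * c ≤ ∑ l, |Λ k l| * c :=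
            Finset.sum_le_sum_of_subset_of_nonneg (Finset.erase_subset _ _)
              fun l _ _ => by positivity
          refine (neg_le_neg h4).trans ?_
          rw [← Finset.sum_neg_distrib]
          refine Finset.sum_le_sum fun l _ => ?_
          by_cases hl : l = k
          · subst hl
            simp only [sub_self, mul_zero]
            exact neg_nonpos.2 (by positivity)
          · have h4 := h.offDiag_nonpos k l (Ne.symm hl)
            rw [abs_of_nonpos h4]
            have h5 : f l - f k ≤ c := by linarith [hmax l]
            nlinarith
        have h6 : -Λ k j * (f k - f j) ≤ D + ∑ l, |Λ k l| * c := by linarith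
        have h7 : f k - f j ≤ (D + ∑ l, |Λ k l| * c) / (-Λ k j) := by
          rw [le_div_iff₀ (neg_pos.2 hneg)]; linarith
        linarith
  choose c hc0 hc using key
  refine ⟨∑ i, ∑ j, c i j, Finset.sum_nonneg fun i _ => Finset.sum_nonneg fun j _ => hc0 i j,
    fun f hf i j => ?_⟩
  have : Nonempty (Fin M) := ⟨i⟩
  obtain ⟨i₀, hi₀⟩ := Finite.exists_max f
  have h1 := hc i₀ j f hf hi₀
  have h2 : c i₀ j ≤ ∑ j, c i₀ j :=
    Finset.single_le_sum (f := fun j => c i₀ j) (fun j _ => hc0 i₀ j) (Finset.mem_univ j)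
  have h3 : ∑ j, c i₀ j ≤ ∑ i, ∑ j, c i j :=
    Finset.single_le_sum (f := fun i => ∑ j, c i j)
      (fun i _ => Finset.sum_nonneg fun j _ => hc0 i j) (Finset.mem_univ i₀)
  linarith [hi₀ i]

/-- The oscillation of subsolutions is bounded, locally uniformly with respect to the level. -/
theorem StandingAssumptions.exists_subsolution_osc_bound (h : StandingAssumptions H Λ) (A : ℝ) :
    ∃ C, ∀ α ≤ A, ∀ u : Torus N → Fin M → ℝ, IsSubsolution H Λ α u →
      ∀ i j x y, u x i - u y j ≤ C := by
  obtain ⟨C₀, hC₀⟩ := h.exists_hamiltonian_lower_bound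
  obtain ⟨C₁, hC₁0, hC₁⟩ := h.exists_osc_bound (D := max (A + C₀) 0) (le_max_right _ _)
  obtain ⟨R, hR0, hR⟩ := exists_torus_bound N
  obtain ⟨C₂, hC₂0, hC₂⟩ := h.exists_lagrangian_bound R
  set K := ∑ i, ∑ j, |Λ i j| with hK
  -- The first three terms bound the action, coupling included, of the straight line from `x` to `y`
  -- in unit time with index `i`; the last pays for the change of index at `y`.
  refine ⟨C₂ + A + K * C₁ + C₁, fun α hα u hu i j x y => ?_⟩
  have hosc : ∀ x i j, u x i - u x j ≤ C₁ := fun x => hC₁ (u x) fun i =>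
    (hu.coupling_le hC₀ i x).trans ((add_le_add_left hα C₀).trans (le_max_left _ _))
  have hcoup : ∀ x, -∑ k, Λ i k * u x k ≤ K * C₁ := fun x => by
    rw [h.sum_mul_eq, ← Finset.sum_neg_distrib]
    have h1 : ∑ k, -(Λ i k * (u x k - u x i)) ≤ ∑ k, |Λ i k| * C₁ := by
      refine Finset.sum_le_sum fun k _ => ?_
      rcases eq_or_ne i k with rfl | hik
      · simp only [sub_self, mul_zero, neg_zero]; positivity
      · have h4 := h.offDiag_nonpos i k hik
        rw [abs_of_nonpos h4]
        nlinarith [hosc x k i]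
    refine h1.trans ?_
    rw [← Finset.sum_mul]
    gcongr
    exact Finset.single_le_sum (f := fun i => ∑ j, |Λ i j|)
      (fun i _ => Finset.sum_nonneg fun j _ => abs_nonneg _) (Finset.mem_univ i)
  obtain ⟨z, hz, hzn⟩ := exists_proj_eq_norm_le (y - x)
  have h1 := hu.sub_le_action h i x (constPath z) le_rfl zero_le_one
  have e0 : x + curve (constPath z) (0 : ℝ).toNNReal = x := by simp
  have e1 : x + curve (constPath z) (1 : ℝ).toNNReal = y := by
    rw [curve_constPath]; simp [hz]
  rw [e0, e1] at h1
  have h2 : ∫ s in (0 : ℝ)..1, (lagrangian H i (x + curve (constPath z) s.toNNReal)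
      (-(constPath z).1 s.toNNReal) + α
        - ∑ j, Λ i j * u (x + curve (constPath z) s.toNNReal) j) ≤ ∫ s in (0 : ℝ)..1,
          (C₂ + A + K * C₁) := by
    refine intervalIntegral.integral_mono_on zero_le_one ?_ intervalIntegrable_const fun s _ => ?_
    · refine ((h.intervalIntegrable_lagrangian (constPath i) x (constPath z) 0 1).add
        intervalIntegrable_const).sub (Continuous.intervalIntegrable ?_ 0 1)
      refine continuous_finsetSum _ fun j _ => continuous_const.mul ?_
      exact ((continuous_apply j).comp hu.1).comp
        (continuous_const.add ((continuous_curve _).comp continuous_real_toNNReal))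
    · have h3 := hC₂ i (x + curve (constPath z) s.toNNReal) (-z)
        (by rw [norm_neg]; exact hzn.trans (hR _))
      have h4 := hcoup (x + curve (constPath z) s.toNNReal)
      simp only [constPath_apply]
      linarith [le_abs_self (lagrangian H i (x + curve (constPath z) s.toNNReal) (-z))]
  simp only [intervalIntegral.integral_const, sub_zero, one_smul] at h2
  linarith [hosc y i j]

end Oscillation

end HJSystem

end

noncomputable section

namespace HJSystem

/-! ## Costs of controls -/

section Cost

variable {M N : ℕ} {H : Fin M → Torus N → Euc N → ℝ} {Λ : Matrix (Fin M) (Fin M) ℝ}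

lemma IsBoundedStoppingTime.measurable {τ : IndexPath M → ℝ≥0} (hτ : IsBoundedStoppingTime τ) :
    Measurable τ := by
  refine measurable_of_Iic fun t => (pathFiltration M).le t _ ?_
  have := hτ.1 t
  simp only [WithTop.coe_le_coe] at this
  exact this

lemma IsBoundedStoppingTime.measurableSet_le {τ : IndexPath M → ℝ≥0} (hτ : IsBoundedStoppingTime τ)
    (t : ℝ≥0) : MeasurableSet[pathFiltration M t] {ω | τ ω ≤ t} := by
  simpa only [WithTop.coe_le_coe] using hτ.1 t

lemma intervalIntegrable_actionIntegrand (h : StandingAssumptions H Λ) (α : ℝ) (x : Torus N)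
    (ω : IndexPath M) (ξ : CadlagPath (Euc N)) (a b : ℝ) :
    IntervalIntegrable (actionIntegrand H α x ω ξ) volume a b :=
  (h.intervalIntegrable_lagrangian ω x ξ a b).add intervalIntegrable_const

/-- The speed of a control is bounded up to any time. -/
lemma IsControl.exists_bound {Ξ : IndexPath M → CadlagPath (Euc N)} (hΞ : IsControl Λ Ξ) (T : ℝ≥0) :
    ∃ R, 0 ≤ R ∧ AlmostSurely Λ fun ω => ∀ s ≤ T, ‖(Ξ ω).1 s‖ ≤ R := by
  obtain ⟨R, hR0, hR⟩ := hΞ.locallyBounded (T + 1) (by positivity)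
  refine ⟨R, hR0.le, fun i => ?_⟩
  filter_upwards [hR i] with ω hω s hs
  exact (hω s (hs.trans le_self_add)).le

lemma IsControl.exists_actionIntegrand_bound (h : StandingAssumptions H Λ) (α : ℝ) (x : Torus N)
    {Ξ : IndexPath M → CadlagPath (Euc N)} (hΞ : IsControl Λ Ξ) (T : ℝ≥0) :
    ∃ C, 0 ≤ C ∧ AlmostSurely Λ fun ω => ∀ s : ℝ, s ≤ T → |actionIntegrand H α x ω (Ξ ω) s| ≤ C := by
  obtain ⟨R, _, hR⟩ := hΞ.exists_bound T
  obtain ⟨C, hC0, hC⟩ := h.exists_lagrangian_bound R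
  refine ⟨C + |α|, by positivity, fun i => ?_⟩
  filter_upwards [hR i] with ω hω s hs
  refine (abs_add_le _ _).trans (add_le_add_left (hC _ _ _ ?_) _)
  rw [norm_neg]
  exact hω _ (Real.toNNReal_le_iff_le_coe.2 hs)

lemma measurable_cost (h : StandingAssumptions H Λ) (α : ℝ) (b : Fin M → ℝ) (x : Torus N)
    {τ : IndexPath M → ℝ≥0} (hτ : Measurable τ) {Ξ : IndexPath M → CadlagPath (Euc N)}
    (hΞ : Measurable Ξ) : Measurable (cost H α b x τ Ξ) := by
  refine Measurable.add ?_ ?_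
  · exact measurable_integral_upto (f := fun z : IndexPath M × ℝ =>
      actionIntegrand H α x z.1 (Ξ z.1) z.2) (h.measurable_actionIntegrand α x measurable_fst
        (hΞ.comp measurable_fst) measurable_snd) hτ
  · exact (measurable_of_finite b).comp (measurable_eval_prod.comp (measurable_id.prodMk hτ))

lemma integrable_cost [IsRateMatrix Λ] (h : StandingAssumptions H Λ) (α : ℝ) (b : Fin M → ℝ)
    (x : Torus N) {τ : IndexPath M → ℝ≥0} (hτ : IsBoundedStoppingTime τ)
    {Ξ : IndexPath M → CadlagPath (Euc N)} (hΞ : IsControl Λ Ξ) (i : Fin M) :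
    Integrable (cost H α b x τ Ξ) (pathMeasureAt Λ i) := by
  obtain ⟨T, hT⟩ := hτ.2
  obtain ⟨C, hC0, hC⟩ := hΞ.exists_actionIntegrand_bound h α x T
  refine Integrable.of_bound (C := C * T + ∑ j, |b j|)
    (measurable_cost h α b x hτ.measurable hΞ.measurable).aestronglyMeasurable ?_
  filter_upwards [hC i] with ω hω
  refine (norm_add_le _ _).trans (add_le_add ?_ ?_)
  · have h1 := intervalIntegral.norm_integral_le_of_norm_le_const (a := 0) (b := (τ ω : ℝ)) (C := C)
      (f := actionIntegrand H α x ω (Ξ ω)) fun s hs => by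
        rw [uIoc_of_le (τ ω).coe_nonneg] at hs
        exact hω s (hs.2.trans (NNReal.coe_le_coe.2 (hT ω)))
    refine h1.trans ?_
    rw [sub_zero, abs_of_nonneg (τ ω).coe_nonneg]
    gcongr
    exact hT ω
  · exact Finset.single_le_sum (f := fun j => |b j|) (fun j _ => abs_nonneg _) (Finset.mem_univ _)

/-! ### Adaptedness -/

lemma measurable_stopped_pathFiltration (t : ℝ≥0) :
    Measurable[pathFiltration M t] (stopped t : IndexPath M → IndexPath M) := by
  refine (@measurable_cadlagPath_iff (Fin M) _ _ (IndexPath M) (pathFiltration M t) _).2 fun s => ?_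
  exact (comap_measurable (fun ω : IndexPath M => ω.1 (min s t))).mono
    (le_iSup (fun r : Iic t => MeasurableSpace.comap (fun ω : IndexPath M => ω.1 r) inferInstance)
      ⟨min s t, min_le_right s t⟩) le_rfl

lemma measurable_eval_pathFiltration (t : ℝ≥0) :
    Measurable[pathFiltration M t] fun ω : IndexPath M => ω.1 t := by
  have := (measurable_eval t).comp (measurable_stopped_pathFiltration (M := M) t)
  simpa [Function.comp_def] using this

/-- The curve of a control is adapted. -/
lemma IsControl.measurable_curve_pathFiltration {Ξ : IndexPath M → CadlagPath (Euc N)}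
    (hΞ : IsControl Λ Ξ) (t : ℝ≥0) :
    Measurable[pathFiltration M t] fun ω => curve (Ξ ω) t := by
  -- By nonanticipation the curve at `t` depends on the stopped path only, and stopping at `t` is
  -- `𝓕_t`-measurable.
  have heq : (fun ω => curve (Ξ ω) t) = (fun ω => curve (Ξ ω) t) ∘ stopped t := by
    funext ω
    rcases eq_or_ne t 0 with rfl | ht
    · simp
    · have h1 := hΞ.nonanticipating t (pos_iff_ne_zero.2 ht) ω (stopped t ω) fun s hs => by
        rw [stopped_apply, min_eq_left hs]
      simp only [Function.comp, curve]
      congr 1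
      refine intervalIntegral.integral_congr fun s hs => h1 _ ?_
      rw [uIcc_of_le t.coe_nonneg] at hs
      exact Real.toNNReal_le_iff_le_coe.2 hs.2
  rw [heq]
  exact (measurable_curve hΞ.measurable measurable_const).comp (measurable_stopped_pathFiltration t)

/-! ### The Markov property for functions -/

/-- Integrals of adapted functions over the events after the time `t`. -/
lemma setIntegral_shiftEvent [IsRateMatrix Λ] (i k : Fin M) (t : ℝ≥0) {A : Set (IndexPath M)}
    (hA : MeasurableSet A) {G : IndexPath M → ℝ} (hG : Measurable[pathFiltration M t] G) :
    ∫ ω in shiftEvent k A t, G ω ∂(pathMeasureAt Λ i)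
      = (pathMeasureAt Λ k).real A * ∫ ω in {ω | ω.1 t = k}, G ω ∂(pathMeasureAt Λ i) := by
  have hle := (pathFiltration M).le t
  have hS2 : MeasurableSet {ω : IndexPath M | ω.1 t = k} :=
    measurable_eval t (measurableSet_singleton k)
  have hext : ((pathMeasureAt Λ i).restrict (shiftEvent k A t)).trim hle
      = (pathMeasureAt Λ k A • (pathMeasureAt Λ i).restrict {ω | ω.1 t = k}).trim hle := by
    refine @Measure.ext _ (pathFiltration M t) _ _ fun B hB => ?_
    rw [trim_measurableSet_eq hle hB, trim_measurableSet_eq hle hB,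
      Measure.restrict_apply (hle _ hB), Measure.smul_apply, Measure.restrict_apply (hle _ hB),
      ← ofReal_measureReal (μ := pathMeasureAt Λ i), pathMeasureAt_inter_shiftEvent Λ i k t hB hA,
      mul_comm, ENNReal.ofReal_mul measureReal_nonneg, ofReal_measureReal, ofReal_measureReal,
      smul_eq_mul]
  have hGs : StronglyMeasurable[pathFiltration M t] G :=
    hG.stronglyMeasurable
  rw [integral_trim hle hGs, hext, ← integral_trim hle hGs, integral_smul_measure]
  rfl

/-- Given `𝓕_t`, each `G j` is frozen while the index at `t + r` has the law `e^{-rΛ}` started at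
`ω(t)`. Splitting over the indices at both times reduces this to events. -/
lemma integral_markov [IsRateMatrix Λ] (i : Fin M) (t r : ℝ≥0) {G : Fin M → IndexPath M → ℝ}
    (hG : ∀ j, Measurable[pathFiltration M t] (G j)) {C : ℝ} (hC : ∀ j ω, |G j ω| ≤ C) :
    ∫ ω, G (ω.1 (t + r)) ω ∂(pathMeasureAt Λ i)
      = ∫ ω, ∑ j, transition Λ r (ω.1 t) j * G j ω ∂(pathMeasureAt Λ i) := by
  have hle := (pathFiltration M).le t
  have hE : ∀ j, MeasurableSet {ω : IndexPath M | ω.1 r = j} := fun j =>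
    measurable_eval r (measurableSet_singleton j)
  have hS : ∀ k, MeasurableSet {ω : IndexPath M | ω.1 t = k} := fun k =>
    measurable_eval t (measurableSet_singleton k)
  have hint : ∀ j, Integrable (G j) (pathMeasureAt Λ i) := fun j =>
    Integrable.of_bound (C := C) ((hG j).mono hle le_rfl).aestronglyMeasurable
      (Eventually.of_forall fun ω => hC j ω)
  have e1 : ∀ ω : IndexPath M, G (ω.1 (t + r)) ω
      = ∑ k, ∑ j, (shiftEvent k {ω | ω.1 r = j} t).indicator (G j) ω := fun ω => by
    rw [Finset.sum_eq_single (ω.1 t), Finset.sum_eq_single (ω.1 (t + r))]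
    · rw [indicator_of_mem]; exact ⟨rfl, rfl⟩
    · intro j _ hj
      exact indicator_of_notMem (fun hmem => hj hmem.2.symm) _
    · simp
    · intro k _ hk
      exact Finset.sum_eq_zero fun j _ => indicator_of_notMem (fun hmem => hk hmem.1.symm) _
    · simp
  have e2 : ∀ ω : IndexPath M, ∑ j, transition Λ r (ω.1 t) j * G j ω
      = ∑ k, ∑ j, {ω : IndexPath M | ω.1 t = k}.indicator (fun ω => transition Λ r k j * G j ω) ω :=
    fun ω => by
      symm
      rw [Finset.sum_eq_single (ω.1 t)]
      · refine Finset.sum_congr rfl fun j _ => ?_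
        rw [indicator_of_mem]; rfl
      · intro k _ hk
        exact Finset.sum_eq_zero fun j _ => indicator_of_notMem
          (s := {ω : IndexPath M | ω.1 t = k}) (fun hmem => hk (Eq.symm hmem)) _
      · simp
  have hint1 : ∀ k j, Integrable ((shiftEvent k {ω | ω.1 r = j} t).indicator (G j))
      (pathMeasureAt Λ i) := fun k j => (hint j).indicator (measurableSet_shiftEvent k (hE j) t)
  have hint2 : ∀ k j, Integrable ({ω : IndexPath M | ω.1 t = k}.indicator
      (fun ω => transition Λ r k j * G j ω)) (pathMeasureAt Λ i) := fun k j =>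
    ((hint j).const_mul _).indicator (hS k)
  calc ∫ ω, G (ω.1 (t + r)) ω ∂(pathMeasureAt Λ i)
      = ∑ k, ∑ j, ∫ ω, (shiftEvent k {ω | ω.1 r = j} t).indicator (G j) ω
          ∂(pathMeasureAt Λ i) := by
        rw [integral_congr_ae (Eventually.of_forall e1), integral_finsetSum _ fun k _ =>
          integrable_finsetSum _ fun j _ => hint1 k j]
        exact Finset.sum_congr rfl fun k _ => integral_finsetSum _ fun j _ => hint1 k j
    _ = ∑ k, ∑ j, ∫ ω, {ω : IndexPath M | ω.1 t = k}.indicator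
          (fun ω => transition Λ r k j * G j ω) ω ∂(pathMeasureAt Λ i) := by
        refine Finset.sum_congr rfl fun k _ => Finset.sum_congr rfl fun j _ => ?_
        rw [integral_indicator (measurableSet_shiftEvent k (hE j) t), integral_indicator (hS k),
          setIntegral_shiftEvent i k t (hE j) (hG j), pathMeasureAt_real_eval, integral_const_mul]
    _ = _ := by
        rw [integral_congr_ae (Eventually.of_forall e2), integral_finsetSum _ fun k _ =>
          integrable_finsetSum _ fun j _ => hint2 k j]
        exact Finset.sum_congr rfl fun k _ => (integral_finsetSum _ fun j _ => hint2 k j).symm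

end Cost

end HJSystem

end

noncomputable section

namespace HJSystem

/-! ## Subsolutions bound the costs from below -/

section Grid

/-- The points of the grid of step `1 / (n + 1)`. -/
def gridPoint (n k : ℕ) : ℝ≥0 := k / (n + 1)

/-- The last point of the grid before `s`. -/
def lowerGrid (n : ℕ) (s : ℝ≥0) : ℝ≥0 := gridPoint n ⌊(n + 1 : ℝ≥0) * s⌋₊

lemma upperGrid_eq (n : ℕ) (s : ℝ≥0) : upperGrid n s = gridPoint n (⌊(n + 1 : ℝ≥0) * s⌋₊ + 1) := by
  simp [upperGrid, gridPoint]

lemma gridPoint_succ (n k : ℕ) : gridPoint n (k + 1) = gridPoint n k + 1 / (n + 1) := by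
  simp [gridPoint, add_div]

lemma gridPoint_lt_iff (n k : ℕ) (s : ℝ≥0) : gridPoint n k < s ↔ k < ⌈(n + 1 : ℝ≥0) * s⌉₊ := by
  rw [Nat.lt_ceil, gridPoint, div_lt_iff₀ (by positivity), mul_comm]

lemma floor_eq_of_mem (n k : ℕ) {s : ℝ≥0} (h1 : gridPoint n k ≤ s) (h2 : s < gridPoint n (k + 1)) :
    ⌊(n + 1 : ℝ≥0) * s⌋₊ = k := by
  rw [gridPoint, div_le_iff₀ (by positivity), mul_comm] at h1
  rw [gridPoint, lt_div_iff₀ (by positivity), mul_comm] at h2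
  exact (Nat.floor_eq_iff zero_le).2 ⟨h1, by simpa using h2⟩

lemma lowerGrid_le (n : ℕ) (s : ℝ≥0) : lowerGrid n s ≤ s := by
  rw [lowerGrid, gridPoint, div_le_iff₀ (by positivity), mul_comm]
  exact Nat.floor_le zero_le

lemma le_lowerGrid_add (n : ℕ) (s : ℝ≥0) : s ≤ lowerGrid n s + 1 / (n + 1) := by
  rw [lowerGrid, ← gridPoint_succ, ← upperGrid_eq]
  exact (lt_upperGrid n s).le

lemma tendsto_lowerGrid (s : ℝ≥0) : Tendsto (fun n => lowerGrid n s) atTop (𝓝 s) := by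
  have h1 : Tendsto (fun n : ℕ => s - 1 / (n + 1 : ℝ≥0)) atTop (𝓝 s) := by
    simpa using (tendsto_const_nhds (x := s)).sub
      (tendsto_one_div_add_atTop_nhds_zero_nat (𝕜 := ℝ≥0))
  exact tendsto_of_tendsto_of_tendsto_of_le_of_le h1 tendsto_const_nhds
    (fun n => tsub_le_iff_right.2 (le_lowerGrid_add n s)) fun n => lowerGrid_le n s

/-- The first point of the grid after `s`. -/
def ceilGrid (n : ℕ) (s : ℝ≥0) : ℝ≥0 := gridPoint n ⌈(n + 1 : ℝ≥0) * s⌉₊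

lemma le_ceilGrid (n : ℕ) (s : ℝ≥0) : s ≤ ceilGrid n s := by
  rw [ceilGrid, gridPoint, le_div_iff₀ (by positivity), mul_comm]
  exact Nat.le_ceil _

lemma ceilGrid_le (n : ℕ) (s : ℝ≥0) : ceilGrid n s ≤ s + 1 / (n + 1) := by
  rw [ceilGrid, gridPoint, div_le_iff₀ (by positivity), add_mul s, div_mul_cancel₀ _ (by positivity),
    mul_comm s]
  exact (Nat.ceil_lt_add_one zero_le).le

lemma ceilGrid_le_add_one (n : ℕ) (s : ℝ≥0) : ceilGrid n s ≤ s + 1 := by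
  refine (ceilGrid_le n s).trans ?_
  gcongr
  rw [div_le_one (by positivity)]
  exact le_add_self

lemma tendsto_ceilGrid (s : ℝ≥0) : Tendsto (fun n => ceilGrid n s) atTop (𝓝[≥] s) := by
  refine tendsto_nhdsWithin_iff.2 ⟨?_, Eventually.of_forall fun n => le_ceilGrid n s⟩
  refine tendsto_of_tendsto_of_tendsto_of_le_of_le tendsto_const_nhds ?_
    (fun n => le_ceilGrid n s) (fun n => ceilGrid_le n s)
  simpa using (tendsto_const_nhds (x := s)).add tendsto_one_div_add_atTop_nhds_zero_nat

lemma measurable_gridPoint (n : ℕ) : Measurable (gridPoint n) := measurable_from_nat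

lemma measurable_upperGrid (n : ℕ) : Measurable (upperGrid n) := by
  have : upperGrid n = fun s => gridPoint n (⌊(n + 1 : ℝ≥0) * s⌋₊ + 1) := funext (upperGrid_eq n)
  rw [this]
  exact (measurable_gridPoint n).comp
    ((Nat.measurable_floor.comp (measurable_const.mul measurable_id)).add_const 1)

lemma measurable_lowerGrid (n : ℕ) : Measurable (lowerGrid n) :=
  (measurable_gridPoint n).comp (Nat.measurable_floor.comp (measurable_const.mul measurable_id))

lemma measurable_ceilGrid (n : ℕ) : Measurable (ceilGrid n) :=
  (measurable_gridPoint n).comp (Nat.measurable_ceil.comp (measurable_const.mul measurable_id))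

variable {M : ℕ}

/-- The difference quotient of `e^{tΛ}` at the origin. -/
def expQuotient (Λ : Matrix (Fin M) (Fin M) ℝ) (n : ℕ) (i j : Fin M) : ℝ :=
  (n + 1) * (transition Λ (-(1 / (n + 1))) i j - (1 : Matrix (Fin M) (Fin M) ℝ) i j)

lemma tendsto_expQuotient (Λ : Matrix (Fin M) (Fin M) ℝ) (i j : Fin M) :
    Tendsto (fun n => expQuotient Λ n i j) atTop (𝓝 (Λ i j)) := by
  have h1 := (hasDerivAt_transition Λ 0 i j).tendsto_slope_zero
  have h2 : Tendsto (fun n : ℕ => -(1 / ((n : ℝ) + 1))) atTop (𝓝[≠] 0) := by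
    refine tendsto_nhdsWithin_iff.2 ⟨by simpa using
      (tendsto_one_div_add_atTop_nhds_zero_nat (𝕜 := ℝ)).neg, Eventually.of_forall fun n => ?_⟩
    have : (0 : ℝ) < 1 / ((n : ℝ) + 1) := by positivity
    exact neg_ne_zero.2 this.ne'
  have h3 := (h1.comp h2).neg
  simp only [transition_zero, mul_one, neg_neg] at h3
  refine h3.congr fun n => ?_
  simp only [Function.comp, zero_add, smul_eq_mul, expQuotient, inv_neg, one_div, inv_inv]
  ring

lemma exists_expQuotient_bound (Λ : Matrix (Fin M) (Fin M) ℝ) :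
    ∃ D, 0 ≤ D ∧ ∀ n i j, |expQuotient Λ n i j| ≤ D := by
  have h1 : ∀ i j, ∃ D, ∀ n, |expQuotient Λ n i j| ≤ D := fun i j => by
    obtain ⟨D, hD⟩ := (tendsto_expQuotient Λ i j).abs.bddAbove_range
    exact ⟨D, fun n => hD ⟨n, rfl⟩⟩
  choose D hD using h1
  have hD0 : ∀ i j, 0 ≤ D i j := fun i j => (abs_nonneg _).trans (hD i j 0)
  refine ⟨∑ i, ∑ j, D i j, Finset.sum_nonneg fun i _ => Finset.sum_nonneg fun j _ => hD0 i j,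
    fun n i j => (hD i j n).trans ?_⟩
  exact (Finset.single_le_sum (f := fun j => D i j) (fun j _ => hD0 i j) (Finset.mem_univ j)).trans
    (Finset.single_le_sum (f := fun i => ∑ j, D i j)
      (fun i _ => Finset.sum_nonneg fun j _ => hD0 i j) (Finset.mem_univ i))

end Grid

/-! ### The discretized action on one cell of the grid. -/

section LowerBound

variable {M N : ℕ} {H : Fin M → Torus N → Euc N → ℝ} {Λ : Matrix (Fin M) (Fin M) ℝ}

/-- The integrand of the action for the index frozen on the cells of a grid, with the generator
replaced by a difference quotient. -/
def gridIntegrand (H : Fin M → Torus N → Euc N → ℝ) (Λ : Matrix (Fin M) (Fin M) ℝ) (α : ℝ)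
    (u : Torus N → Fin M → ℝ) (x : Torus N) (n : ℕ) (ω : IndexPath M) (ξ : CadlagPath (Euc N))
    (s : ℝ) : ℝ :=
  (lagrangian H (ω.1 (upperGrid n s.toNNReal)) (x + curve ξ s.toNNReal) (-ξ.1 s.toNNReal) + α
    - ∑ j, Λ (ω.1 (upperGrid n s.toNNReal)) j * u (x + curve ξ s.toNNReal) j)
  + ∑ j, expQuotient Λ n (ω.1 (upperGrid n s.toNNReal)) j
      * u (x + curve ξ (lowerGrid n s.toNNReal)) j

variable {α : ℝ} {u : Torus N → Fin M → ℝ}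

lemma measurable_uncurry_of_continuous (hu : Continuous u) :
    Measurable fun z : Fin M × Torus N => u z.2 z.1 :=
  measurable_from_prod_countable_right fun i => ((continuous_apply i).comp hu).measurable

lemma exists_bound_of_continuous (hu : Continuous u) : ∃ B, 0 ≤ B ∧ ∀ x i, |u x i| ≤ B := by
  obtain ⟨B, hB⟩ := isCompact_univ.exists_bound_of_continuousOn (s := (univ : Set (Torus N)))
    hu.continuousOn
  exact ⟨B, (norm_nonneg _).trans (hB 0 (mem_univ _)),
    fun x i => (norm_le_pi_norm (u x) i).trans (hB x (mem_univ x))⟩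

lemma measurable_gridIntegrand (h : StandingAssumptions H Λ) (hu : Continuous u) (x : Torus N)
    (n : ℕ) {β : Type*} [MeasurableSpace β] {ω : β → IndexPath M} {ξ : β → CadlagPath (Euc N)}
    {s : β → ℝ} (hω : Measurable ω) (hξ : Measurable ξ) (hs : Measurable s) :
    Measurable fun z => gridIntegrand H Λ α u x n (ω z) (ξ z) (s z) := by
  have hs' := hs.real_toNNReal
  have h1 : Measurable fun z => (ω z).1 (upperGrid n (s z).toNNReal) :=
    measurable_eval_prod.comp (hω.prodMk ((measurable_upperGrid n).comp hs'))
  have h2 : Measurable fun z => -(ξ z).1 (s z).toNNReal :=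
    continuous_neg.measurable.comp (measurable_eval_toNNReal.comp (hξ.prodMk hs))
  have h3 : Measurable fun z => x + curve (ξ z) (s z).toNNReal :=
    (continuous_const_add x).measurable.comp (measurable_curve hξ hs')
  have h4 : Measurable fun z => x + curve (ξ z) (lowerGrid n (s z).toNNReal) :=
    (continuous_const_add x).measurable.comp
      (measurable_curve hξ ((measurable_lowerGrid n).comp hs'))
  have hum : ∀ j, Measurable fun x => u x j := fun j => ((continuous_apply j).comp hu).measurable
  refine Measurable.add (Measurable.sub ((h.measurable_lagrangian.comp
    (h1.prodMk (h3.prodMk h2))).add_const α) (Finset.measurable_sum _ fun j _ => ?_))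
    (Finset.measurable_sum _ fun j _ => ?_)
  · exact ((measurable_of_finite fun i => Λ i j).comp h1).mul ((hum j).comp h3)
  · exact ((measurable_of_finite fun i => expQuotient Λ n i j).comp h1).mul ((hum j).comp h4)

lemma exists_gridIntegrand_bound (h : StandingAssumptions H Λ) (hu : Continuous u) (α R : ℝ) :
    ∃ C, 0 ≤ C ∧ ∀ x n (ω : IndexPath M) (ξ : CadlagPath (Euc N)) (s : ℝ),
      ‖ξ.1 s.toNNReal‖ ≤ R → |gridIntegrand H Λ α u x n ω ξ s| ≤ C := by
  obtain ⟨B, hB0, hB⟩ := exists_bound_of_continuous hu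
  obtain ⟨D, hD0, hD⟩ := exists_expQuotient_bound Λ
  obtain ⟨C, hC0, hC⟩ := h.exists_lagrangian_bound R
  have hsum : ∀ (A : Fin M → ℝ) (E : ℝ) (y : Torus N), (∀ j, |A j| ≤ E) →
      |∑ j, A j * u y j| ≤ M * (E * B) := fun A E y hA => by
    refine (Finset.abs_sum_le_sum_abs _ _).trans ?_
    refine (Finset.sum_le_sum (g := fun _ => E * B) fun j _ => ?_).trans (by simp)
    rw [abs_mul]
    exact mul_le_mul (hA j) (hB y j) (abs_nonneg _) ((abs_nonneg _).trans (hA j))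
  set E := ∑ i, ∑ j, |Λ i j| with hE
  have hΛ : ∀ i j, |Λ i j| ≤ E := fun i j =>
    (Finset.single_le_sum (f := fun j => |Λ i j|) (fun j _ => abs_nonneg _)
      (Finset.mem_univ j)).trans (Finset.single_le_sum (f := fun i => ∑ j, |Λ i j|)
      (fun i _ => Finset.sum_nonneg fun j _ => abs_nonneg _) (Finset.mem_univ i))
  have hE0 : 0 ≤ E := Finset.sum_nonneg fun i _ => Finset.sum_nonneg fun j _ => abs_nonneg _
  refine ⟨C + |α| + M * (E * B) + M * (D * B), by positivity, fun x n ω ξ s hs => ?_⟩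
  refine (abs_add_le _ _).trans (add_le_add ((abs_sub _ _).trans (add_le_add
    ((abs_add_le _ _).trans (add_le_add ?_ le_rfl)) ?_)) ?_)
  · exact hC _ _ _ (by rwa [norm_neg])
  · exact hsum _ _ _ fun j => hΛ _ j
  · exact hsum _ _ _ fun j => hD n _ j

lemma intervalIntegrable_gridIntegrand (h : StandingAssumptions H Λ) (hu : Continuous u)
    (x : Torus N) (n : ℕ) (ω : IndexPath M) (ξ : CadlagPath (Euc N)) (a b : ℝ) :
    IntervalIntegrable (gridIntegrand H Λ α u x n ω ξ) volume a b := by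
  obtain ⟨R, hR⟩ := exists_bound_cadlag ξ (max a b).toNNReal
  obtain ⟨C, _, hC⟩ := exists_gridIntegrand_bound h hu α R
  refine intervalIntegrable_of_bound (C := C) ?_ fun s hs => ?_
  · exact (measurable_gridIntegrand h hu x n measurable_const measurable_const
      measurable_id).aestronglyMeasurable
  · exact hC _ _ _ _ _ (hR _ (Real.toNNReal_le_toNNReal hs.2))

/-- The integral over a cell of the grid. -/
lemma IsSubsolution.le_integral_cell (h : StandingAssumptions H Λ) (hu : IsSubsolution H Λ α u)
    (x : Torus N) (n k : ℕ) (ω : IndexPath M) (ξ : CadlagPath (Euc N)) :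
    ∑ j, transition Λ (-(1 / (n + 1))) (ω.1 (gridPoint n (k + 1))) j
        * u (x + curve ξ (gridPoint n k)) j
      - u (x + curve ξ (gridPoint n (k + 1))) (ω.1 (gridPoint n (k + 1)))
      ≤ ∫ s in (gridPoint n k : ℝ)..gridPoint n (k + 1), gridIntegrand H Λ α u x n ω ξ s := by
  set J := ω.1 (gridPoint n (k + 1)) with hJ
  set y := x + curve ξ (gridPoint n k) with hy
  have hle : (gridPoint n k : ℝ) ≤ gridPoint n (k + 1) := by
    rw [gridPoint_succ]; push_cast; simp only [le_add_iff_nonneg_right]; positivity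
  have hlen : (gridPoint n (k + 1) : ℝ) - gridPoint n k = 1 / (n + 1) := by
    rw [gridPoint_succ]; push_cast; ring
  -- The index is frozen at the end of the cell: its conditional law given the beginning is then a
  -- full step `e^{-Λ/(n+1)}` of the chain.
  have hD := hu.sub_le_action h J x ξ (gridPoint n k).coe_nonneg hle
  rw [Real.toNNReal_coe, Real.toNNReal_coe, ← hy] at hD
  have hint1 : IntervalIntegrable (fun s : ℝ => lagrangian H J (x + curve ξ s.toNNReal)
      (-ξ.1 s.toNNReal) + α - ∑ j, Λ J j * u (x + curve ξ s.toNNReal) j) volume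
      (gridPoint n k) (gridPoint n (k + 1)) := by
    refine ((h.intervalIntegrable_lagrangian (constPath J) x ξ _ _).add
      intervalIntegrable_const).sub (Continuous.intervalIntegrable ?_ _ _)
    refine continuous_finsetSum _ fun j _ => continuous_const.mul ?_
    exact ((continuous_apply j).comp hu.1).comp
      (continuous_const.add ((continuous_curve _).comp continuous_real_toNNReal))
  have hcongr : ∫ s in (gridPoint n k : ℝ)..gridPoint n (k + 1), gridIntegrand H Λ α u x n ω ξ s
      = ∫ s in (gridPoint n k : ℝ)..gridPoint n (k + 1),
        ((lagrangian H J (x + curve ξ s.toNNReal) (-ξ.1 s.toNNReal) + α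
          - ∑ j, Λ J j * u (x + curve ξ s.toNNReal) j) + ∑ j, expQuotient Λ n J j * u y j) := by
    -- The right endpoint is discarded because both grid functions jump to the next cell there.
    rw [intervalIntegral.integral_of_le hle, intervalIntegral.integral_of_le hle,
      integral_Ioc_eq_integral_Ioo, integral_Ioc_eq_integral_Ioo]
    refine setIntegral_congr_fun measurableSet_Ioo fun s hs => ?_
    have h1 : gridPoint n k ≤ s.toNNReal := NNReal.le_toNNReal_of_coe_le hs.1.le
    have h2 : s.toNNReal < gridPoint n (k + 1) :=
      (Real.toNNReal_lt_iff_lt_coe ((gridPoint n k).coe_nonneg.trans hs.1.le)).2 hs.2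
    have h3 := floor_eq_of_mem n k h1 h2
    simp only [gridIntegrand, upperGrid_eq, lowerGrid, h3, hJ, hy]
  rw [hcongr, intervalIntegral.integral_add hint1 intervalIntegrable_const,
    intervalIntegral.integral_const, hlen, smul_eq_mul]
  -- The cell length cancels the factor `n + 1` of the quotient and leaves `e^{Λ/(n+1)} u - u` at
  -- the beginning of the cell, with no error term.
  have hq : 1 / ((n : ℝ) + 1) * ∑ j, expQuotient Λ n J j * u y j
      = ∑ j, transition Λ (-(1 / (n + 1))) J j * u y j - u y J := by
    have h1 : u y J = ∑ j, (1 : Matrix (Fin M) (Fin M) ℝ) J j * u y j := by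
      simp [Matrix.one_apply]
    rw [h1, Finset.mul_sum, ← Finset.sum_sub_distrib]
    refine Finset.sum_congr rfl fun j _ => ?_
    rw [expQuotient]
    field_simp
  rw [hq]
  linarith

end LowerBound

end HJSystem

end

noncomputable section

namespace HJSystem

/-! ### The discretized process as a submartingale, and its limit. -/

section GridValue

variable {M N : ℕ} {H : Fin M → Torus N → Euc N → ℝ} {Λ : Matrix (Fin M) (Fin M) ℝ}
  {α : ℝ} {u : Torus N → Fin M → ℝ}

/-- The discretized action up to the time `t` plus the value of `u` at the position reached. -/
def gridValue (H : Fin M → Torus N → Euc N → ℝ) (Λ : Matrix (Fin M) (Fin M) ℝ) (α : ℝ)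
    (u : Torus N → Fin M → ℝ) (x : Torus N) (n : ℕ) (ω : IndexPath M) (ξ : CadlagPath (Euc N))
    (t : ℝ≥0) : ℝ :=
  (∫ s in (0 : ℝ)..t, gridIntegrand H Λ α u x n ω ξ s) + u (x + curve ξ t) (ω.1 t)

lemma measurable_terminal (hu : Continuous u) (x : Torus N)
    {β : Type*} [MeasurableSpace β] {ω : β → IndexPath M} {ξ : β → CadlagPath (Euc N)}
    {t : β → ℝ≥0} (hω : Measurable ω) (hξ : Measurable ξ) (ht : Measurable t) :
    Measurable fun z => u (x + curve (ξ z) (t z)) ((ω z).1 (t z)) := by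
  have h1 : Measurable fun z => (ω z).1 (t z) := measurable_eval_prod.comp (hω.prodMk ht)
  have h2 : Measurable fun z => x + curve (ξ z) (t z) :=
    (continuous_const_add x).measurable.comp (measurable_curve hξ ht)
  exact (measurable_uncurry_of_continuous hu).comp (h1.prodMk h2)

lemma measurable_gridValue (h : StandingAssumptions H Λ) (hu : Continuous u) (x : Torus N)
    (n : ℕ) {Ξ : IndexPath M → CadlagPath (Euc N)} {t : IndexPath M → ℝ≥0} (hΞ : Measurable Ξ)
    (ht : Measurable t) : Measurable fun ω => gridValue H Λ α u x n ω (Ξ ω) (t ω) := by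
  refine Measurable.add ?_ (measurable_terminal hu x measurable_id hΞ ht)
  exact measurable_integral_upto (f := fun z : IndexPath M × ℝ =>
    gridIntegrand H Λ α u x n z.1 (Ξ z.1) z.2) (measurable_gridIntegrand h hu x n measurable_fst
      (hΞ.comp measurable_fst) measurable_snd) ht

lemma IsControl.exists_gridValue_bound (h : StandingAssumptions H Λ) (hu : Continuous u) (α : ℝ)
    {Ξ : IndexPath M → CadlagPath (Euc N)} (hΞ : IsControl Λ Ξ) (T : ℝ≥0) :
    ∃ C, 0 ≤ C ∧ AlmostSurely Λ fun ω => ∀ x n, ∀ t ≤ T,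
      ‖gridValue H Λ α u x n ω (Ξ ω) t‖ ≤ C := by
  obtain ⟨R, _, hR⟩ := hΞ.exists_bound T
  obtain ⟨B, hB0, hB⟩ := exists_bound_of_continuous hu
  obtain ⟨C, hC0, hC⟩ := exists_gridIntegrand_bound (M := M) h hu α R
  refine ⟨C * T + B, by positivity, fun i => ?_⟩
  filter_upwards [hR i] with ω hω x n t ht
  refine (norm_add_le _ _).trans (add_le_add ?_ (hB _ _))
  have h1 := intervalIntegral.norm_integral_le_of_norm_le_const (a := 0) (b := (t : ℝ)) (C := C)
    (f := gridIntegrand H Λ α u x n ω (Ξ ω)) fun s hs => by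
      rw [uIoc_of_le t.coe_nonneg] at hs
      exact hC _ _ _ _ _ (hω _ (Real.toNNReal_le_iff_le_coe.2
        (hs.2.trans (NNReal.coe_le_coe.2 ht))))
  refine h1.trans ?_
  rw [sub_zero, abs_of_nonneg t.coe_nonneg]
  gcongr

lemma integrable_gridValue [IsRateMatrix Λ] (h : StandingAssumptions H Λ) (hu : Continuous u)
    (x : Torus N) (n : ℕ) {Ξ : IndexPath M → CadlagPath (Euc N)} (hΞ : IsControl Λ Ξ)
    {t : IndexPath M → ℝ≥0} (ht : Measurable t) {T : ℝ≥0} (hT : ∀ ω, t ω ≤ T) (i : Fin M) :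
    Integrable (fun ω => gridValue H Λ α u x n ω (Ξ ω) (t ω)) (pathMeasureAt Λ i) := by
  obtain ⟨C, _, hC⟩ := hΞ.exists_gridValue_bound h hu α T
  refine Integrable.of_bound (C := C)
    (measurable_gridValue h hu x n hΞ.measurable ht).aestronglyMeasurable ?_
  filter_upwards [hC i] with ω hω using hω x n _ (hT ω)

/-- The discretized process is a submartingale along the grid. -/
lemma IsSubsolution.integral_cell_nonneg [IsRateMatrix Λ] (h : StandingAssumptions H Λ)
    (hu : IsSubsolution H Λ α u) (x : Torus N) {τ : IndexPath M → ℝ≥0}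
    (hτ : IsBoundedStoppingTime τ) {Ξ : IndexPath M → CadlagPath (Euc N)} (hΞ : IsControl Λ Ξ)
    (i : Fin M) (n k : ℕ) :
    0 ≤ ∫ ω, {ω | gridPoint n k < τ ω}.indicator (fun ω =>
      gridValue H Λ α u x n ω (Ξ ω) (gridPoint n (k + 1))
        - gridValue H Λ α u x n ω (Ξ ω) (gridPoint n k)) ω ∂(pathMeasureAt Λ i) := by
  obtain ⟨B, hB0, hB⟩ := exists_bound_of_continuous hu.1
  -- Whether `τ` is still to come is known at the beginning of the cell, so this event is allowed in
  -- the Markov property there.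
  set A : Set (IndexPath M) := {ω | gridPoint n k < τ ω} with hAdef
  have hle := (pathFiltration M).le (gridPoint n k)
  have hA : MeasurableSet[pathFiltration M (gridPoint n k)] A := by
    have := (hτ.measurableSet_le (gridPoint n k)).compl
    have e : {ω | τ ω ≤ gridPoint n k}ᶜ = A := by ext ω; simp [hAdef]
    rwa [e] at this
  set P : Matrix (Fin M) (Fin M) ℝ := transition Λ (-(1 / (n + 1))) with hP
  set X : IndexPath M → Torus N := fun ω => x + curve (Ξ ω) (gridPoint n k) with hX
  have hXm : Measurable[pathFiltration M (gridPoint n k)] X :=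
    (continuous_const_add x).measurable.comp (hΞ.measurable_curve_pathFiltration _)
  -- The matrix `P = e^{Λ/(n+1)}` acts with the index at the end of the cell. Taking the expectation
  -- over the cell applies `e^{-Λ/(n+1)}`, and the two cancel to the value at its beginning.
  set G : Fin M → IndexPath M → ℝ := fun j => A.indicator fun ω => ∑ l, P j l * u (X ω) l with hG
  have hum : ∀ j, Measurable fun x => u x j := fun j => ((continuous_apply j).comp hu.1).measurable
  have hGm : ∀ j, Measurable[pathFiltration M (gridPoint n k)] (G j) := fun j =>
    Measurable.indicator (Finset.measurable_sum _ fun l _ => ((hum l).comp hXm).const_mul _) hA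
  have hGb : ∀ j ω, |G j ω| ≤ ∑ j, ∑ l, |P j l| * B := fun j ω => by
    have h0 : |∑ l, P j l * u (X ω) l| ≤ ∑ j, ∑ l, |P j l| * B := by
      refine (Finset.abs_sum_le_sum_abs _ _).trans ((Finset.sum_le_sum (g := fun l => |P j l| * B)
        fun l _ => ?_).trans (Finset.single_le_sum (f := fun j => ∑ l, |P j l| * B)
        (fun j _ => Finset.sum_nonneg fun l _ => by positivity) (Finset.mem_univ j)))
      rw [abs_mul]
      exact mul_le_mul_of_nonneg_left (hB _ _) (abs_nonneg _)
    refine le_trans ?_ h0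
    rw [hG]
    by_cases hω : ω ∈ A
    · simp [indicator_of_mem hω]
    · simp only [indicator_of_notMem hω, abs_zero]; exact abs_nonneg _
  have hmark := integral_markov (Λ := Λ) i (gridPoint n k) (1 / (n + 1)) hGm hGb
  rw [← gridPoint_succ] at hmark
  -- the value at the beginning of the cell
  set Z : IndexPath M → ℝ := A.indicator fun ω => u (X ω) (ω.1 (gridPoint n k)) with hZ
  have hsum : ∀ ω : IndexPath M, ∑ j, transition Λ ((1 / (n + 1) : ℝ≥0) : ℝ)
      (ω.1 (gridPoint n k)) j * G j ω = Z ω := fun ω => by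
    by_cases hω : ω ∈ A
    · simp only [hG, hZ, indicator_of_mem hω, hP]
      push_cast
      have h1 := transition_neg_mul Λ (1 / ((n : ℝ) + 1))
      have h2 : ∀ a, ((transition Λ (1 / ((n : ℝ) + 1)) * transition Λ (-(1 / ((n : ℝ) + 1)))).mulVec
          (u (X ω))) a = u (X ω) a := fun a => by rw [h1, Matrix.one_mulVec]
      rw [← h2 (ω.1 (gridPoint n k)), ← Matrix.mulVec_mulVec]
      rfl
    · simp [hG, hZ, indicator_of_notMem hω]
  simp only [hsum] at hmark
  have hAm : MeasurableSet A := hle _ hA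
  have hGint : Integrable (fun ω : IndexPath M => G (ω.1 (gridPoint n (k + 1))) ω)
      (pathMeasureAt Λ i) := by
    refine Integrable.of_bound (C := ∑ j, ∑ l, |P j l| * B) ?_
      (Eventually.of_forall fun ω => hGb _ ω)
    have h1 : Measurable fun z : Fin M × IndexPath M => G z.1 z.2 :=
      measurable_from_prod_countable_right fun j => (hGm j).mono hle le_rfl
    exact (h1.comp ((measurable_eval _).prodMk measurable_id)).aestronglyMeasurable
  have hZint : Integrable Z (pathMeasureAt Λ i) := by
    refine Integrable.indicator (Integrable.of_bound (C := B) ?_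
      (Eventually.of_forall fun ω => hB _ _)) hAm
    exact (measurable_terminal hu.1 x measurable_id hΞ.measurable
      measurable_const).aestronglyMeasurable
  have h0 : 0 = ∫ ω, (G (ω.1 (gridPoint n (k + 1))) ω - Z ω) ∂(pathMeasureAt Λ i) := by
    rw [integral_sub hGint hZint, hmark, sub_self]
  rw [h0]
  refine integral_mono (hGint.sub hZint) (((integrable_gridValue h hu.1 x n hΞ measurable_const
    (fun _ => le_rfl) i).sub (integrable_gridValue h hu.1 x n hΞ measurable_const
    (fun _ => le_rfl) i)).indicator hAm) fun ω => ?_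
  by_cases hω : ω ∈ A
  · simp only [hG, hZ, indicator_of_mem hω]
    have h1 := hu.le_integral_cell h x n k ω (Ξ ω)
    have h2 := intervalIntegral.integral_add_adjacent_intervals
      (intervalIntegrable_gridIntegrand (α := α) h hu.1 x n ω (Ξ ω) 0 (gridPoint n k))
      (intervalIntegrable_gridIntegrand (α := α) h hu.1 x n ω (Ξ ω) (gridPoint n k)
        (gridPoint n (k + 1)))
    simp only [gridValue, hP, hX]
    linarith
  · simp [hG, hZ, indicator_of_notMem hω]

/-- Over the cells that begin before `τ` the increments telescope to the first grid point not before
`τ`, and each has nonnegative mean. The bound on `τ` makes one finite range of cells serve all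
paths. -/
lemma IsSubsolution.le_integral_gridValue [IsRateMatrix Λ] (h : StandingAssumptions H Λ)
    (hu : IsSubsolution H Λ α u) (x : Torus N) {τ : IndexPath M → ℝ≥0}
    (hτ : IsBoundedStoppingTime τ) {Ξ : IndexPath M → CadlagPath (Euc N)} (hΞ : IsControl Λ Ξ)
    (i : Fin M) (n : ℕ) :
    u x i ≤ ∫ ω, gridValue H Λ α u x n ω (Ξ ω) (ceilGrid n (τ ω)) ∂(pathMeasureAt Λ i) := by
  obtain ⟨T, hT⟩ := hτ.2
  have hA : ∀ k, MeasurableSet {ω | gridPoint n k < τ ω} := fun k =>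
    measurableSet_lt measurable_const hτ.measurable
  have hint : ∀ k, Integrable (fun ω => gridValue H Λ α u x n ω (Ξ ω) (gridPoint n k))
      (pathMeasureAt Λ i) := fun k =>
    integrable_gridValue h hu.1 x n hΞ measurable_const (fun _ => le_rfl) i
  have htel : ∀ ω, gridValue H Λ α u x n ω (Ξ ω) (ceilGrid n (τ ω))
      = u x (ω.1 0) + ∑ k ∈ Finset.range ⌈(n + 1 : ℝ≥0) * T⌉₊,
        {ω | gridPoint n k < τ ω}.indicator (fun ω =>
          gridValue H Λ α u x n ω (Ξ ω) (gridPoint n (k + 1))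
            - gridValue H Λ α u x n ω (Ξ ω) (gridPoint n k)) ω := fun ω => by
    have h1 : ∑ k ∈ Finset.range ⌈(n + 1 : ℝ≥0) * T⌉₊,
        {ω | gridPoint n k < τ ω}.indicator (fun ω =>
          gridValue H Λ α u x n ω (Ξ ω) (gridPoint n (k + 1))
            - gridValue H Λ α u x n ω (Ξ ω) (gridPoint n k)) ω
        = ∑ k ∈ Finset.range ⌈(n + 1 : ℝ≥0) * τ ω⌉₊,
          (gridValue H Λ α u x n ω (Ξ ω) (gridPoint n (k + 1))
            - gridValue H Λ α u x n ω (Ξ ω) (gridPoint n k)) := by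
      symm
      refine Finset.sum_subset_zero_on_sdiff ?_ ?_ ?_
      · refine Finset.range_mono (Nat.ceil_mono ?_)
        gcongr
        exact hT ω
      · intro k hk
        refine indicator_of_notMem (fun hm => ?_) _
        have := (gridPoint_lt_iff n k (τ ω)).1 hm
        rw [Finset.mem_sdiff, Finset.mem_range, Finset.mem_range] at hk
        exact hk.2 this
      · intro k hk
        rw [indicator_of_mem]
        exact (gridPoint_lt_iff n k (τ ω)).2 (Finset.mem_range.1 hk)
    rw [h1, Finset.sum_range_sub fun k => gridValue H Λ α u x n ω (Ξ ω) (gridPoint n k)]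
    have h2 : gridValue H Λ α u x n ω (Ξ ω) (gridPoint n 0) = u x (ω.1 0) := by
      simp [gridValue, gridPoint]
    rw [h2]
    simp [ceilGrid]
  simp only [htel]
  have hint2 : ∀ k, Integrable ({ω | gridPoint n k < τ ω}.indicator (fun ω =>
          gridValue H Λ α u x n ω (Ξ ω) (gridPoint n (k + 1))
            - gridValue H Λ α u x n ω (Ξ ω) (gridPoint n k))) (pathMeasureAt Λ i) := fun k =>
    ((hint (k + 1)).sub (hint k)).indicator (hA k)
  have h0 : (fun ω : IndexPath M => u x (ω.1 0)) =ᵐ[pathMeasureAt Λ i] fun _ => u x i := by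
    filter_upwards [ae_eval_zero Λ i] with ω hω
    rw [hω]
  rw [integral_add ((integrable_const (u x i)).congr h0.symm)
    (integrable_finsetSum _ fun k _ => hint2 k), integral_congr_ae h0, integral_const,
    integral_finsetSum _ fun k _ => hint2 k]
  simp only [probReal_univ, one_smul, le_add_iff_nonneg_right]
  exact Finset.sum_nonneg fun k _ => hu.integral_cell_nonneg h x hτ hΞ i n k

lemma eventually_eval_eq (ω : IndexPath M) {t : ℝ≥0} {s : ℕ → ℝ≥0}
    (hs : Tendsto s atTop (𝓝[≥] t)) : ∀ᶠ n in atTop, ω.1 (s n) = ω.1 t := by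
  have := (ω.2 t).1.tendsto.comp hs
  rw [nhds_discrete, tendsto_pure] at this
  exact this

/-- The difference quotient tends to the coupling term that the deterministic estimate subtracts, so
the coupling disappears in the limit. The index settles because the grid points approach `s` from
the right. -/
lemma tendsto_gridIntegrand (hu : Continuous u) (x : Torus N) (ω : IndexPath M)
    (ξ : CadlagPath (Euc N)) (s : ℝ) :
    Tendsto (fun n => gridIntegrand H Λ α u x n ω ξ s) atTop (𝓝 (actionIntegrand H α x ω ξ s)) := by
  set j := ω.1 s.toNNReal with hj
  have h1 : Tendsto (fun n => (lagrangian H j (x + curve ξ s.toNNReal) (-ξ.1 s.toNNReal) + α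
      - ∑ l, Λ j l * u (x + curve ξ s.toNNReal) l)
      + ∑ l, expQuotient Λ n j l * u (x + curve ξ (lowerGrid n s.toNNReal)) l) atTop
      (𝓝 ((lagrangian H j (x + curve ξ s.toNNReal) (-ξ.1 s.toNNReal) + α
      - ∑ l, Λ j l * u (x + curve ξ s.toNNReal) l)
      + ∑ l, Λ j l * u (x + curve ξ s.toNNReal) l)) := by
    refine tendsto_const_nhds.add (tendsto_finsetSum _ fun l _ =>
      (tendsto_expQuotient Λ j l).mul ?_)
    have hc : Continuous fun t => u (x + curve ξ t) l :=
      ((continuous_apply l).comp hu).comp (continuous_const.add (continuous_curve ξ))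
    exact (hc.tendsto _).comp (tendsto_lowerGrid s.toNNReal)
  rw [sub_add_cancel] at h1
  refine h1.congr' ?_
  filter_upwards [eventually_eval_eq ω (tendsto_upperGrid s.toNNReal)] with n hn
  simp only [gridIntegrand, hn, hj]

/-- Dominated convergence handles the integral up to `t`; the excess up to the next grid point has
vanishing length and a bounded integrand. -/
lemma tendsto_gridValue (h : StandingAssumptions H Λ) (hu : Continuous u) (x : Torus N)
    (ω : IndexPath M) (ξ : CadlagPath (Euc N)) (t : ℝ≥0) :
    Tendsto (fun n => gridValue H Λ α u x n ω ξ (ceilGrid n t)) atTop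
      (𝓝 ((∫ s in (0 : ℝ)..t, actionIntegrand H α x ω ξ s) + u (x + curve ξ t) (ω.1 t))) := by
  obtain ⟨R, hR⟩ := exists_bound_cadlag ξ (t + 1)
  obtain ⟨C, hC0, hC⟩ := exists_gridIntegrand_bound (M := M) h hu α R
  have hbd : ∀ n (s : ℝ), s ≤ t + 1 → ‖gridIntegrand H Λ α u x n ω ξ s‖ ≤ C := fun n s hs =>
    hC _ _ _ _ _ (hR _ (Real.toNNReal_le_iff_le_coe.2 (by push_cast; exact hs)))
  refine Tendsto.add ?_ ?_
  · have h1 : Tendsto (fun n => ∫ s in (0 : ℝ)..t, gridIntegrand H Λ α u x n ω ξ s) atTop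
        (𝓝 (∫ s in (0 : ℝ)..t, actionIntegrand H α x ω ξ s)) := by
      refine intervalIntegral.tendsto_integral_filter_of_dominated_convergence (fun _ => C)
        (Eventually.of_forall fun n => ?_) (Eventually.of_forall fun n =>
          Eventually.of_forall fun s hs => ?_) intervalIntegrable_const
        (Eventually.of_forall fun s _ => tendsto_gridIntegrand hu x ω ξ s)
      · exact (measurable_gridIntegrand h hu x n measurable_const measurable_const
          measurable_id).aestronglyMeasurable
      · rw [uIoc_of_le t.coe_nonneg] at hs
        exact hbd n s (hs.2.trans (by simp))
    have h2 : Tendsto (fun n => ∫ s in (t : ℝ)..ceilGrid n t, gridIntegrand H Λ α u x n ω ξ s) atTop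
        (𝓝 0) := by
      have h3 : Tendsto (fun n => C * |((ceilGrid n t : ℝ≥0) : ℝ) - t|) atTop (𝓝 0) := by
        have h4 : Tendsto (fun n => ((ceilGrid n t : ℝ≥0) : ℝ)) atTop (𝓝 t) :=
          (NNReal.continuous_coe.tendsto t).comp
            ((tendsto_ceilGrid t).mono_right nhdsWithin_le_nhds)
        simpa using ((h4.sub_const (t : ℝ)).abs.const_mul C)
      refine squeeze_zero_norm (fun n => ?_) h3
      refine intervalIntegral.norm_integral_le_of_norm_le_const fun s hs => ?_
      rw [uIoc_of_le (NNReal.coe_le_coe.2 (le_ceilGrid n t))] at hs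
      exact hbd n s (hs.2.trans (by exact_mod_cast ceilGrid_le_add_one n t))
    have h5 := h1.add h2
    rw [add_zero] at h5
    refine h5.congr fun n => ?_
    exact intervalIntegral.integral_add_adjacent_intervals
      (intervalIntegrable_gridIntegrand h hu x n ω ξ _ _)
      (intervalIntegrable_gridIntegrand h hu x n ω ξ _ _)
  · have hc : Continuous fun s => u (x + curve ξ s) (ω.1 t) :=
      ((continuous_apply _).comp hu).comp (continuous_const.add (continuous_curve ξ))
    refine ((hc.tendsto t).comp
      ((tendsto_ceilGrid t).mono_right nhdsWithin_le_nhds)).congr' ?_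
    filter_upwards [eventually_eval_eq ω (tendsto_ceilGrid t)] with n hn
    simp only [Function.comp, hn]

/-- Subsolutions are bounded from above by the expected costs. -/
theorem IsSubsolution.le_integral [IsRateMatrix Λ] (h : StandingAssumptions H Λ)
    (hu : IsSubsolution H Λ α u) (x : Torus N) {τ : IndexPath M → ℝ≥0}
    (hτ : IsBoundedStoppingTime τ) {Ξ : IndexPath M → CadlagPath (Euc N)} (hΞ : IsControl Λ Ξ)
    (i : Fin M) :
    u x i ≤ ∫ ω, ((∫ s in (0 : ℝ)..τ ω, actionIntegrand H α x ω (Ξ ω) s)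
      + u (x + curve (Ξ ω) (τ ω)) (ω.1 (τ ω))) ∂(pathMeasureAt Λ i) := by
  obtain ⟨T, hT⟩ := hτ.2
  obtain ⟨C, _, hC⟩ := hΞ.exists_gridValue_bound h hu.1 α (T + 1)
  refine ge_of_tendsto' (x := atTop) ?_ fun n => hu.le_integral_gridValue h x hτ hΞ i n
  refine tendsto_integral_of_dominated_convergence (fun _ => C) (fun n => ?_) (integrable_const C)
    (fun n => ?_) (Eventually.of_forall fun ω => tendsto_gridValue h hu.1 x ω (Ξ ω) (τ ω))
  · exact (measurable_gridValue h hu.1 x n hΞ.measurable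
      ((measurable_ceilGrid n).comp hτ.measurable)).aestronglyMeasurable
  · filter_upwards [hC i] with ω hω
    exact hω x n _ ((ceilGrid_le_add_one n _).trans (add_le_add_left (hT ω) 1))

end GridValue

end HJSystem

end

noncomputable section

namespace HJSystem

/-! ## Bounds for the value function -/

section Bounds

variable {M N : ℕ} {H : Fin M → Torus N → Euc N → ℝ} {Λ : Matrix (Fin M) (Fin M) ℝ}

/-- Constants are subsolutions at high levels. -/
lemma StandingAssumptions.exists_isSubsolution (h : StandingAssumptions H Λ) :
    ∃ α u, IsSubsolution H Λ α u := by
  choose C hC using fun i => h.exists_hamiltonian_bound_ball i 0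
  refine ⟨∑ i, |C i|, fun _ _ => 0, continuous_const, fun i ψ hψ z hz => ?_⟩
  have hmin : IsLocalMin (fun w : Euc N => ψ (proj w)) z :=
    Eventually.of_forall fun w => by
      have := hz (proj w)
      show ψ (proj z) ≤ ψ (proj w)
      linarith
  have hgrad : gradient (fun w : Euc N => ψ (proj w)) z = 0 := by
    rw [gradient, hmin.fderiv_eq_zero, map_zero]
  rw [hgrad]
  simp only [mul_zero, Finset.sum_const_zero, add_zero]
  refine (le_abs_self _).trans (((hC i (proj z) 0 (by simp)).trans (le_abs_self _)).trans ?_)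
  exact Finset.single_le_sum (f := fun i => |C i|) (fun _ _ => abs_nonneg _) (Finset.mem_univ i)

/-- The infimum `γ` is not known to be attained, so a subsolution is only available strictly above
it. Raising the level preserves subsolutions. -/
lemma StandingAssumptions.exists_isSubsolution_add (h : StandingAssumptions H Λ) {α : ℝ}
    (hα : criticalValue H Λ ≤ α) {ε : ℝ} (hε : 0 < ε) : ∃ u, IsSubsolution H Λ (α + ε) u := by
  obtain ⟨β, ⟨u, hu⟩, hβ⟩ := exists_lt_of_csInf_lt (s := {α | ∃ u, IsSubsolution H Λ α u})
    h.exists_isSubsolution (hα.trans_lt (lt_add_of_pos_right α hε))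
  exact ⟨u, hu.1, fun i ψ hψ z hz => (hu.2 i ψ hψ z hz).trans hβ.le⟩

lemma cost_add (h : StandingAssumptions H Λ) (α ε : ℝ) (b : Fin M → ℝ) (x : Torus N)
    (τ : IndexPath M → ℝ≥0) (Ξ : IndexPath M → CadlagPath (Euc N)) (ω : IndexPath M) :
    cost H (α + ε) b x τ Ξ ω = cost H α b x τ Ξ ω + ε * τ ω := by
  have h1 : actionIntegrand H (α + ε) x ω (Ξ ω) = fun s => actionIntegrand H α x ω (Ξ ω) s + ε := by
    funext s
    simp only [actionIntegrand, add_assoc]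
  simp only [cost, h1]
  rw [intervalIntegral.integral_add (intervalIntegrable_actionIntegrand h α x ω (Ξ ω) _ _)
    intervalIntegrable_const, intervalIntegral.integral_const, sub_zero, smul_eq_mul]
  ring

/-- Above the critical value the expected costs are bounded from below. -/
theorem StandingAssumptions.exists_le_expectedCosts [IsRateMatrix Λ] (h : StandingAssumptions H Λ)
    {α : ℝ} (hα : criticalValue H Λ ≤ α) (y : Torus N) (b : Fin M → ℝ) :
    ∃ C, ∀ x i, ∀ r ∈ expectedCosts H Λ α y b x i, C ≤ r := by
  obtain ⟨C, hC⟩ := h.exists_subsolution_osc_bound (α + 1)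
  refine ⟨-C - ∑ j, |b j|, ?_⟩
  rintro x i r ⟨τ, hτ, Ξ, ⟨hΞ, hend⟩, rfl⟩
  obtain ⟨T, hT⟩ := hτ.2
  have hτint : Integrable (fun ω => (τ ω : ℝ)) (pathMeasureAt Λ i) := by
    refine Integrable.of_bound (C := T) hτ.measurable.coe_nnreal_real.aestronglyMeasurable
      (Eventually.of_forall fun ω => ?_)
    rw [Real.norm_of_nonneg (τ ω).coe_nonneg]
    exact_mod_cast hT ω
  -- Raising the level by `ε` adds `ε 𝔼 τ` to the cost. The restriction `ε ≤ 1` keeps all levels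
  -- below `α + 1`, where a single oscillation bound holds.
  have key : ∀ ε : ℝ, 0 < ε → ε ≤ 1 → -C - ∑ j, |b j| ≤
      (∫ ω, cost H α b x τ Ξ ω ∂(pathMeasureAt Λ i)) + ε * ∫ ω, (τ ω : ℝ) ∂(pathMeasureAt Λ i) := by
    intro ε hε hε1
    obtain ⟨u, hu⟩ := h.exists_isSubsolution_add hα hε
    rw [← integral_const_mul, ← integral_add (integrable_cost h α b x hτ hΞ i)
      (hτint.const_mul ε)]
    simp only [← cost_add h]
    have h1 := hu.le_integral h x hτ hΞ i
    have h2 : ∀ᵐ ω ∂(pathMeasureAt Λ i), (∫ s in (0 : ℝ)..τ ω, actionIntegrand H (α + ε) x ω (Ξ ω) s)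
        + u (x + curve (Ξ ω) (τ ω)) (ω.1 (τ ω)) = cost H (α + ε) (u y) x τ Ξ ω := by
      filter_upwards [hend i] with ω hω
      rw [hω, add_sub_cancel, cost]
    rw [integral_congr_ae h2] at h1
    -- The terminal cost `u y` is traded for `b`. Measuring `u y` against `u x i` removes the
    -- arbitrary additive constant of `u`.
    have h3 : ∫ ω, (cost H (α + ε) (u y) x τ Ξ ω - (u x i + C + ∑ j, |b j|)) ∂(pathMeasureAt Λ i)
        ≤ ∫ ω, cost H (α + ε) b x τ Ξ ω ∂(pathMeasureAt Λ i) := by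
      refine integral_mono ((integrable_cost h (α + ε) (u y) x hτ hΞ i).sub
        (integrable_const _)) (integrable_cost h _ b x hτ hΞ i)
        fun ω => ?_
      have h4 := hC (α + ε) (by linarith) u hu (ω.1 (τ ω)) i y x
      have h5 : -∑ j, |b j| ≤ b (ω.1 (τ ω)) := by
        refine neg_le.1 ((neg_le_abs _).trans ?_)
        exact Finset.single_le_sum (f := fun j => |b j|) (fun _ _ => abs_nonneg _)
          (Finset.mem_univ _)
      simp only [cost]
      linarith
    rw [integral_sub (integrable_cost h (α + ε) (u y) x hτ hΞ i) (integrable_const _),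
      integral_const] at h3
    simp only [probReal_univ, one_smul] at h3
    linarith
  set E := ∫ ω, (τ ω : ℝ) ∂(pathMeasureAt Λ i) with hE
  have hlim : Tendsto (fun ε : ℝ => (∫ ω, cost H α b x τ Ξ ω ∂(pathMeasureAt Λ i)) + ε * E)
      (𝓝[>] 0) (𝓝 ((∫ ω, cost H α b x τ Ξ ω ∂(pathMeasureAt Λ i)) + 0 * E)) :=
    (Continuous.tendsto (by fun_prop) 0).mono_left nhdsWithin_le_nhds
  rw [zero_mul, add_zero] at hlim
  refine ge_of_tendsto hlim ?_
  filter_upwards [Ioc_mem_nhdsGT zero_lt_one] with ε hε using key ε hε.1 hε.2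

lemma isBoundedStoppingTime_const (t : ℝ≥0) :
    IsBoundedStoppingTime (fun _ : IndexPath M => t) :=
  ⟨isStoppingTime_const _ _, t, fun _ => le_rfl⟩

lemma isControl_constPath (q : Euc N) : IsControl Λ fun _ => constPath q :=
  ⟨measurable_const, fun _ _ => ⟨‖q‖ + 1, by positivity, fun _ => Eventually.of_forall fun _ _ _ => by
    simp⟩, fun _ _ _ _ _ _ _ => rfl⟩

/-- The expected costs of the straight lines. -/
lemma StandingAssumptions.exists_expectedCosts_le [IsRateMatrix Λ] (h : StandingAssumptions H Λ)
    (α : ℝ) (y : Torus N) (b : Fin M → ℝ) :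
    ∃ C, ∀ x i, ∃ r ∈ expectedCosts H Λ α y b x i, r ≤ C := by
  obtain ⟨R, hR0, hR⟩ := exists_torus_bound N
  obtain ⟨C, hC0, hC⟩ := h.exists_lagrangian_bound R
  refine ⟨C + |α| + ∑ j, |b j|, fun x i => ?_⟩
  obtain ⟨z, hz, hzn⟩ := exists_proj_eq_norm_le (y - x)
  refine ⟨_, ⟨fun _ => 1, isBoundedStoppingTime_const 1, fun _ => constPath z,
    ⟨isControl_constPath z, fun _ => Eventually.of_forall fun _ => ?_⟩, rfl⟩, ?_⟩
  · rw [curve_constPath]; simp [hz]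
  · have h1 := norm_integral_le_of_norm_le_const (μ := pathMeasureAt Λ i)
      (f := cost H α b x (fun _ => 1) fun _ => constPath z) (C := C + |α| + ∑ j, |b j|)
      (Eventually.of_forall fun ω => ?_)
    · simp only [probReal_univ, mul_one] at h1
      exact (le_abs_self _).trans h1
    · refine (norm_add_le _ _).trans (add_le_add ?_ (Finset.single_le_sum (f := fun j => |b j|)
        (fun j _ => abs_nonneg _) (Finset.mem_univ _)))
      have h2 := intervalIntegral.norm_integral_le_of_norm_le_const (a := 0) (b := ((1 : ℝ≥0) : ℝ))
        (C := C + |α|) (f := actionIntegrand H α x ω (constPath z)) fun s _ =>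
          (norm_add_le _ _).trans (add_le_add (hC _ _ _ ?_) le_rfl)
      · simpa using h2
      · rw [norm_neg, constPath_apply]; exact hzn.trans (hR _)

variable {α : ℝ} {y : Torus N} {b : Fin M → ℝ}

lemma StandingAssumptions.expectedCosts_nonempty [IsRateMatrix Λ] (h : StandingAssumptions H Λ)
    (α : ℝ) (y : Torus N) (b : Fin M → ℝ) (x : Torus N) (i : Fin M) :
    (expectedCosts H Λ α y b x i).Nonempty := by
  obtain ⟨C, hC⟩ := h.exists_expectedCosts_le α y b
  obtain ⟨r, hr, _⟩ := hC x i
  exact ⟨r, hr⟩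

lemma StandingAssumptions.expectedCosts_bddBelow [IsRateMatrix Λ] (h : StandingAssumptions H Λ)
    (hα : criticalValue H Λ ≤ α) (y : Torus N) (b : Fin M → ℝ) (x : Torus N) (i : Fin M) :
    BddBelow (expectedCosts H Λ α y b x i) := by
  obtain ⟨C, hC⟩ := h.exists_le_expectedCosts hα y b
  exact ⟨C, hC x i⟩

/-- The value function is bounded. -/
lemma StandingAssumptions.exists_valueFunction_bound [IsRateMatrix Λ] (h : StandingAssumptions H Λ)
    (hα : criticalValue H Λ ≤ α) (y : Torus N) (b : Fin M → ℝ) :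
    ∃ B, 0 ≤ B ∧ ∀ x i, |valueFunction H Λ α y b x i| ≤ B := by
  obtain ⟨C, hC⟩ := h.exists_le_expectedCosts hα y b
  obtain ⟨D, hD⟩ := h.exists_expectedCosts_le α y b
  refine ⟨max |C| |D|, (abs_nonneg C).trans (le_max_left _ _), fun x i => ?_⟩
  have h1 : C ≤ valueFunction H Λ α y b x i :=
    le_csInf (h.expectedCosts_nonempty α y b x i) (hC x i)
  obtain ⟨r, hr, hrD⟩ := hD x i
  have h2 : valueFunction H Λ α y b x i ≤ D :=
    (csInf_le (h.expectedCosts_bddBelow hα y b x i) hr).trans hrD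
  exact abs_le_max_abs_abs h1 h2

end Bounds

end HJSystem

end

noncomputable section

namespace HJSystem

/-! ## The dynamic programming inequality -/

section Concat

variable {M N : ℕ} {H : Fin M → Torus N → Euc N → ℝ} {Λ : Matrix (Fin M) (Fin M) ℝ}

lemma curve_concat_of_le (t : ℝ≥0) (ξ η : CadlagPath (Euc N)) {s : ℝ≥0} (hs : s ≤ t) :
    curve (concat t ξ η) s = curve ξ s := by
  simp only [curve]
  congr 1
  rw [intervalIntegral.integral_of_le s.coe_nonneg, intervalIntegral.integral_of_le s.coe_nonneg,
    integral_Ioc_eq_integral_Ioo, integral_Ioc_eq_integral_Ioo]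
  refine setIntegral_congr_fun measurableSet_Ioo fun r hr => ?_
  have : r.toNNReal < t := ((Real.toNNReal_lt_iff_lt_coe hr.1.le).2 hr.2).trans_le hs
  simp only [concat_apply, if_pos this]

lemma concat_add (t : ℝ≥0) (ξ η : CadlagPath (Euc N)) {s : ℝ} (hs : 0 ≤ s) :
    (concat t ξ η).1 (t + s).toNNReal = η.1 s.toNNReal := by
  rw [Real.toNNReal_add t.coe_nonneg hs, Real.toNNReal_coe, concat_apply,
    if_neg (not_lt.2 le_self_add), add_tsub_cancel_left]

lemma curve_concat_add (t : ℝ≥0) (ξ η : CadlagPath (Euc N)) (s : ℝ≥0) :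
    curve (concat t ξ η) (t + s) = curve ξ t + curve η s := by
  rw [← curve_concat_of_le t ξ η le_rfl]
  simp only [curve]
  rw [← proj_add]
  congr 1
  have h1 := intervalIntegral.integral_add_adjacent_intervals
    (intervalIntegrable_path (concat t ξ η) 0 t) (intervalIntegrable_path (concat t ξ η) t (t + s))
  have h2 := intervalIntegral.integral_comp_add_left (a := 0) (b := (s : ℝ))
    (fun r : ℝ => (concat t ξ η).1 r.toNNReal) (t : ℝ)
  rw [add_zero] at h2
  push_cast
  rw [← h1, ← h2]
  congr 1
  refine intervalIntegral.integral_congr fun r hr => ?_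
  rw [uIcc_of_le s.coe_nonneg] at hr
  exact concat_add t ξ η hr.1

/-- The action of a concatenated path. -/
lemma integral_action_concat (h : StandingAssumptions H Λ) (α : ℝ) (x : Torus N) (ω : IndexPath M)
    (t s : ℝ≥0) (ξ η : CadlagPath (Euc N)) :
    ∫ r in (0 : ℝ)..(t + s : ℝ≥0), actionIntegrand H α x ω (concat t ξ η) r
      = (∫ r in (0 : ℝ)..t, actionIntegrand H α x ω ξ r)
        + ∫ r in (0 : ℝ)..s, actionIntegrand H α (x + curve ξ t) (shift t ω) η r := by
  have h1 := intervalIntegral.integral_add_adjacent_intervals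
    (intervalIntegrable_actionIntegrand h α x ω (concat t ξ η) 0 t)
    (intervalIntegrable_actionIntegrand h α x ω (concat t ξ η) t (t + s))
  have h2 := intervalIntegral.integral_comp_add_left (a := 0) (b := (s : ℝ))
    (fun r : ℝ => actionIntegrand H α x ω (concat t ξ η) r) (t : ℝ)
  rw [add_zero] at h2
  push_cast
  rw [← h1, ← h2]
  congr 1
  · rw [intervalIntegral.integral_of_le t.coe_nonneg, intervalIntegral.integral_of_le t.coe_nonneg,
      integral_Ioc_eq_integral_Ioo, integral_Ioc_eq_integral_Ioo]
    refine setIntegral_congr_fun measurableSet_Ioo fun r hr => ?_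
    have hrt : r.toNNReal < t := (Real.toNNReal_lt_iff_lt_coe hr.1.le).2 hr.2
    simp only [actionIntegrand, curve_concat_of_le t ξ η hrt.le, concat_apply, if_pos hrt]
  · refine intervalIntegral.integral_congr fun r hr => ?_
    rw [uIcc_of_le s.coe_nonneg] at hr
    have e : ((t : ℝ) + r).toNNReal = t + r.toNNReal := by
      rw [Real.toNNReal_add t.coe_nonneg hr.1, Real.toNNReal_coe]
    simp only [actionIntegrand, concat_add t ξ η hr.1]
    rw [e, curve_concat_add, shift_apply, add_assoc]

lemma measurable_shift_const {E : Type*} [TopologicalSpace E] [MeasurableSpace E]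
    [TopologicalSpace.PseudoMetrizableSpace E] [BorelSpace E] (t : ℝ≥0) :
    Measurable (shift t : CadlagPath E → CadlagPath E) :=
  measurable_shift.comp measurable_prodMk_left

/-- On the event `ω(t) = j` the shifted path has a multiple of `ℙ_j` as its law, so `ℙ_j`-null sets
pull back to null sets. -/
lemma ae_shift [IsRateMatrix Λ] {p : Fin M → IndexPath M → Prop}
    (hp : ∀ j, ∀ᵐ ω ∂(pathMeasureAt Λ j), p j ω) (i : Fin M) (t : ℝ≥0) :
    ∀ᵐ ω ∂(pathMeasureAt Λ i), p (ω.1 t) (shift t ω) := by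
  have h1 : ∀ j, ∀ᵐ ω ∂(pathMeasureAt Λ i), ω.1 t = j → p j (shift t ω) := fun j => by
    have h2 : ∀ᵐ ω ∂(((pathMeasureAt Λ i).restrict {ω | ω.1 t = j}).map (shift t)), p j ω := by
      rw [map_shift_restrict]
      exact Measure.ae_smul_measure (hp j) _
    have h3 := ae_of_ae_map (measurable_shift_const t).aemeasurable h2
    exact (ae_restrict_iff' (measurable_eval t (measurableSet_singleton j))).1 h3
  filter_upwards [ae_all_iff.2 h1] with ω hω using hω _ rfl

/-- The Markov property for expectations of functions of the shifted path. -/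
lemma integral_shift [IsRateMatrix Λ] {F : Fin M → IndexPath M → ℝ}
    (hF : ∀ j, Measurable (F j)) (hint : ∀ j, Integrable (F j) (pathMeasureAt Λ j))
    (i : Fin M) (t : ℝ≥0) :
    Integrable (fun ω => F (ω.1 t) (shift t ω)) (pathMeasureAt Λ i) ∧
    ∫ ω, F (ω.1 t) (shift t ω) ∂(pathMeasureAt Λ i)
      = ∑ j, transition Λ t i j * ∫ ω, F j ω ∂(pathMeasureAt Λ j) := by
  have hS : ∀ j, MeasurableSet {ω : IndexPath M | ω.1 t = j} := fun j =>
    measurable_eval t (measurableSet_singleton j)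
  have e : (fun ω : IndexPath M => F (ω.1 t) (shift t ω))
      = fun ω => ∑ j, {ω : IndexPath M | ω.1 t = j}.indicator (fun ω => F j (shift t ω)) ω := by
    funext ω
    rw [Finset.sum_eq_single (ω.1 t)]
    · rw [indicator_of_mem]; rfl
    · intro j _ hj
      exact indicator_of_notMem (s := {ω : IndexPath M | ω.1 t = j})
        (fun hmem => hj (Eq.symm hmem)) _
    · simp
  have hI : ∀ j, Integrable (fun ω => F j (shift t ω))
      ((pathMeasureAt Λ i).restrict {ω | ω.1 t = j}) := fun j => by
    have h1 : Integrable (F j) (((pathMeasureAt Λ i).restrict {ω | ω.1 t = j}).map (shift t)) := by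
      rw [map_shift_restrict]
      exact (hint j).smul_measure ENNReal.ofReal_ne_top
    exact h1.comp_measurable (measurable_shift_const t)
  have hI' : ∀ j, Integrable ({ω : IndexPath M | ω.1 t = j}.indicator fun ω => F j (shift t ω))
      (pathMeasureAt Λ i) := fun j => (integrable_indicator_iff (hS j)).2 (hI j)
  rw [e]
  refine ⟨integrable_finsetSum _ fun j _ => hI' j, ?_⟩
  rw [integral_finsetSum _ fun j _ => hI' j]
  refine Finset.sum_congr rfl fun j _ => ?_
  rw [integral_indicator (hS j), ← integral_map (f := F j) (measurable_shift_const t).aemeasurable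
    (hF j).aestronglyMeasurable, map_shift_restrict, integral_smul_measure,
    ENNReal.toReal_ofReal (transition_nonneg Λ i j t), smul_eq_mul]

/-- The stopping time which starts one of the `τ j` at the time `t`. -/
def restartTime (t : ℝ≥0) (τ : Fin M → IndexPath M → ℝ≥0) (ω : IndexPath M) : ℝ≥0 :=
  t + τ (ω.1 t) (shift t ω)

/-- The control which starts one of the controls `Ξ j` at the time `t`. -/
def restartControl (t : ℝ≥0) (q : Euc N) (Ξ : Fin M → IndexPath M → CadlagPath (Euc N))
    (ω : IndexPath M) : CadlagPath (Euc N) :=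
  concat t (constPath q) (Ξ (ω.1 t) (shift t ω))

lemma measurable_shift_pathFiltration (t s : ℝ≥0) :
    Measurable[pathFiltration M (t + s), pathFiltration M s]
      (shift t : IndexPath M → IndexPath M) := by
  refine measurable_iff_comap_le.2 ?_
  show MeasurableSpace.comap _ (⨆ r : Iic s, _) ≤ _
  rw [MeasurableSpace.comap_iSup]
  refine iSup_le fun r => ?_
  rw [MeasurableSpace.comap_comp]
  exact le_iSup (fun r : Iic (t + s) =>
    MeasurableSpace.comap (fun ω : IndexPath M => ω.1 r) inferInstance)
      ⟨t + r, add_le_add_right r.2 t⟩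

/-- Stopping by the time `t + r` is decided by the index at `t` and by the shifted path up to `r`,
both known at `t + r`. -/
lemma isBoundedStoppingTime_restartTime (t : ℝ≥0) {τ : Fin M → IndexPath M → ℝ≥0}
    (hτ : ∀ j, IsBoundedStoppingTime (τ j)) : IsBoundedStoppingTime (restartTime t τ) := by
  constructor
  · intro s
    simp only [WithTop.coe_le_coe]
    rcases lt_or_ge s t with hst | hst
    · have : {ω : IndexPath M | restartTime t τ ω ≤ s} = ∅ := by
        ext ω
        simp only [mem_ofPred_eq, mem_empty_iff_false, iff_false, not_le]
        exact hst.trans_le le_self_add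
      rw [this]
      exact @MeasurableSet.empty _ (pathFiltration M s)
    · obtain ⟨r, rfl⟩ := exists_add_of_le hst
      have : {ω : IndexPath M | restartTime t τ ω ≤ t + r}
          = ⋃ j, ({ω : IndexPath M | ω.1 t = j} ∩ shift t ⁻¹' {ω | τ j ω ≤ r}) := by
        ext ω
        simp [restartTime]
      rw [this]
      refine MeasurableSet.iUnion fun j => MeasurableSet.inter ?_ ?_
      · exact (pathFiltration M).mono le_self_add _
          (measurable_eval_pathFiltration t (measurableSet_singleton j))
      · exact measurable_shift_pathFiltration t r ((hτ j).measurableSet_le r)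
  · choose T hT using fun j => (hτ j).2
    refine ⟨t + ∑ j, T j, fun ω => add_le_add_right ((hT _ _).trans ?_) t⟩
    exact Finset.single_le_sum (f := T) (fun _ _ => zero_le) (Finset.mem_univ _)

/-- Two paths which agree at a time agree for a while. -/
lemma exists_eqOn_of_eval_eq {ω₁ ω₂ : IndexPath M} (h0 : ω₁.1 0 = ω₂.1 0) :
    ∃ δ : ℝ≥0, 0 < δ ∧ ∀ s ≤ δ, ω₁.1 s = ω₂.1 s := by
  have hev : ∀ ω : IndexPath M, ∀ᶠ s in 𝓝[≥] (0 : ℝ≥0), ω.1 s = ω.1 0 := fun ω => by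
    have := (ω.2 0).1.tendsto
    rw [nhds_discrete, tendsto_pure] at this
    exact this
  have h1 : ∀ᶠ s in 𝓝[≥] (0 : ℝ≥0), ω₁.1 s = ω₂.1 s := by
    filter_upwards [hev ω₁, hev ω₂] with s h1 h2
    rw [h1, h2, h0]
  obtain ⟨δ, hδ, hsub⟩ := (mem_nhdsGE_iff_exists_Icc_subset (a := (0 : ℝ≥0))).1 h1
  exact ⟨δ, hδ, fun s hs => hsub ⟨zero_le, hs⟩⟩

/-- Nonanticipation is postulated at positive times only, but paths with the same initial index
agree on a short interval, the index set being discrete. -/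
lemma IsControl.eval_zero_eq {Ξ : IndexPath M → CadlagPath (Euc N)} (hΞ : IsControl Λ Ξ)
    {ω₁ ω₂ : IndexPath M} (h0 : ω₁.1 0 = ω₂.1 0) : (Ξ ω₁).1 0 = (Ξ ω₂).1 0 := by
  obtain ⟨δ, hδ, h1⟩ := exists_eqOn_of_eval_eq h0
  exact hΞ.nonanticipating δ hδ ω₁ ω₂ h1 0 zero_le

lemma isControl_restartControl [IsRateMatrix Λ] (t : ℝ≥0) (q : Euc N)
    {Ξ : Fin M → IndexPath M → CadlagPath (Euc N)} (hΞ : ∀ j, IsControl Λ (Ξ j)) :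
    IsControl Λ (restartControl t q Ξ) := by
  refine ⟨measurable_cadlagPath_iff.2 fun s => ?_, fun T hT => ?_, fun T hT ω₁ ω₂ hω s hs => ?_⟩
  · have h1 : Measurable fun z : Fin M × IndexPath M => (Ξ z.1 z.2).1 (s - t) :=
      measurable_from_prod_countable_right fun j => (measurable_eval _).comp (hΞ j).measurable
    have h2 : Measurable fun ω : IndexPath M => (Ξ (ω.1 t) (shift t ω)).1 (s - t) :=
      h1.comp ((measurable_eval t).prodMk (measurable_shift_const t))
    simp only [restartControl, concat_apply]
    split_ifs
    · exact measurable_const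
    · exact h2
  -- After `t` only the control of the index reached is used, under the law started at that index;
  -- the finitely many bounds are added.
  · choose R hR0 hR using fun j => (hΞ j).exists_bound T
    refine ⟨‖q‖ + ∑ j, R j + 1, ?_, fun i => ?_⟩
    · have := Finset.sum_nonneg (s := Finset.univ) fun j _ => hR0 j
      positivity
    · filter_upwards [ae_shift (fun j => hR j j) i t] with ω hω s hs
      have hsum : R (ω.1 t) ≤ ∑ j, R j :=
        Finset.single_le_sum (f := R) (fun j _ => hR0 j) (Finset.mem_univ _)
      have h0 := hR0 (ω.1 t)
      simp only [restartControl, concat_apply]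
      split_ifs
      · simp only [constPath_apply]; linarith
      · have := hω (s - t) (tsub_le_self.trans hs)
        linarith [norm_nonneg q]
  · simp only [restartControl, concat_apply]
    split_ifs with hst
    · rfl
    · rw [not_lt] at hst
      have htT := hst.trans hs
      rw [hω t htT]
      have h0 : (shift t ω₁).1 0 = (shift t ω₂).1 0 := by simp [hω t htT]
      -- At `s = t` the restarted control is evaluated at time `0`, the case outside the
      -- nonanticipation hypothesis.
      rcases hst.eq_or_lt with rfl | hst
      · rw [tsub_self]
        exact (hΞ _).eval_zero_eq h0
      · refine (hΞ _).nonanticipating (s - t) (tsub_pos_of_lt hst) _ _ (fun r hr => ?_) _ le_rfl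
        refine hω _ ((add_le_add_right hr t).trans ?_)
        rw [add_tsub_cancel_of_le hst.le]
        exact hs

variable {α : ℝ}

/-- The dynamic programming inequality for motions with a constant velocity. -/
theorem StandingAssumptions.valueFunction_le [IsRateMatrix Λ] (h : StandingAssumptions H Λ)
    (hα : criticalValue H Λ ≤ α) (y : Torus N) (b : Fin M → ℝ) (x : Torus N) (i : Fin M)
    (t : ℝ≥0) (q : Euc N) :
    valueFunction H Λ α y b x i ≤
      (∫ ω, (∫ s in (0 : ℝ)..t, actionIntegrand H α x ω (constPath q) s) ∂(pathMeasureAt Λ i))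
        + ∑ j, transition Λ t i j * valueFunction H Λ α y b (x + proj ((t : ℝ) • q)) j := by
  set x' := x + proj ((t : ℝ) • q) with hx'
  refine le_of_forall_pos_le_add fun ε hε => ?_
  -- With constant velocity the position at `t` is the deterministic point `x'`, so one nearly
  -- optimal pair per index suffices and no measurable selection is needed.
  have hex : ∀ j, ∃ r ∈ expectedCosts H Λ α y b x' j, r < valueFunction H Λ α y b x' j + ε :=
    fun j => exists_lt_of_csInf_lt (h.expectedCosts_nonempty α y b x' j) (lt_add_of_pos_right _ hε)
  choose r hr hrε using hex
  choose τ hτ Ξ hΞ hrΞ using hr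
  have hmem : (∫ ω, cost H α b x (restartTime t τ) (restartControl t q Ξ) ω ∂(pathMeasureAt Λ i))
      ∈ expectedCosts H Λ α y b x i := by
    refine ⟨_, isBoundedStoppingTime_restartTime t hτ, _,
      ⟨isControl_restartControl t q fun j => (hΞ j).1, fun k => ?_⟩, rfl⟩
    filter_upwards [ae_shift (fun j => (hΞ j).2 j) k t] with ω hω
    rw [restartControl, restartTime, curve_concat_add, hω, curve_constPath, hx']
    abel
  have hcost : ∀ ω, cost H α b x (restartTime t τ) (restartControl t q Ξ) ω
      = (∫ s in (0 : ℝ)..t, actionIntegrand H α x ω (constPath q) s)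
        + cost H α b x' (τ (ω.1 t)) (Ξ (ω.1 t)) (shift t ω) := fun ω => by
    simp only [cost, restartTime, restartControl]
    rw [integral_action_concat h, curve_constPath, add_assoc, shift_apply]
  obtain ⟨hI, hE⟩ := integral_shift (Λ := Λ) (F := fun j => cost H α b x' (τ j) (Ξ j))
    (fun j => measurable_cost h α b x' (hτ j).measurable (hΞ j).1.measurable)
    (fun j => integrable_cost h α b x' (hτ j) (hΞ j).1 j) i t
  have hI0 : Integrable (fun ω => ∫ s in (0 : ℝ)..t, actionIntegrand H α x ω (constPath q) s)
      (pathMeasureAt Λ i) := by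
    have := integrable_cost h α 0 x (isBoundedStoppingTime_const t)
      (isControl_constPath (Λ := Λ) q) i
    exact this.congr (Eventually.of_forall fun ω => by simp [cost])
  refine (csInf_le (h.expectedCosts_bddBelow hα y b x i) hmem).trans ?_
  simp only [hcost]
  rw [integral_add hI0 hI, hE, add_assoc]
  refine add_le_add_right ?_ _
  have h1 : ∑ j, transition Λ t i j * (∫ ω, cost H α b x' (τ j) (Ξ j) ω ∂(pathMeasureAt Λ j))
      ≤ ∑ j, transition Λ t i j * (valueFunction H Λ α y b x' j + ε) :=
    Finset.sum_le_sum fun j _ => mul_le_mul_of_nonneg_left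
      ((hrΞ j).symm.le.trans (hrε j).le) (transition_nonneg Λ i j t)
  refine h1.trans_eq ?_
  simp only [mul_add, Finset.sum_add_distrib, ← Finset.sum_mul, sum_transition, one_mul]

end Concat

end HJSystem

end

noncomputable section

namespace HJSystem

/-! ## Regularity of the value function and the viscosity inequality -/

section ValueFunction

variable {M N : ℕ} {H : Fin M → Torus N → Euc N → ℝ} {Λ : Matrix (Fin M) (Fin M) ℝ} {α : ℝ}

/-- Mean value inequality: the entries of `-Λ e^{-tΛ}` are bounded by `∑ |Λ i j|`, since those of a
stochastic matrix are at most `1`. -/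
lemma exists_transition_sub_one_bound (Λ : Matrix (Fin M) (Fin M) ℝ) [IsRateMatrix Λ] :
    ∃ D, 0 ≤ D ∧ ∀ (t : ℝ≥0) i j,
      |transition Λ t i j - (1 : Matrix (Fin M) (Fin M) ℝ) i j| ≤ D * t := by
  refine ⟨∑ i, ∑ j, |Λ i j|, Finset.sum_nonneg fun _ _ => Finset.sum_nonneg fun _ _ =>
    abs_nonneg _, fun t i j => ?_⟩
  have hle : ∀ (s : ℝ≥0) k, |transition Λ s k j| ≤ 1 := fun s k => by
    rw [abs_of_nonneg (transition_nonneg Λ k j s), ← sum_transition Λ k s]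
    exact Finset.single_le_sum (f := fun j => transition Λ s k j)
      (fun j _ => transition_nonneg Λ k j s) (Finset.mem_univ j)
  have hder : ∀ s ∈ Ici (0 : ℝ), ‖-(Λ * transition Λ s) i j‖ ≤ ∑ i, ∑ j, |Λ i j| := fun s hs => by
    rw [norm_neg, Matrix.mul_apply]
    refine (Finset.abs_sum_le_sum_abs _ _).trans ((Finset.sum_le_sum
      (g := fun k => |Λ i k|) fun k _ => ?_).trans (Finset.single_le_sum
      (f := fun i => ∑ j, |Λ i j|) (fun i _ => Finset.sum_nonneg fun j _ => abs_nonneg _)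
      (Finset.mem_univ i)))
    rw [abs_mul]
    exact mul_le_of_le_one_right (abs_nonneg _) (hle ⟨s, hs⟩ k)
  have := (convex_Ici (0 : ℝ)).norm_image_sub_le_of_norm_hasDerivWithin_le
    (fun s _ => (hasDerivAt_transition Λ s i j).hasDerivWithinAt) hder (mem_Ici.2 le_rfl)
    (mem_Ici.2 t.coe_nonneg)
  rw [transition_zero, sub_zero, Real.norm_of_nonneg t.coe_nonneg] at this
  exact this

lemma sum_transition_mul (Λ : Matrix (Fin M) (Fin M) ℝ) (t : ℝ) (i : Fin M) (f : Fin M → ℝ) :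
    ∑ j, transition Λ t i j * f j
      = f i + ∑ j, (transition Λ t i j - (1 : Matrix (Fin M) (Fin M) ℝ) i j) * f j := by
  simp [sub_mul, Matrix.one_apply]

lemma norm_action_constPath_le {C : ℝ} (q : Euc N)
    (hC : ∀ i x, |lagrangian H i x (-q)| ≤ C) (α : ℝ) (x : Torus N) (t : ℝ≥0) (ω : IndexPath M) :
    ‖∫ s in (0 : ℝ)..t, actionIntegrand H α x ω (constPath q) s‖ ≤ (C + |α|) * t := by
  have h2 := intervalIntegral.norm_integral_le_of_norm_le_const (a := 0) (b := (t : ℝ))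
    (C := C + |α|) (f := actionIntegrand H α x ω (constPath q)) fun s _ =>
      (norm_add_le _ _).trans (add_le_add (hC _ _) le_rfl)
  simpa using h2

/-- The value function is Lipschitz continuous. -/
theorem StandingAssumptions.lipschitz_valueFunction [IsRateMatrix Λ] (h : StandingAssumptions H Λ)
    (hα : criticalValue H Λ ≤ α) (y : Torus N) (b : Fin M → ℝ) :
    ∃ K : ℝ≥0, LipschitzWith K (valueFunction H Λ α y b) := by
  obtain ⟨B, hB0, hB⟩ := h.exists_valueFunction_bound hα y b
  obtain ⟨C, hC0, hC⟩ := h.exists_lagrangian_bound 1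
  obtain ⟨D, hD0, hD⟩ := exists_transition_sub_one_bound Λ
  set E : ℝ := (C + |α|) + M * (D * B) with hE
  have hE0 : 0 ≤ E := by positivity
  have key : ∀ x x' i, valueFunction H Λ α y b x i - valueFunction H Λ α y b x' i
      ≤ E * √N * dist x x' := by
    intro x x' i
    obtain ⟨z, hz, hzn⟩ := exists_proj_eq_norm_le (x' - x)
    rw [← dist_eq_norm, dist_comm] at hzn
    -- Unit speed during a time equal to the distance makes both the action and the effect of the
    -- jumps proportional to the distance. For `z = 0` the time is `0` as well.
    set t : ℝ≥0 := ‖z‖₊ with ht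
    set q : Euc N := ‖z‖⁻¹ • z with hq
    have hq1 : ‖q‖ ≤ 1 := by
      rw [hq, norm_smul, norm_inv, norm_norm]
      exact inv_mul_le_one
    have htq : (t : ℝ) • q = z := by
      rcases eq_or_ne z 0 with rfl | hz0
      · simp [ht]
      · show ‖z‖ • (‖z‖⁻¹ • z) = z
        rw [smul_smul, mul_inv_cancel₀ (norm_ne_zero_iff.2 hz0), one_smul]
    have h1 := h.valueFunction_le hα y b x i t q
    rw [htq, hz, add_sub_cancel, sum_transition_mul] at h1
    have h2 : (∫ ω, (∫ s in (0 : ℝ)..t, actionIntegrand H α x ω (constPath q) s)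
        ∂(pathMeasureAt Λ i)) ≤ (C + |α|) * t := by
      have := norm_integral_le_of_norm_le_const (μ := pathMeasureAt Λ i) (Eventually.of_forall
        (norm_action_constPath_le q (fun i x => hC i x (-q) (by rwa [norm_neg])) α x t))
      rw [probReal_univ, mul_one] at this
      exact (le_abs_self _).trans this
    have h3 : ∑ j, (transition Λ t i j - (1 : Matrix (Fin M) (Fin M) ℝ) i j)
        * valueFunction H Λ α y b x' j ≤ M * (D * B) * t := by
      refine (Finset.sum_le_sum (g := fun _ => D * t * B) fun j _ => ?_).trans_eq ?_
      · refine (le_abs_self _).trans ?_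
        rw [abs_mul]
        exact mul_le_mul (hD t i j) (hB x' j) (abs_nonneg _) (by positivity)
      · simp only [Finset.sum_const, Finset.card_univ, Fintype.card_fin, nsmul_eq_mul]
        ring
    have h4 : (t : ℝ) ≤ √N * dist x x' := hzn
    calc valueFunction H Λ α y b x i - valueFunction H Λ α y b x' i ≤ E * t := by
          rw [hE, add_mul]; linarith
      _ ≤ E * (√N * dist x x') := by gcongr
      _ = E * √N * dist x x' := by ring
  refine ⟨(E * √N).toNNReal, LipschitzWith.of_dist_le_mul fun x x' => ?_⟩
  rw [Real.coe_toNNReal _ (by positivity)]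
  refine (dist_pi_le_iff (by positivity)).2 fun i => ?_
  rw [Real.dist_eq, abs_le]
  have h1 := key x x' i
  have h2 := key x' x i
  rw [dist_comm] at h2
  exact ⟨by linarith, h1⟩

/-- Up to the first jump the index is still `i` and the integrand is continuous, so the mean tends
to its value at time `0`. -/
lemma StandingAssumptions.tendsto_mean_action_path (h : StandingAssumptions H Λ)
    (α : ℝ) (x : Torus N) (q : Euc N) {i : Fin M} {ω : IndexPath M} (hω : ω.1 0 = i)
    {t : ℕ → ℝ≥0} (ht0 : ∀ n, 0 < t n) (ht : Tendsto t atTop (𝓝 0)) :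
    Tendsto (fun n => (t n : ℝ)⁻¹ * ∫ s in (0 : ℝ)..t n,
      actionIntegrand H α x ω (constPath q) s) atTop (𝓝 (lagrangian H i x (-q) + α)) := by
  set f : ℝ → ℝ := actionIntegrand H α x ω (constPath q) with hf
  have hfm : Measurable f := h.measurable_actionIntegrand α x (measurable_const (a := ω))
    (measurable_const (a := constPath q)) measurable_id
  have h6 : f 0 = lagrangian H i x (-q) + α := by simp [hf, actionIntegrand, hω]
  have hcont : ContinuousWithinAt f (Ici 0) 0 := by
    have h1 : ∀ᶠ s in 𝓝[≥] (0 : ℝ), ω.1 s.toNNReal = i := by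
      have := (continuousWithinAt_path_toNNReal ω 0).tendsto
      rw [nhds_discrete, tendsto_pure, Real.toNNReal_zero, hω] at this
      exact this
    have hc : Continuous fun s : ℝ => lagrangian H i (x + curve (constPath q) s.toNNReal) (-q)
        + α := by
      have hX : Continuous fun s : ℝ => x + curve (constPath q) s.toNNReal :=
        continuous_const.add ((continuous_curve _).comp continuous_real_toNNReal)
      have hg : Continuous fun s : ℝ => (x + curve (constPath q) s.toNNReal, -q) :=
        hX.prodMk continuous_const
      exact ((h.continuous_lagrangian i).comp hg).add continuous_const
    refine hc.continuousWithinAt.congr_of_eventuallyEq ?_ ?_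
    · filter_upwards [h1] with s hs
      simp only [hf, actionIntegrand, hs, constPath_apply]
    · simp only [hf, actionIntegrand, Real.toNNReal_zero, hω, constPath_apply]
  have hder : HasDerivWithinAt (fun s => ∫ r in (0 : ℝ)..s, f r) (f 0) (Ici 0) 0 :=
    intervalIntegral.integral_hasDerivWithinAt_right
      (intervalIntegrable_actionIntegrand h α x ω (constPath q) 0 0) (s := Ici 0) (t := Ioi 0)
      hfm.stronglyMeasurable.stronglyMeasurableAtFilter (hcont.mono Ioi_subset_Ici_self)
  have h3 := (hasDerivWithinAt_iff_tendsto_slope' self_notMem_Ioi).1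
    (hder.mono Ioi_subset_Ici_self)
  have h4 : Tendsto (fun n => (t n : ℝ)) atTop (𝓝[>] 0) :=
    tendsto_nhdsWithin_iff.2 ⟨(NNReal.continuous_coe.tendsto 0).comp ht,
      Eventually.of_forall fun n => ht0 n⟩
  have h5 := h3.comp h4
  rw [h6] at h5
  refine h5.congr fun n => ?_
  simp [slope_def_module]

/-- The mean action of a short motion with a constant velocity. -/
lemma StandingAssumptions.tendsto_mean_action [IsRateMatrix Λ] (h : StandingAssumptions H Λ)
    (α : ℝ) (x : Torus N) (q : Euc N) (i : Fin M) {t : ℕ → ℝ≥0} (ht0 : ∀ n, 0 < t n)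
    (ht : Tendsto t atTop (𝓝 0)) :
    Tendsto (fun n => (t n : ℝ)⁻¹ * ∫ ω, (∫ s in (0 : ℝ)..t n,
      actionIntegrand H α x ω (constPath q) s) ∂(pathMeasureAt Λ i)) atTop
      (𝓝 (lagrangian H i x (-q) + α)) := by
  obtain ⟨C, hC0, hC⟩ := h.exists_lagrangian_bound ‖q‖
  have hlim : Tendsto (fun n => ∫ ω, (t n : ℝ)⁻¹ * (∫ s in (0 : ℝ)..t n,
      actionIntegrand H α x ω (constPath q) s) ∂(pathMeasureAt Λ i)) atTop
      (𝓝 (∫ _, (lagrangian H i x (-q) + α) ∂(pathMeasureAt Λ i))) := by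
    refine tendsto_integral_of_dominated_convergence (fun _ => C + |α|) (fun n => ?_)
      (integrable_const _) (fun n => Eventually.of_forall fun ω => ?_) ?_
    · have := measurable_cost h α 0 x (measurable_const (a := t n))
        (measurable_const (a := constPath q) (α := CadlagPath (Euc N)) (β := IndexPath M))
      have e : cost H α 0 x (fun _ => t n) (fun _ : IndexPath M => constPath q)
          = fun ω => ∫ s in (0 : ℝ)..t n, actionIntegrand H α x ω (constPath q) s :=
        funext fun ω => by simp [cost]
      rw [e] at this
      exact (this.const_mul _).aestronglyMeasurable
    · have h1 := norm_action_constPath_le q (fun i x => hC i x (-q) (norm_neg q).le) α x (t n) ω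
      have h2 : (0 : ℝ) < t n := ht0 n
      rw [norm_mul, norm_inv, Real.norm_of_nonneg h2.le, inv_mul_le_iff₀ h2]
      linarith
    · filter_upwards [ae_eval_zero Λ i] with ω hω using h.tendsto_mean_action_path α x q hω ht0 ht
  simpa [integral_const_mul] using hlim

/-- The value function is a subsolution. -/
theorem StandingAssumptions.isSubsolution_valueFunction [IsRateMatrix Λ]
    (h : StandingAssumptions H Λ) (hα : criticalValue H Λ ≤ α) (y : Torus N) (b : Fin M → ℝ) :
    IsSubsolution H Λ α (valueFunction H Λ α y b) := by
  obtain ⟨K, hK⟩ := h.lipschitz_valueFunction hα y b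
  have hc := hK.continuous
  refine ⟨hc, fun i ψ hψ z hz => ?_⟩
  set v := valueFunction H Λ α y b with hv
  set Ψ : Euc N → ℝ := fun w => ψ (proj w) with hΨ
  -- Dynamic programming for the velocity `q` and a short time `t`, with the increment of `v_i`
  -- bounded by that of the test function, then divided by `t`.
  have key : ∀ q : Euc N, 0 ≤ lagrangian H i (proj z) (-q) + α
      - ∑ j, Λ i j * v (proj z) j + inner ℝ (gradient Ψ z) q := by
    intro q
    set t : ℕ → ℝ≥0 := fun n => 1 / (n + 1) with ht
    have ht0 : ∀ n, 0 < t n := fun n => by positivity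
    have htlim : Tendsto t atTop (𝓝 0) := tendsto_one_div_add_atTop_nhds_zero_nat
    have htR : Tendsto (fun n => (t n : ℝ)) atTop (𝓝 0) :=
      (NNReal.continuous_coe.tendsto 0).comp htlim
    have htne : Tendsto (fun n => (t n : ℝ)) atTop (𝓝[≠] 0) :=
      tendsto_nhdsWithin_iff.2 ⟨htR, Eventually.of_forall fun n => by
        have : (0 : ℝ) < t n := ht0 n
        exact this.ne'⟩
    have h1 := h.tendsto_mean_action (Λ := Λ) α (proj z) q i ht0 htlim
    -- The weights `e^{-tΛ} - 1` are of order `t`, so continuity of `v` suffices in this sum; the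
    -- test function is needed only for the increment of `v_i`, which carries weight `1`.
    have h2 : Tendsto (fun n => ∑ j, ((t n : ℝ)⁻¹ * (transition Λ (t n) i j
        - (1 : Matrix (Fin M) (Fin M) ℝ) i j)) * v (proj (z + (t n : ℝ) • q)) j) atTop
        (𝓝 (∑ j, (-Λ i j) * v (proj z) j)) := by
      refine tendsto_finsetSum _ fun j _ => Tendsto.mul ?_ ?_
      · have h3 := (hasDerivAt_transition Λ 0 i j).tendsto_slope_zero.comp htne
        simpa [Function.comp_def] using h3
      · have hcz : Continuous fun s : ℝ => v (proj (z + s • q)) j :=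
          ((continuous_apply j).comp hc).comp (continuous_proj.comp (by fun_prop))
        have := (hcz.tendsto 0).comp htR
        simpa [Function.comp_def] using this
    have h3 : Tendsto (fun n => (t n : ℝ)⁻¹ * (Ψ (z + (t n : ℝ) • q) - Ψ z)) atTop
        (𝓝 (inner ℝ (gradient Ψ z) q)) := by
      have hd : HasFDerivAt Ψ (fderiv ℝ Ψ z) z := (hψ.differentiable one_ne_zero z).hasFDerivAt
      have hl : HasDerivAt (fun s : ℝ => Ψ (z + s • q)) (fderiv ℝ Ψ z q) 0 := by
        have hline : HasDerivAt (fun s : ℝ => z + s • q) q 0 := by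
          simpa using ((hasDerivAt_id (0 : ℝ)).smul_const q).const_add z
        refine HasFDerivAt.comp_hasDerivAt (0 : ℝ) (l := Ψ) ?_ hline
        simpa using hd
      have h4 := hl.tendsto_slope_zero.comp htne
      rw [gradient, InnerProductSpace.toDual_symm_apply]
      simpa [Function.comp_def] using h4
    have hlim := (h1.add h2).add h3
    have hnn := ge_of_tendsto' hlim (b := 0) fun n => ?_
    · simp only [neg_mul, Finset.sum_neg_distrib] at hnn
      linarith
    · have h5 := h.valueFunction_le hα y b (proj z) i (t n) q
      rw [← proj_add, sum_transition_mul, ← hv] at h5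
      have h6 := hz (proj (z + (t n : ℝ) • q))
      have h7 : (0 : ℝ) ≤ (t n : ℝ)⁻¹ := by positivity
      simp only [mul_assoc, ← Finset.mul_sum, ← mul_add]
      refine mul_nonneg h7 ?_
      simp only [hΨ]
      linarith
  -- The inequality for the velocity `-q`, with `q` nearly optimal in the dual formula for `H`, is
  -- the viscosity inequality up to `ε`.
  refine le_of_forall_pos_le_add fun ε hε => ?_
  obtain ⟨q, hq⟩ := h.exists_sub_lagrangian_ge i (proj z) (gradient Ψ z) hε
  have h1 := key (-q)
  rw [neg_neg, inner_neg_right] at h1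
  linarith

end ValueFunction

end HJSystem

end

theorem theorem5p2 {M N : ℕ} (H : Fin M → Torus N → Euc N → ℝ) (Λ : Matrix (Fin M) (Fin M) ℝ)
    (hHΛ : StandingAssumptions H Λ) (α : ℝ) (hα : criticalValue H Λ ≤ α)
    (y : Torus N) (b : Fin M → ℝ) :
    -- the expected costs are well defined
    (∀ (x : Torus N) (τ : IndexPath M → ℝ≥0), IsBoundedStoppingTime τ →
      ∀ Ξ ∈ controlsTo (N := N) Λ τ (y - x),
        (∀ ω, IntervalIntegrable (actionIntegrand H α x ω (Ξ ω)) volume 0 (τ ω)) ∧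
        ∀ i, Integrable (cost H α b x τ Ξ) (pathMeasureAt Λ i)) ∧
    -- their infimum is finite
    (∀ (x : Torus N) (i : Fin M),
      (expectedCosts H Λ α y b x i).Nonempty ∧ BddBelow (expectedCosts H Λ α y b x i)) ∧
    -- the value function is a Lipschitz continuous subsolution
    (∃ K : ℝ≥0, LipschitzWith K (valueFunction H Λ α y b)) ∧
    IsSubsolution H Λ α (valueFunction H Λ α y b) := by
  have := hHΛ.isRateMatrix
  refine ⟨fun x τ hτ Ξ hΞ => ⟨fun ω => intervalIntegrable_actionIntegrand hHΛ α x ω (Ξ ω) _ _,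
    fun i => integrable_cost hHΛ α b x hτ hΞ.1 i⟩, fun x i =>
    ⟨hHΛ.expectedCosts_nonempty α y b x i, hHΛ.expectedCosts_bddBelow hα y b x i⟩,
    hHΛ.lipschitz_valueFunction hα y b, hHΛ.isSubsolution_valueFunction hα y b⟩
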